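/- Let $d\in\{2,3\}$, $p\in(2,\infty)$, $\theta>0$ and let $k_{max}\ge 0$ be an integer. There is a constant $C=C(d,p,\theta,k_{max})>0$ such that the following holds. Let $K\subset\mathbb R^d$ be a closed nondegenerate triangle ($d=2$) or tetrahedron ($d=3$), of diameter $h_K$, with minimum angle at least $\theta$; for a tetrahedron this means that all angles of its triangular faces and all its dihedral angles are at least $\theta$. Let $e$ be an edge (resp. face) of $K$, and let $n$ be the unit normal to $e$ pointing out of $K$. Then, for every symmetric tensor field $\tau\in L^p(K)^{d\times d}_{sym}$ whose distributional (row-wise) divergence $\mathrm{div}\,\tau$ belongs to $L^2(K)^d$, and for every vector field $v$ on $K$ whose components are polynomials of degree $\le k_{max}$, the integral $\int_e v\cdot(\tau n)\,ds$ is well defined and $$\int_e v\cdot(\tau n)\,ds\;\le\; C\,h_K^{-1/2}\,\|v\|_{0,e}\,\Big(h_K\,\|\mathrm{div}\,\tau\|_{0,K}+h_K^{\frac{d(p-2)}{2p}}\,\|\tau\|_{0,p,K}\Big).$$ Here $\|\cdot\|_{0,e}$ and $\|\cdot\|_{0,K}$ are the $L^2$ norms on $e$ (with respect to the $(d-1)$-dimensional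 surface measure) and on $K$, and $\|\cdot\|_{0,p,K}$ is the $L^p(K)$ norm, with the Frobenius norm on matrices. The integral $\int_e v\cdot(\tau n)\,ds$ is understood in the sense of normal traces, by density: there are tensor fields $\sigma_m$, smooth up to the boundary of $K$, with $\sigma_m\to\tau$ in $L^p(K)$ and $\mathrm{div}\,\sigma_m\to\mathrm{div}\,\tau$ in $L^2(K)$, and for every such sequence the ordinary surface integrals $\int_e v\cdot(\sigma_m n)\,ds$ converge to the same real number, which is the value of $\int_e v\cdot(\tau n)\,ds$. -/

import Mathlib

open MeasureTheory Filter Topology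
open scoped ContDiff

noncomputable section

namespace FaceTrace

variable {d : ℕ}

/-- The entries of a matrix as a Euclidean vector, whose norm is the Frobenius norm of `A`. -/
def entries (A : Matrix (Fin d) (Fin d) ℝ) : EuclideanSpace ℝ (Fin d × Fin d) :=
  WithLp.toLp 2 fun ab => A ab.1 ab.2

/-- The unit normal of the face of `K` opposite to the vertex `i`, pointing out of `K`:
the normalized vector from the vertex `i` to the foot of its altitude. -/
def outwardNormal [NeZero d] (K : Affine.Simplex ℝ (EuclideanSpace ℝ (Fin d)) d)
    (i : Fin (d + 1)) : EuclideanSpace ℝ (Fin d) :=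
  (‖K.altitudeFoot i - K.points i‖)⁻¹ • (K.altitudeFoot i - K.points i)

/-- The interior dihedral angle between the faces of `K` opposite to the vertices `i ≠ j`
(for a triangle, this is the angle at the third vertex). -/
def dihedralAngle [NeZero d] (K : Affine.Simplex ℝ (EuclideanSpace ℝ (Fin d)) d)
    (i j : Fin (d + 1)) : ℝ :=
  Real.pi - InnerProductGeometry.angle (outwardNormal K i) (outwardNormal K j)

/-- The minimum angle of the triangle or tetrahedron `K` is at least `θ`: all the angles of its
two-dimensional faces (of `K` itself, if `K` is a triangle) and all its dihedral angles
are at least `θ`. -/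
def MinAngleGE [NeZero d] (K : Affine.Simplex ℝ (EuclideanSpace ℝ (Fin d)) d) (θ : ℝ) : Prop :=
  (∀ i j k : Fin (d + 1), i ≠ j → j ≠ k → i ≠ k →
      θ ≤ EuclideanGeometry.angle (K.points i) (K.points j) (K.points k)) ∧
    ∀ i j : Fin (d + 1), i ≠ j → θ ≤ dihedralAngle K i j

/-- The diameter `h_K`. -/
def diam (K : Affine.Simplex ℝ (EuclideanSpace ℝ (Fin d)) d) : ℝ :=
  Metric.diam K.closedInterior

/-- Lebesgue measure on `K`. -/
def vol (K : Affine.Simplex ℝ (EuclideanSpace ℝ (Fin d)) d) :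
    Measure (EuclideanSpace ℝ (Fin d)) :=
  volume.restrict K.closedInterior

/-- The `(d - 1)`-dimensional surface measure on the face of `K` opposite to the vertex `i`. -/
def surf [NeZero d] (K : Affine.Simplex ℝ (EuclideanSpace ℝ (Fin d)) d) (i : Fin (d + 1)) :
    Measure (EuclideanSpace ℝ (Fin d)) :=
  (Measure.euclideanHausdorffMeasure (d - 1)).restrict (K.faceOpposite i).closedInterior

/-- The partial derivative of `f` at `x` in the `j`-th coordinate. -/
def pderiv (j : Fin d) (f : EuclideanSpace ℝ (Fin d) → ℝ) (x : EuclideanSpace ℝ (Fin d)) : ℝ :=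
  fderiv ℝ f x (EuclideanSpace.single j 1)

/-- The classical (row-wise) divergence of a tensor field:
`(div σ) a = ∑ b, ∂ σ a b / ∂ x b`. -/
def classicalDiv (σ : EuclideanSpace ℝ (Fin d) → Matrix (Fin d) (Fin d) ℝ)
    (x : EuclideanSpace ℝ (Fin d)) : EuclideanSpace ℝ (Fin d) :=
  WithLp.toLp 2 fun a => ∑ b, pderiv b (fun y => σ y a b) x

/-- `g` is the (row-wise) divergence of `τ` on `K` in the sense of distributions. -/
def HasWeakDiv (K : Affine.Simplex ℝ (EuclideanSpace ℝ (Fin d)) d)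
    (τ : EuclideanSpace ℝ (Fin d) → Matrix (Fin d) (Fin d) ℝ)
    (g : EuclideanSpace ℝ (Fin d) → EuclideanSpace ℝ (Fin d)) : Prop :=
  ∀ φ : EuclideanSpace ℝ (Fin d) → ℝ, ContDiff ℝ ∞ φ → HasCompactSupport φ →
    tsupport φ ⊆ interior K.closedInterior →
    ∀ a, ∫ x, (∑ b, τ x a b * pderiv b φ x) ∂(vol K) = -∫ x, g x a * φ x ∂(vol K)

/-- The vector `A n`. -/
def mulVec (A : Matrix (Fin d) (Fin d) ℝ) (n : EuclideanSpace ℝ (Fin d)) :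
    EuclideanSpace ℝ (Fin d) :=
  WithLp.toLp 2 (A.mulVec n.ofLp)

/-- The vector field with polynomial components `q`. -/
def polyField (q : Fin d → MvPolynomial (Fin d) ℝ) (x : EuclideanSpace ℝ (Fin d)) :
    EuclideanSpace ℝ (Fin d) :=
  WithLp.toLp 2 fun a => MvPolynomial.eval x.ofLp (q a)

/-- The classical surface integral of `v · (σ n)` over the face opposite to the vertex `i`. -/
def classicalFlux [NeZero d] (K : Affine.Simplex ℝ (EuclideanSpace ℝ (Fin d)) d)
    (i : Fin (d + 1)) (σ : EuclideanSpace ℝ (Fin d) → Matrix (Fin d) (Fin d) ℝ)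
    (v : EuclideanSpace ℝ (Fin d) → EuclideanSpace ℝ (Fin d)) : ℝ :=
  ∫ x, inner ℝ (v x) (mulVec (σ x) (outwardNormal K i)) ∂(surf K i)

/-- `σ n` are smooth tensor fields (up to the boundary of `K`) with `σ n → τ` in `L^p(K)` and
`div (σ n) → g` in `L²(K)`. -/
structure SmoothApprox (p : ENNReal) (K : Affine.Simplex ℝ (EuclideanSpace ℝ (Fin d)) d)
    (τ : EuclideanSpace ℝ (Fin d) → Matrix (Fin d) (Fin d) ℝ)
    (g : EuclideanSpace ℝ (Fin d) → EuclideanSpace ℝ (Fin d))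
    (σ : ℕ → EuclideanSpace ℝ (Fin d) → Matrix (Fin d) (Fin d) ℝ) : Prop where
  smooth : ∀ n a b, ContDiff ℝ ∞ fun x => σ n x a b
  tendsto_field : Tendsto (fun n => eLpNorm (fun x => entries (σ n x) - entries (τ x)) p (vol K))
    atTop (𝓝 0)
  tendsto_div : Tendsto (fun n => eLpNorm (fun x => classicalDiv (σ n) x - g x) 2 (vol K))
    atTop (𝓝 0)

/-- For a field `τ ∈ L^p(K)` with weak divergence `g ∈ L²(K)`, the integral of `v · (τ n)` over
the face opposite to the vertex `i` exists, in the sense of normal traces, and equals `I`: the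
field `τ` is a limit of smooth fields, and for every such approximation the classical surface
integrals converge to `I`. -/
def HasFaceFlux [NeZero d] (p : ENNReal) (K : Affine.Simplex ℝ (EuclideanSpace ℝ (Fin d)) d)
    (i : Fin (d + 1)) (τ : EuclideanSpace ℝ (Fin d) → Matrix (Fin d) (Fin d) ℝ)
    (g v : EuclideanSpace ℝ (Fin d) → EuclideanSpace ℝ (Fin d)) (I : ℝ) : Prop :=
  (∃ σ, SmoothApprox p K τ g σ) ∧
    ∀ σ, SmoothApprox p K τ g σ →
      Tendsto (fun n => classicalFlux K i (σ n) v) atTop (𝓝 I)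

/-- The value of the trace integral is unique. -/
theorem HasFaceFlux.unique [NeZero d] {p : ENNReal}
    {K : Affine.Simplex ℝ (EuclideanSpace ℝ (Fin d)) d} {i : Fin (d + 1)}
    {τ : EuclideanSpace ℝ (Fin d) → Matrix (Fin d) (Fin d) ℝ}
    {g v : EuclideanSpace ℝ (Fin d) → EuclideanSpace ℝ (Fin d)} {I J : ℝ}
    (hI : HasFaceFlux p K i τ g v I) (hJ : HasFaceFlux p K i τ g v J) : I = J := by
  obtain ⟨⟨σ, hσ⟩, h⟩ := hI
  exact tendsto_nhds_unique (h σ hσ) (hJ.2 σ hσ)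

/-- For a smooth field the trace integral is the classical surface integral. -/
theorem HasFaceFlux.eq_classicalFlux [NeZero d] {p : ENNReal}
    {K : Affine.Simplex ℝ (EuclideanSpace ℝ (Fin d)) d} {i : Fin (d + 1)}
    {τ : EuclideanSpace ℝ (Fin d) → Matrix (Fin d) (Fin d) ℝ}
    {v : EuclideanSpace ℝ (Fin d) → EuclideanSpace ℝ (Fin d)} {I : ℝ}
    (hτ : ∀ a b, ContDiff ℝ ∞ fun x => τ x a b)
    (hI : HasFaceFlux p K i τ (classicalDiv τ) v I) : I = classicalFlux K i τ v := by
  have h : SmoothApprox p K τ (classicalDiv τ) fun _ => τ :=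
    ⟨fun _ => hτ, by simp, by simp⟩
  exact tendsto_nhds_unique (hI.2 _ h) tendsto_const_nhds

end FaceTrace

end

/-! The flux through a single face e of K is isolated by testing the divergence theorem with a field
that equals v on e and 0 on the other faces. Such a field must jump at the boundary of e, a set of
codimension two in K; the estimate consists in measuring the cost of that jump.

Let λ_j be the barycentric coordinates, with e = {λ_i = 0}, and h the diameter. The test field is φ
w. The cutoff φ is the product over j ≠ i of max(λ_j, 0)² / ((λ_i + λ_j)² + ε²). On K, away from λ_i
= 0, its gradient is bounded uniformly in ε by a multiple of h⁻¹ Σ_j (λ_i + λ_j)⁻¹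
(`norm_fderiv_cutoff_le`). The q-th power of this weight is integrable for q < 2
(`exists_lintegral_inv_bary_le`). For q conjugate to p this is the assumption p > 2, and Hölder's
inequality pairs the weight with the L^p norm of the tensor field.

The field w extends v from e, constantly along the normal of e. Since v is polynomial of bounded
degree, equivalence of norms on a finite-dimensional space and scaling bound |w| by C h^(-(d-1)/2)
‖v‖_{0,e}, and |∇w| by h⁻¹ times such a bound (`exists_face_extension`). Expanding div(φ wᵀσ),
estimating, and letting ε → 0 on e gives the inequality for smooth fields
(`exists_abs_classicalFlux_le`).

The minimum angle enters only through |∇λ_j| ≤ B / h (`exists_norm_grad_le`), that is, through a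
lower bound for the heights: plane angles control the part of ∇λ_j tangential to a face, dihedral
angles compare the normal part with it.

For general τ, a homothety towards an interior point followed by mollification produces smooth
approximations up to the boundary (`exists_smoothApprox`). The smooth estimate applied to
differences then shows that the fluxes are Cauchy, with a limit independent of the sequence, and the
inequality passes to the limit (`exists_hasFaceFlux_le`). -/

noncomputable section

namespace FaceTrace

variable {d : ℕ}

/-! ### Barycentric coordinates and their gradients -/

section Barycentric

variable [NeZero d] (K : Affine.Simplex ℝ (EuclideanSpace ℝ (Fin d)) d)

/-- The gradient of the barycentric coordinate of the vertex `i`. -/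
def grad (i : Fin (d + 1)) : EuclideanSpace ℝ (Fin d) :=
  (‖K.points i - K.altitudeFoot i‖ ^ 2)⁻¹ • (K.points i - K.altitudeFoot i)

/-- The barycentric coordinate of the vertex `i`. -/
def bary (i : Fin (d + 1)) (x : EuclideanSpace ℝ (Fin d)) : ℝ :=
  1 + inner ℝ (grad K i) (x - K.points i)

theorem norm_altitude_pos (i : Fin (d + 1)) : 0 < ‖K.points i - K.altitudeFoot i‖ :=
  norm_pos_iff.2 (sub_ne_zero.2 (K.ne_altitudeFoot i))

theorem norm_grad (i : Fin (d + 1)) : ‖grad K i‖ = ‖K.points i - K.altitudeFoot i‖⁻¹ := by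
  have := norm_altitude_pos K i
  rw [grad, norm_smul, norm_inv, norm_pow, norm_norm]
  field_simp

theorem norm_grad_pos (i : Fin (d + 1)) : 0 < ‖grad K i‖ := by
  rw [norm_grad]
  exact inv_pos.2 (norm_altitude_pos K i)

theorem outwardNormal_eq (i : Fin (d + 1)) :
    outwardNormal K i = -(‖grad K i‖⁻¹ • grad K i) := by
  have := norm_altitude_pos K i
  rw [norm_grad, grad, outwardNormal, norm_sub_rev, smul_smul, inv_inv,
    ← neg_sub (K.points i) (K.altitudeFoot i), smul_neg]
  congr 2
  field_simp

theorem norm_outwardNormal (i : Fin (d + 1)) : ‖outwardNormal K i‖ = 1 := by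
  rw [outwardNormal_eq, norm_neg, norm_smul, norm_inv, norm_norm,
    inv_mul_cancel₀ (norm_grad_pos K i).ne']

/-- The altitude is orthogonal to the opposite face, so for k ≠ i the edge joining the two vertices
has inner product with the altitude equal to the squared height, which the normalization of `grad`
cancels. -/
theorem bary_point (i k : Fin (d + 1)) : bary K i (K.points k) = if k = i then 1 else 0 := by
  split_ifs with h
  · subst h; simp [bary]
  · have h1 := K.inner_vsub_vsub_altitudeFoot_eq_height_sq (i := i) (j := k) (Ne.symm h)
    simp only [vsub_eq_sub, Affine.Simplex.height, dist_eq_norm] at h1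
    have := norm_altitude_pos K i
    rw [bary, grad, real_inner_smul_left, ← neg_sub (K.points i) (K.points k), inner_neg_right,
      real_inner_comm, h1]
    field_simp
    simp

/-- An affine function is determined by its values at the vertices. With `exists_weights` this
identifies the explicit formula `bary` with the barycentric coordinates, so that later facts reduce
to weights. -/
theorem bary_linear_combination {w : Fin (d + 1) → ℝ} (hw : ∑ k, w k = 1) (i : Fin (d + 1)) :
    bary K i (∑ k, w k • K.points k) = w i := by
  have h : ∀ k, w k * bary K i (K.points k)
      = w k + w k * inner ℝ (grad K i) (K.points k - K.points i) := fun k => by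
    rw [bary]; ring
  have h2 : (∑ k, w k • K.points k) - K.points i = ∑ k, w k • (K.points k - K.points i) := by
    simp only [smul_sub, Finset.sum_sub_distrib, ← Finset.sum_smul, hw, one_smul]
  have h3 : ∑ k, w k * bary K i (K.points k) = w i := by simp [bary_point]
  rw [bary, h2, inner_sum, ← h3, Finset.sum_congr rfl fun k _ => h k, Finset.sum_add_distrib, hw]
  simp [real_inner_smul_right]

omit [NeZero d] in
theorem exists_weights (x : EuclideanSpace ℝ (Fin d)) :
    ∃ w : Fin (d + 1) → ℝ, ∑ k, w k = 1 ∧ ∑ k, w k • K.points k = x := by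
  have htop : affineSpan ℝ (Set.range K.points) = ⊤ :=
    K.independent.affineSpan_eq_top_iff_card_eq_finrank_add_one.2 (by simp)
  obtain ⟨w, hw, h⟩ := eq_affineCombination_of_mem_affineSpan_of_fintype
    (k := ℝ) (p1 := x) (p := K.points) (by rw [htop]; trivial)
  refine ⟨w, hw, ?_⟩
  rw [h, Finset.affineCombination_eq_linear_combination _ _ _ hw]

theorem sum_bary (x : EuclideanSpace ℝ (Fin d)) : ∑ i, bary K i x = 1 := by
  obtain ⟨w, hw, rfl⟩ := exists_weights K x
  simp [bary_linear_combination K hw, hw]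

theorem sum_bary_smul (x : EuclideanSpace ℝ (Fin d)) : ∑ i, bary K i x • K.points i = x := by
  obtain ⟨w, hw, rfl⟩ := exists_weights K x
  simp [bary_linear_combination K hw]

theorem bary_sub (i : Fin (d + 1)) (x y : EuclideanSpace ℝ (Fin d)) :
    bary K i x - bary K i y = inner ℝ (grad K i) (x - y) := by
  simp only [bary, inner_sub_right]; ring

theorem sum_grad : ∑ i, grad K i = 0 := by
  refine ext_inner_right ℝ fun v => ?_
  have h : ∑ i, (bary K i v - bary K i 0) = 0 := by
    rw [Finset.sum_sub_distrib, sum_bary, sum_bary, sub_self]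
  rw [sum_inner, inner_zero_left, ← h]
  exact Finset.sum_congr rfl fun i _ => by rw [bary_sub, sub_zero]

@[fun_prop]
theorem contDiff_bary (i : Fin (d + 1)) {n : WithTop ℕ∞} : ContDiff ℝ n (bary K i) := by
  exact contDiff_const.add (contDiff_const.inner ℝ (contDiff_id.sub contDiff_const))

@[fun_prop]
theorem continuous_bary (i : Fin (d + 1)) : Continuous (bary K i) :=
  (contDiff_bary K i (n := 0)).continuous

theorem hasFDerivAt_bary (i : Fin (d + 1)) (x : EuclideanSpace ℝ (Fin d)) :
    HasFDerivAt (bary K i) (innerSL ℝ (grad K i)) x := by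
  have h : bary K i = fun x => innerSL ℝ (grad K i) x + (1 - inner ℝ (grad K i) (K.points i)) := by
    ext x; simp only [bary, inner_sub_right, innerSL_apply_apply]; ring
  rw [h]
  exact (innerSL ℝ (grad K i)).hasFDerivAt.add_const _

theorem mem_closedInterior_iff {x : EuclideanSpace ℝ (Fin d)} :
    x ∈ K.closedInterior ↔ ∀ i, 0 ≤ bary K i x := by
  have hx : x = Finset.univ.affineCombination ℝ K.points fun i => bary K i x := by
    rw [Finset.affineCombination_eq_linear_combination _ _ _ (sum_bary K x), sum_bary_smul]
  rw [hx, Affine.Simplex.affineCombination_mem_closedInterior_iff (sum_bary K x), ← hx]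
  refine ⟨fun h i => (h i).1, fun h i => ⟨h i, ?_⟩⟩
  rw [← sum_bary K x]
  exact Finset.single_le_sum (f := fun i => bary K i x) (fun j _ => h j) (Finset.mem_univ i)

theorem bary_le_one {x : EuclideanSpace ℝ (Fin d)} (hx : x ∈ K.closedInterior)
    (i : Fin (d + 1)) : bary K i x ≤ 1 := by
  rw [← sum_bary K x]
  exact Finset.single_le_sum (f := fun i => bary K i x)
    (fun j _ => (mem_closedInterior_iff K).1 hx j) (Finset.mem_univ i)

theorem mem_face_iff (i : Fin (d + 1)) {x : EuclideanSpace ℝ (Fin d)} :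
    x ∈ (K.faceOpposite i).closedInterior ↔ bary K i x = 0 ∧ ∀ j, 0 ≤ bary K j x := by
  have hx : x = Finset.univ.affineCombination ℝ K.points fun i => bary K i x := by
    rw [Finset.affineCombination_eq_linear_combination _ _ _ (sum_bary K x), sum_bary_smul]
  rw [hx, Affine.Simplex.faceOpposite,
    K.affineCombination_mem_closedInterior_face_iff_nonneg _ (sum_bary K x), ← hx]
  simp only [Finset.mem_compl, Finset.mem_singleton, not_not, forall_eq]
  refine ⟨fun h => ⟨h.2, fun j => ?_⟩, fun h => ⟨fun j _ => h.2 j, h.1⟩⟩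
  rcases eq_or_ne j i with rfl | hj
  · exact h.2.ge
  · exact h.1 j hj

omit [NeZero d] in
theorem convex_closedInterior : Convex ℝ K.closedInterior := by
  rw [← Affine.Simplex.convexHull_eq_closedInterior]
  exact convex_convexHull ℝ _

theorem isClosed_face (i : Fin (d + 1)) : IsClosed (K.faceOpposite i).closedInterior :=
  (K.faceOpposite i).isClosed_closedInterior

theorem mem_interior_of_bary_pos {x : EuclideanSpace ℝ (Fin d)} (hx : ∀ i, 0 < bary K i x) :
    x ∈ interior K.closedInterior := by
  have ho : IsOpen {y | ∀ i, 0 < bary K i y} := by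
    simp only [Set.ofPred_forall]
    exact isOpen_iInter_of_finite fun i => isOpen_lt continuous_const (continuous_bary K i)
  exact interior_maximal (fun y hy => (mem_closedInterior_iff K).2 fun i => (hy i).le) ho hx

theorem nonempty_interior : (interior K.closedInterior).Nonempty := by
  have hd : (0 : ℝ) < (d : ℝ) + 1 := by positivity
  have hw : ∑ _k : Fin (d + 1), ((d : ℝ) + 1)⁻¹ = 1 := by
    simp [hd.ne']
  refine ⟨∑ k, ((d : ℝ) + 1)⁻¹ • K.points k, mem_interior_of_bary_pos K fun i => ?_⟩
  rw [bary_linear_combination K hw]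
  positivity

omit [NeZero d] in
theorem isBounded_closedInterior : Bornology.IsBounded K.closedInterior :=
  K.isCompact_closedInterior.isBounded

omit [NeZero d] in
theorem dist_le_diam {x y : EuclideanSpace ℝ (Fin d)} (hx : x ∈ K.closedInterior)
    (hy : y ∈ K.closedInterior) : dist x y ≤ diam K :=
  Metric.dist_le_diam_of_mem (isBounded_closedInterior K) hx hy

theorem diam_pos : 0 < diam K := by
  have h01 : (0 : Fin (d + 1)) ≠ Fin.last d := (Fin.last_pos' (n := d)).ne
  have := dist_le_diam K (K.point_mem_closedInterior 0) (K.point_mem_closedInterior (Fin.last d))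
  exact lt_of_lt_of_le (dist_pos.2 (K.independent.injective.ne h01)) this

omit [NeZero d] in
-- A convex hull has the diameter of its generating set, here the finite set of vertices.
theorem exists_dist_eq_diam : ∃ j k, dist (K.points j) (K.points k) = diam K := by
  have hne : (Finset.univ : Finset (Fin (d + 1) × Fin (d + 1))).Nonempty := Finset.univ_nonempty
  obtain ⟨⟨j, k⟩, -, hjk⟩ := Finset.exists_max_image Finset.univ
    (fun jk : Fin (d + 1) × Fin (d + 1) => dist (K.points jk.1) (K.points jk.2)) hne
  refine ⟨j, k, le_antisymm
    (dist_le_diam K (K.point_mem_closedInterior j) (K.point_mem_closedInterior k)) ?_⟩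
  rw [diam, ← Affine.Simplex.convexHull_eq_closedInterior, convexHull_diam]
  refine Metric.diam_le_of_forall_dist_le dist_nonneg ?_
  rintro _ ⟨a, rfl⟩ _ ⟨b, rfl⟩
  exact hjk (a, b) (Finset.mem_univ _)

end Barycentric

variable {d : ℕ}

/-! ### Shape regularity: from angles to heights -/

section Angles

/-- The left side is the distance from x to the line ℝ y. After squaring and multiplying by ‖y‖²,
the gap between the two sides is the square (c‖y‖² + ⟨x, y⟩)². -/
theorem norm_mul_sin_angle_le {V : Type*} [NormedAddCommGroup V] [InnerProductSpace ℝ V]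
    (x y : V) (c : ℝ) : ‖x‖ * Real.sin (InnerProductGeometry.angle x y) ≤ ‖x + c • y‖ := by
  rcases eq_or_ne y 0 with rfl | hy
  · simp
  have hy' : 0 < ‖y‖ := norm_pos_iff.2 hy
  refine le_of_mul_le_mul_right (a := ‖y‖) ?_ hy'
  have h := InnerProductGeometry.sin_angle_mul_norm_mul_norm x y
  have h1 : ‖x‖ * Real.sin (InnerProductGeometry.angle x y) * ‖y‖ =
      Real.sin (InnerProductGeometry.angle x y) * (‖x‖ * ‖y‖) := by ring
  rw [h1, h]
  refine Real.sqrt_le_iff.2 ⟨by positivity, ?_⟩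
  have h2 : ‖x + c • y‖ ^ 2 = ‖x‖ ^ 2 + 2 * (c * inner ℝ x y) + c ^ 2 * ‖y‖ ^ 2 := by
    rw [norm_add_sq_real, real_inner_smul_right, norm_smul, mul_pow, Real.norm_eq_abs, sq_abs]
  rw [mul_pow, h2, real_inner_self_eq_norm_sq, real_inner_self_eq_norm_sq]
  nlinarith [sq_nonneg (c * ‖y‖ ^ 2 + inner ℝ x y)]

/-- In the span of x and y, t is the gradient of the linear form that is 1 at x and 0 on y, so its
norm is the reciprocal of the distance from x to ℝ y. Indeed ‖t‖² = ⟨t, c x + c' y⟩ = c, and t / c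
is x plus a multiple of y. -/
theorem norm_mul_le_one_of_dual {V : Type*} [NormedAddCommGroup V] [InnerProductSpace ℝ V]
    {t x y : V} {c c' : ℝ} (ht : t = c • x + c' • y) (hx : inner ℝ t x = 1)
    (hy : inner ℝ t y = 0) :
    ‖t‖ * (‖x‖ * Real.sin (InnerProductGeometry.angle x y)) ≤ 1 := by
  have h1 : ‖t‖ ^ 2 = c := by
    rw [← real_inner_self_eq_norm_sq]
    conv_lhs => rw [ht, inner_add_right, real_inner_smul_right, real_inner_smul_right, ← ht, hx, hy]
    ring
  have h0 : t ≠ 0 := by rintro rfl; simp at hx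
  have ht0 : 0 < ‖t‖ := norm_pos_iff.2 h0
  have hc : 0 < c := by rw [← h1]; positivity
  have h2 : t = c • (x + (c' / c) • y) := by
    rw [smul_add, smul_smul, mul_div_cancel₀ _ hc.ne', ht]
  have h3 : ‖t‖ = c * ‖x + (c' / c) • y‖ := by
    conv_lhs => rw [h2, norm_smul, Real.norm_of_nonneg hc.le]
  have h4 := norm_mul_sin_angle_le x y (c' / c)
  refine le_of_mul_le_mul_left (a := ‖t‖) ?_ ht0
  calc ‖t‖ * (‖t‖ * (‖x‖ * Real.sin (InnerProductGeometry.angle x y)))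
      = c * (‖x‖ * Real.sin (InnerProductGeometry.angle x y)) := by rw [← h1]; ring
    _ ≤ c * ‖x + (c' / c) • y‖ := by gcongr
    _ = ‖t‖ * 1 := by rw [mul_one, h3]

variable [NeZero d] {K : Affine.Simplex ℝ (EuclideanSpace ℝ (Fin d)) d} {θ : ℝ}

omit [NeZero d] in
theorem points_ne {i j : Fin (d + 1)} (h : i ≠ j) : K.points i ≠ K.points j :=
  K.independent.injective.ne h

theorem MinAngleGE.angle_le (hK : MinAngleGE K θ) (hθ : 0 < θ) {i j k : Fin (d + 1)} (hij : i ≠ j)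
    (hjk : j ≠ k) (hik : i ≠ k) :
    EuclideanGeometry.angle (K.points i) (K.points j) (K.points k) ≤ Real.pi - θ := by
  have h := EuclideanGeometry.angle_add_angle_add_angle_eq_pi (K.points k)
    (points_ne (K := K) hij.symm)
  have h1 := hK.1 j k i hjk hik.symm hij.symm
  have h2 := hK.1 k i j hik.symm hij hjk.symm
  linarith

theorem MinAngleGE.le_pi_div_two (hK : MinAngleGE K θ) (hd : 2 ≤ d) : θ ≤ Real.pi / 2 := by
  let a : Fin (d + 1) := ⟨0, by omega⟩
  let b : Fin (d + 1) := ⟨1, by omega⟩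
  let c : Fin (d + 1) := ⟨2, by omega⟩
  have hab : a ≠ b := by simp [a, b]
  have hbc : b ≠ c := by simp [b, c]
  have hac : a ≠ c := by simp [a, c]
  have h := EuclideanGeometry.angle_add_angle_add_angle_eq_pi (K.points c)
    (points_ne (K := K) hab.symm)
  have h0 := hK.1 a b c hab hbc hac
  have h1 := hK.1 b c a hbc hac.symm hab.symm
  have h2 := hK.1 c a b hac.symm hab hbc.symm
  linarith [Real.pi_pos]

/-- The angle sum of a triangle confines every angle to [θ, π - θ], where the sine is at least sin θ
because θ ≤ π / 2. -/
theorem MinAngleGE.sin_le (hK : MinAngleGE K θ) (hd : 2 ≤ d) (hθ : 0 < θ) {i j k : Fin (d + 1)}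
    (hij : i ≠ j) (hjk : j ≠ k) (hik : i ≠ k) :
    Real.sin θ ≤
      Real.sin (EuclideanGeometry.angle (K.points i) (K.points j) (K.points k)) := by
  have h1 := hK.1 i j k hij hjk hik
  have h2 := hK.angle_le hθ hij hjk hik
  have h3 := hK.le_pi_div_two hd
  rcases le_total (EuclideanGeometry.angle (K.points i) (K.points j) (K.points k))
    (Real.pi / 2) with h | h
  · exact Real.sin_le_sin_of_le_of_le_pi_div_two (by linarith) h h1
  · rw [← Real.sin_pi_sub (EuclideanGeometry.angle _ _ _)]
    exact Real.sin_le_sin_of_le_of_le_pi_div_two (by linarith) (by linarith) (by linarith)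

theorem MinAngleGE.sin_pos (hK : MinAngleGE K θ) (hd : 2 ≤ d) (hθ : 0 < θ) : 0 < Real.sin θ :=
  Real.sin_pos_of_pos_of_lt_pi hθ (by linarith [hK.le_pi_div_two hd, Real.pi_pos])

/-- The law of sines compares two edges that share the vertex a. -/
theorem MinAngleGE.sin_mul_dist_le (hK : MinAngleGE K θ) (hd : 2 ≤ d) (hθ : 0 < θ)
    {a b : Fin (d + 1)} (hab : a ≠ b) (c : Fin (d + 1)) :
    Real.sin θ * dist (K.points a) (K.points c) ≤ dist (K.points a) (K.points b) := by
  rcases eq_or_ne a c with rfl | hac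
  · simp
  rcases eq_or_ne b c with rfl | hbc
  · exact mul_le_of_le_one_left dist_nonneg (Real.sin_le_one _)
  have h := EuclideanGeometry.law_sin (K.points c) (K.points b) (K.points a)
  rw [dist_comm (K.points b)] at h
  calc Real.sin θ * dist (K.points a) (K.points c)
      ≤ Real.sin (EuclideanGeometry.angle (K.points a) (K.points c) (K.points b)) *
        dist (K.points a) (K.points c) := by
        gcongr
        exact hK.sin_le hd hθ hac hbc.symm hab
    _ ≤ dist (K.points a) (K.points b) := by
        rw [← h]
        exact mul_le_of_le_one_left dist_nonneg (Real.sin_le_one _)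

/-- The diameter is the length of some edge c e. It is reached from a b in at most two comparisons
of edges with a common vertex, through c a; each costs a factor sin θ. -/
theorem MinAngleGE.sin_sq_mul_diam_le (hK : MinAngleGE K θ) (hd : 2 ≤ d) (hθ : 0 < θ)
    {a b : Fin (d + 1)} (hab : a ≠ b) :
    Real.sin θ ^ 2 * diam K ≤ dist (K.points a) (K.points b) := by
  have hs := hK.sin_pos hd hθ
  obtain ⟨c, e, hce⟩ := exists_dist_eq_diam K
  rw [← hce]
  rcases eq_or_ne a c with rfl | hac
  · refine le_trans ?_ (hK.sin_mul_dist_le hd hθ hab e)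
    gcongr
    exact pow_le_of_le_one hs.le (Real.sin_le_one _) two_ne_zero
  · calc Real.sin θ ^ 2 * dist (K.points c) (K.points e)
        = Real.sin θ * (Real.sin θ * dist (K.points c) (K.points e)) := by ring
      _ ≤ Real.sin θ * dist (K.points c) (K.points a) := by
          gcongr; exact hK.sin_mul_dist_le hd hθ hac.symm e
      _ ≤ dist (K.points a) (K.points b) := by
          rw [dist_comm]; exact hK.sin_mul_dist_le hd hθ hab c

variable (K) in
theorem inner_grad_sub (i j k : Fin (d + 1)) :
    inner ℝ (grad K i) (K.points j - K.points k) =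
      (if j = i then 1 else 0) - (if k = i then 1 else 0) := by
  rw [← bary_sub, bary_point, bary_point]

variable (K) in
-- The gradients are dual to the edge vectors issuing from the vertex k, so these inner products are
-- the coordinates of v in that basis.
theorem sum_inner_grad_smul (v : EuclideanSpace ℝ (Fin d)) (k : Fin (d + 1)) :
    ∑ p, inner ℝ (grad K p) v • (K.points p - K.points k) = v := by
  have h0 : ∑ p, inner ℝ (grad K p) v = 0 := by rw [← sum_inner, sum_grad, inner_zero_left]
  have h : ∑ p, (bary K p v - bary K p 0) • K.points p = v := by
    simp only [sub_smul, Finset.sum_sub_distrib, sum_bary_smul, sub_zero]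
  simp only [smul_sub, Finset.sum_sub_distrib, ← Finset.sum_smul, h0, zero_smul, sub_zero]
  rw [← h]
  refine Finset.sum_congr rfl fun p _ => ?_
  rw [bary_sub, sub_zero, h]

/-- The part of the gradient of the barycentric coordinate `j` tangential to the face `i`. -/
def tangentialGrad (K : Affine.Simplex ℝ (EuclideanSpace ℝ (Fin d)) d) (i j : Fin (d + 1)) :
    EuclideanSpace ℝ (Fin d) :=
  grad K j - inner ℝ (grad K j) (outwardNormal K i) • outwardNormal K i

theorem inner_tangentialGrad (i j : Fin (d + 1)) {v : EuclideanSpace ℝ (Fin d)}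
    (hv : inner ℝ (grad K i) v = 0) :
    inner ℝ (tangentialGrad K i j) v = inner ℝ (grad K j) v := by
  rw [tangentialGrad, inner_sub_left, real_inner_smul_left, outwardNormal_eq, inner_neg_left,
    real_inner_smul_left, hv]
  ring

theorem inner_grad_tangentialGrad (i j : Fin (d + 1)) :
    inner ℝ (grad K i) (tangentialGrad K i j) = 0 := by
  have hn := norm_outwardNormal K i
  have hg : grad K i = -(‖grad K i‖ • outwardNormal K i) := by
    rw [outwardNormal_eq, smul_neg, neg_neg, smul_smul, mul_inv_cancel₀ (norm_grad_pos K i).ne',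
      one_smul]
  rw [hg, inner_neg_left, real_inner_smul_left, tangentialGrad, inner_sub_right,
    real_inner_smul_right, real_inner_self_eq_norm_sq, hn, real_inner_comm]
  ring

/-- The tangential gradient is the gradient of λ_j restricted to the hyperplane of the face i, hence
the reciprocal of a height of that face: a segment if d = 2, a triangle j k l with base k l if d =
3. Two factors sin θ come from the length of the edge j k and one from the angle at k. -/
theorem norm_tangentialGrad_mul_le (hK : MinAngleGE K θ) (hd : d = 2 ∨ d = 3) (hθ : 0 < θ)
    {i j : Fin (d + 1)} (hij : j ≠ i) :
    ‖tangentialGrad K i j‖ * (Real.sin θ ^ 3 * diam K) ≤ 1 := by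
  have hd2 : 2 ≤ d := by omega
  have hs := hK.sin_pos hd2 hθ
  obtain ⟨k, hki, hkj, y, c', hty, hy, hsin⟩ : ∃ k, k ≠ i ∧ k ≠ j ∧
      ∃ (y : EuclideanSpace ℝ (Fin d)) (c' : ℝ),
      tangentialGrad K i j = inner ℝ (grad K j) (tangentialGrad K i j) •
        (K.points j - K.points k) + c' • y ∧ inner ℝ (tangentialGrad K i j) y = 0 ∧
      Real.sin θ ≤ Real.sin (InnerProductGeometry.angle (K.points j - K.points k) y) := by
    obtain ⟨k, hk⟩ : ∃ k, k ∉ ({i, j} : Finset (Fin (d + 1))) := by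
      by_contra! h
      have := Finset.card_le_card (fun x _ => h x : Finset.univ ⊆ ({i, j} : Finset (Fin (d + 1))))
      have h2 := Finset.card_le_two (a := i) (b := j)
      simp at this; omega
    simp only [Finset.mem_insert, Finset.mem_singleton, not_or] at hk
    refine ⟨k, hk.1, hk.2, ?_⟩
    have hsum := sum_inner_grad_smul K (tangentialGrad K i j) k
    rcases hd with hd | hd
    · have huniv : (Finset.univ : Finset (Fin (d + 1))) = {i, j, k} := by
        symm
        rw [← Finset.card_eq_iff_eq_univ, Finset.card_eq_three.2
          ⟨i, j, k, hij.symm, Ne.symm hk.1, Ne.symm hk.2, rfl⟩]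
        simp [hd]
      -- For a triangle the face is the edge j k and no second direction is needed. The angle with
      -- the zero vector is π / 2 by convention, so its sine is 1.
      refine ⟨0, 0, ?_, by simp, by simpa using Real.sin_le_one _⟩
      rw [huniv, Finset.sum_insert (by simp [hij.symm, Ne.symm hk.1]),
        Finset.sum_pair (Ne.symm hk.2), inner_grad_tangentialGrad] at hsum
      conv_lhs => rw [← hsum]
      simp
    · obtain ⟨l, hl⟩ : ∃ l, l ∉ ({i, j, k} : Finset (Fin (d + 1))) := by
        by_contra! h
        have := Finset.card_le_card
          (fun x _ => h x : Finset.univ ⊆ ({i, j, k} : Finset (Fin (d + 1))))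
        have h2 := Finset.card_le_three (a := i) (b := j) (c := k)
        simp at this; omega
      simp only [Finset.mem_insert, Finset.mem_singleton, not_or] at hl
      have huniv : (Finset.univ : Finset (Fin (d + 1))) = {i, j, k, l} := by
        symm
        rw [← Finset.card_eq_iff_eq_univ,
          Finset.card_insert_of_notMem (by simp [hij.symm, Ne.symm hk.1, Ne.symm hl.1]),
          Finset.card_insert_of_notMem (by simp [Ne.symm hk.2, Ne.symm hl.2.1]),
          Finset.card_pair (Ne.symm hl.2.2)]
        simp [hd]
      refine ⟨K.points l - K.points k, inner ℝ (grad K l) (tangentialGrad K i j), ?_, ?_, ?_⟩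
      · rw [huniv, Finset.sum_insert (by simp [hij.symm, Ne.symm hk.1, Ne.symm hl.1]),
          Finset.sum_insert (by simp [Ne.symm hk.2, Ne.symm hl.2.1]),
          Finset.sum_pair (Ne.symm hl.2.2), inner_grad_tangentialGrad] at hsum
        conv_lhs => rw [← hsum]
        simp
      · rw [inner_tangentialGrad _ _ (by rw [inner_grad_sub]; simp [hl.1, hk.1]), inner_grad_sub]
        simp [hl.2.1, hk.2]
      · exact hK.sin_le hd2 hθ (Ne.symm hk.2) (Ne.symm hl.2.2) (Ne.symm hl.2.1)
  have h1 : inner ℝ (tangentialGrad K i j) (K.points j - K.points k) = 1 := by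
    rw [inner_tangentialGrad _ _ (by rw [inner_grad_sub]; simp [hij, hki]), inner_grad_sub]
    simp [hkj]
  refine le_trans ?_ (norm_mul_le_one_of_dual hty h1 hy)
  have h2 := hK.sin_sq_mul_diam_le hd2 hθ hkj.symm
  rw [dist_eq_norm] at h2
  refine mul_le_mul_of_nonneg_left ?_ (norm_nonneg _)
  calc Real.sin θ ^ 3 * diam K = (Real.sin θ ^ 2 * diam K) * Real.sin θ := by ring
    _ ≤ _ := by gcongr

/-- Let a be the component of ∇λ_j along the normal of the face i, and t its tangential part. The
dihedral angle bounds the angle between the two normals by π - θ, so a ≤ cos θ |∇λ_j|. By Pythagoras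
|t|² = |∇λ_j|² - a² ≥ sin²θ |∇λ_j|² ≥ sin²θ a² when a > 0; otherwise there is nothing to prove. -/
theorem sin_mul_inner_grad_outwardNormal_le (hK : MinAngleGE K θ) (hd : d = 2 ∨ d = 3) (hθ : 0 < θ)
    {i j : Fin (d + 1)} (hij : j ≠ i) :
    Real.sin θ * inner ℝ (grad K j) (outwardNormal K i) ≤ ‖tangentialGrad K i j‖ := by
  have hs := hK.sin_pos (by omega) hθ
  set a := inner ℝ (grad K j) (outwardNormal K i) with ha
  rcases le_or_gt a 0 with h0 | h0
  · exact (mul_nonpos_of_nonneg_of_nonpos hs.le h0).trans (norm_nonneg _)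
  have hn := norm_outwardNormal K i
  have hgj := norm_grad_pos K j
  have hang : InnerProductGeometry.angle (outwardNormal K i) (outwardNormal K j) ≤
      Real.pi - θ := by
    have := hK.2 i j hij.symm
    rw [dihedralAngle] at this
    linarith
  have hcos : -Real.cos θ ≤ inner ℝ (outwardNormal K i) (outwardNormal K j) := by
    have h := Real.cos_le_cos_of_nonneg_of_le_pi (InnerProductGeometry.angle_nonneg _ _)
      (by linarith) hang
    rw [Real.cos_pi_sub, InnerProductGeometry.cos_angle, hn, norm_outwardNormal] at h
    simpa using h
  have h1 : a ≤ Real.cos θ * ‖grad K j‖ := by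
    rw [outwardNormal_eq K j, inner_neg_right, real_inner_smul_right, real_inner_comm, ← ha] at hcos
    have : ‖grad K j‖⁻¹ * a ≤ Real.cos θ := by linarith
    rwa [inv_mul_le_iff₀ hgj, mul_comm] at this
  have h2 : ‖tangentialGrad K i j‖ ^ 2 = ‖grad K j‖ ^ 2 - a ^ 2 := by
    rw [tangentialGrad, ← ha, norm_sub_sq_real, real_inner_smul_right, ← ha, norm_smul, hn,
      Real.norm_eq_abs, mul_one, sq_abs]
    ring
  refine le_of_sq_le_sq ?_ (norm_nonneg _)
  have h3 : a ^ 2 ≤ Real.cos θ ^ 2 * ‖grad K j‖ ^ 2 := by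
    rw [← mul_pow]; gcongr
  have h4 := Real.sin_sq_add_cos_sq θ
  have h5 : Real.cos θ ^ 2 ≤ 1 := by nlinarith
  rw [mul_pow, h2]
  have h6 : Real.cos θ ^ 2 = 1 - Real.sin θ ^ 2 := by linarith
  rw [h6] at h3
  nlinarith [sq_nonneg a, sq_nonneg (Real.sin θ), sq_nonneg (‖grad K j‖)]

/-- Shape regularity: the heights of `K` are comparable to its diameter. -/
theorem exists_norm_grad_le (d : ℕ) [NeZero d] (hd : d = 2 ∨ d = 3) {θ : ℝ} (hθ : 0 < θ) :
    ∃ B : ℝ, 0 < B ∧ ∀ K : Affine.Simplex ℝ (EuclideanSpace ℝ (Fin d)) d, MinAngleGE K θ →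
      ∀ i, ‖grad K i‖ ≤ B / diam K := by
  -- The summand 1 keeps the constant positive even if sin θ = 0: without an admissible simplex at
  -- hand, θ is not known to be below π.
  refine ⟨d / Real.sin θ ^ 4 + 1, by positivity, fun K hK i => ?_⟩
  have hs := hK.sin_pos (by omega) hθ
  have hD := diam_pos K
  -- The gradients sum to zero and ∇λ_i points along the inward normal, so its length is the sum of
  -- the outward normal components of the d other gradients.
  have hsum : ‖grad K i‖ = ∑ j ∈ Finset.univ.erase i, inner ℝ (grad K j) (outwardNormal K i) := by
    have h : ∑ j, inner ℝ (grad K j) (outwardNormal K i) = 0 := by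
      rw [← sum_inner, sum_grad, inner_zero_left]
    rw [← Finset.add_sum_erase _ _ (Finset.mem_univ i)] at h
    have h1 : inner ℝ (grad K i) (outwardNormal K i) = -‖grad K i‖ := by
      have := norm_grad_pos K i
      rw [outwardNormal_eq, inner_neg_right, real_inner_smul_right, real_inner_self_eq_norm_sq]
      field_simp
    linarith
  have hle : ∀ j ∈ Finset.univ.erase i,
      inner ℝ (grad K j) (outwardNormal K i) ≤ 1 / (Real.sin θ ^ 4 * diam K) := by
    intro j hj
    have hji := Finset.ne_of_mem_erase hj
    have h1 := sin_mul_inner_grad_outwardNormal_le hK hd hθ hji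
    have h2 := norm_tangentialGrad_mul_le hK hd hθ hji
    rw [le_div_iff₀ (by positivity)]
    calc inner ℝ (grad K j) (outwardNormal K i) * (Real.sin θ ^ 4 * diam K)
        = (Real.sin θ * inner ℝ (grad K j) (outwardNormal K i)) * (Real.sin θ ^ 3 * diam K) := by
          ring
      _ ≤ ‖tangentialGrad K i j‖ * (Real.sin θ ^ 3 * diam K) := by gcongr
      _ ≤ 1 := h2
  rw [hsum]
  refine (Finset.sum_le_sum hle).trans ?_
  rw [Finset.sum_const, Finset.card_erase_of_mem (Finset.mem_univ i), Finset.card_univ,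
    Fintype.card_fin, Nat.add_sub_cancel, nsmul_eq_mul, add_div]
  have : (d : ℝ) * (1 / (Real.sin θ ^ 4 * diam K)) = d / Real.sin θ ^ 4 / diam K := by
    field_simp
  rw [this]
  have : 0 < 1 / diam K := by positivity
  linarith

end Angles

/-! ### The divergence theorem in a half-space -/

section HalfSpace

variable {N : ℕ}

/-- An isometric parametrization of the orthogonal complement of the unit vector `n`. -/
def planeEmb (n : EuclideanSpace ℝ (Fin (N + 1))) (hn : n ≠ 0) :
    EuclideanSpace ℝ (Fin N) →ₗᵢ[ℝ] EuclideanSpace ℝ (Fin (N + 1)) :=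
  have : Fact (Module.finrank ℝ (EuclideanSpace ℝ (Fin (N + 1))) = N + 1) := ⟨by simp⟩
  (Submodule.subtypeₗᵢ (Submodule.span ℝ {n})ᗮ).comp
    (OrthonormalBasis.fromOrthogonalSpanSingleton (𝕜 := ℝ) N hn).repr.symm.toLinearIsometry

theorem inner_planeEmb (n : EuclideanSpace ℝ (Fin (N + 1))) (hn : n ≠ 0)
    (y : EuclideanSpace ℝ (Fin N)) : inner ℝ n (planeEmb n hn y) = 0 := by
  have : Fact (Module.finrank ℝ (EuclideanSpace ℝ (Fin (N + 1))) = N + 1) := ⟨by simp⟩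
  exact Submodule.mem_orthogonal_singleton_iff_inner_right.1
    ((OrthonormalBasis.fromOrthogonalSpanSingleton (𝕜 := ℝ) N hn).repr.symm y).2

/-- Orthonormal splitting into depth and tangential coordinates. The minus sign makes t the depth
below the hyperplane, so the half-space with outer normal n is t > 0. -/
theorem exists_planeEmb_decomposition (n : EuclideanSpace ℝ (Fin (N + 1))) (hn : ‖n‖ = 1)
    (hn0 : n ≠ 0) :
    ∃ e : WithLp 2 (ℝ × EuclideanSpace ℝ (Fin N)) ≃ₗᵢ[ℝ] EuclideanSpace ℝ (Fin (N + 1)),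
      ∀ t y, e (WithLp.toLp 2 (t, y)) = planeEmb n hn0 y - t • n := by
  let L : WithLp 2 (ℝ × EuclideanSpace ℝ (Fin N)) →ₗ[ℝ] EuclideanSpace ℝ (Fin (N + 1)) :=
    { toFun := fun z => planeEmb n hn0 z.snd - z.fst • n
      map_add' := fun z w => by simp only [WithLp.add_snd, WithLp.add_fst, map_add, add_smul]; abel
      map_smul' := fun c z => by
        simp [smul_sub, smul_smul] }
  have hL : ∀ z, ‖L z‖ = ‖z‖ := fun z => by
    have h : ‖L z‖ ^ 2 = ‖z‖ ^ 2 := by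
      change ‖planeEmb n hn0 z.snd - z.fst • n‖ ^ 2 = _
      rw [norm_sub_sq_real, real_inner_smul_right, real_inner_comm, inner_planeEmb, norm_smul, hn,
        LinearIsometry.norm_map, WithLp.prod_norm_sq_eq_of_L2]
      ring
    exact (sq_eq_sq₀ (norm_nonneg _) (norm_nonneg _)).1 h
  let I : WithLp 2 (ℝ × EuclideanSpace ℝ (Fin N)) →ₗᵢ[ℝ] EuclideanSpace ℝ (Fin (N + 1)) :=
    ⟨L, hL⟩
  have hfin : Module.finrank ℝ (WithLp 2 (ℝ × EuclideanSpace ℝ (Fin N))) =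
      Module.finrank ℝ (EuclideanSpace ℝ (Fin (N + 1))) := by
    rw [(WithLp.linearEquiv 2 ℝ (ℝ × EuclideanSpace ℝ (Fin N))).finrank_eq]
    simp [add_comm]
  exact ⟨I.toLinearIsometryEquiv hfin, fun t y => rfl⟩

theorem measurePreserving_planeEmb_sub (n : EuclideanSpace ℝ (Fin (N + 1))) (hn : ‖n‖ = 1)
    (hn0 : n ≠ 0) (P : EuclideanSpace ℝ (Fin (N + 1))) :
    MeasurePreserving (fun z : ℝ × EuclideanSpace ℝ (Fin N) => P + (planeEmb n hn0 z.2 - z.1 • n))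
      volume volume := by
  obtain ⟨e, he⟩ := exists_planeEmb_decomposition n hn hn0
  have h1 := WithLp.volume_preserving_toLp ℝ (EuclideanSpace ℝ (Fin N))
  have h2 := (measurePreserving_add_left volume P).comp (e.measurePreserving.comp h1)
  convert! h2 using 1
  ext1 z
  simp [← he]

theorem measurableEmbedding_planeEmb_sub (n : EuclideanSpace ℝ (Fin (N + 1))) (hn : ‖n‖ = 1)
    (hn0 : n ≠ 0) (P : EuclideanSpace ℝ (Fin (N + 1))) :
    MeasurableEmbedding
      (fun z : ℝ × EuclideanSpace ℝ (Fin N) => P + (planeEmb n hn0 z.2 - z.1 • n)) := by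
  obtain ⟨e, he⟩ := exists_planeEmb_decomposition n hn hn0
  have h1 := (MeasurableEquiv.toLp 2 (ℝ × EuclideanSpace ℝ (Fin N))).measurableEmbedding
  have h2 := (measurableEmbedding_addLeft P).comp
    (e.toHomeomorph.measurableEmbedding.comp h1)
  convert! h2 using 1
  ext1 z
  simp [← he]

/-- Integration by parts against the constant function 1. -/
theorem integral_fderiv_eq_zero_of_compactSupport {V : Type*} [NormedAddCommGroup V]
    [NormedSpace ℝ V] [FiniteDimensional ℝ V] [MeasurableSpace V] [BorelSpace V] (μ : Measure V)
    [μ.IsAddHaarMeasure] {f : V → ℝ} (hf : ContDiff ℝ 1 f) (hc : HasCompactSupport f) (u : V) :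
    ∫ y, fderiv ℝ f y u ∂μ = 0 := by
  have hint : Integrable (fun y => fderiv ℝ f y u) μ :=
    ((hf.continuous_fderiv one_ne_zero).clm_apply continuous_const).integrable_of_hasCompactSupport
      (hc.fderiv_apply (𝕜 := ℝ) u)
  have h := integral_bilinear_hasLineDerivAt_right_eq_neg_left_of_integrable (μ := μ)
    (f := fun _ => (1 : ℝ)) (f' := fun _ => 0) (g := f) (g' := fun y => fderiv ℝ f y u) (v := u)
    (B := ContinuousLinearMap.mul ℝ ℝ) (by simp) (by simpa using hint)
    (by simpa using hf.continuous.integrable_of_hasCompactSupport hc)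
    (fun x _ => by simpa using (hasFDerivAt_const (1 : ℝ) x).hasLineDerivAt u)
    (fun x _ => ((hf.differentiable one_ne_zero) x).hasFDerivAt.hasLineDerivAt u)
  simpa using h

/-- The divergence theorem in the half-space with outer unit normal `n`. -/
theorem integral_halfSpace_fderiv (n : EuclideanSpace ℝ (Fin (N + 1))) (hn : ‖n‖ = 1)
    (hn0 : n ≠ 0) (P : EuclideanSpace ℝ (Fin (N + 1))) {f : EuclideanSpace ℝ (Fin (N + 1)) → ℝ}
    (hf : ContDiff ℝ 1 f) (hc : HasCompactSupport f) (u : EuclideanSpace ℝ (Fin (N + 1))) :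
    ∫ x in {x | inner ℝ n (x - P) < 0}, fderiv ℝ f x u =
      inner ℝ n u * ∫ y, f (P + planeEmb n hn0 y) := by
  set Ψ : ℝ × EuclideanSpace ℝ (Fin N) → EuclideanSpace ℝ (Fin (N + 1)) :=
    fun z => P + (planeEmb n hn0 z.2 - z.1 • n) with hΨ
  have hmp : MeasurePreserving Ψ volume volume := measurePreserving_planeEmb_sub n hn hn0 P
  have hme : MeasurableEmbedding Ψ := measurableEmbedding_planeEmb_sub n hn hn0 P
  obtain ⟨e, he⟩ := exists_planeEmb_decomposition n hn hn0
  have hclosed : Topology.IsClosedEmbedding Ψ := by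
    have h := ((Homeomorph.addLeft P).isClosedEmbedding.comp
      (e.toHomeomorph.isClosedEmbedding.comp
        (WithLp.homeomorphProd 2 ℝ (EuclideanSpace ℝ (Fin N))).symm.isClosedEmbedding))
    convert! h using 1
    ext1 z
    simp only [hΨ, ← he]
    rfl
  have hΨd : ∀ z, HasFDerivAt Ψ ((planeEmb n hn0).toContinuousLinearMap.comp
      (ContinuousLinearMap.snd ℝ ℝ _) - (ContinuousLinearMap.fst ℝ ℝ _).smulRight n) z :=
    fun z => (((planeEmb n hn0).toContinuousLinearMap.comp
      (ContinuousLinearMap.snd ℝ ℝ _) - (ContinuousLinearMap.fst ℝ ℝ _).smulRight n).hasFDerivAt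
      ).const_add P
  have hΨs : ContDiff ℝ 1 Ψ := by
    have := (planeEmb n hn0).contDiff (n := 1)
    fun_prop
  set g : ℝ × EuclideanSpace ℝ (Fin N) → ℝ := f ∘ Ψ with hg
  have hgs : ContDiff ℝ 1 g := hf.comp hΨs
  have hgc : HasCompactSupport g := hc.comp_isClosedEmbedding hclosed
  obtain ⟨w, rfl⟩ := e.surjective u
  obtain ⟨u0, u1⟩ := w
  rw [he]
  have hnn : inner ℝ n (planeEmb n hn0 u1 - u0 • n) = -u0 := by
    rw [inner_sub_right, inner_planeEmb, real_inner_smul_right, real_inner_self_eq_norm_sq, hn]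
    ring
  have hder : ∀ z, fderiv ℝ f (Ψ z) (planeEmb n hn0 u1 - u0 • n) =
      u0 * fderiv ℝ g z (1, 0) + fderiv ℝ g z (0, u1) := fun z => by
    have h1 := ((hf.differentiable one_ne_zero (Ψ z)).hasFDerivAt.comp z (hΨd z)).fderiv
    rw [← hg] at h1
    simp only [h1, ContinuousLinearMap.comp_apply, sub_apply,
      ContinuousLinearMap.smulRight_apply, map_sub, map_smul, smul_eq_mul]
    simp
    ring
  have hset : Ψ ⁻¹' {x | inner ℝ n (x - P) < 0} = Set.Ioi 0 ×ˢ Set.univ := by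
    ext z
    have h : inner ℝ n (Ψ z - P) = -z.1 := by
      rw [hΨ, add_sub_cancel_left, inner_sub_right, inner_planeEmb, real_inner_smul_right,
        real_inner_self_eq_norm_sq, hn]
      ring
    simp only [Set.mem_preimage, Set.mem_ofPred_eq, h]
    simp
  have hcont : ∀ v, Continuous fun z => fderiv ℝ g z v := fun v =>
    (hgs.continuous_fderiv one_ne_zero).clm_apply continuous_const
  have hint : ∀ v, Integrable fun z => fderiv ℝ g z v := fun v =>
    (hcont v).integrable_of_hasCompactSupport (hgc.fderiv_apply (𝕜 := ℝ) v)
  rw [← hmp.setIntegral_preimage_emb hme, hset, hnn]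
  simp only [hder]
  rw [integral_add ((hint _).const_mul _).integrableOn (hint _).integrableOn, integral_const_mul]
  -- The tangential derivative integrates to zero on every slice of constant depth, since the slice
  -- of g has compact support.
  have hI2 : ∫ z in Set.Ioi (0 : ℝ) ×ˢ Set.univ, fderiv ℝ g z (0, u1) = 0 := by
    rw [Measure.volume_eq_prod, setIntegral_prod _ (by
      rw [← Measure.volume_eq_prod]; exact (hint _).integrableOn)]
    refine setIntegral_eq_zero_of_forall_eq_zero fun t _ => ?_
    rw [setIntegral_univ]
    have hcl : Topology.IsClosedEmbedding (fun y : EuclideanSpace ℝ (Fin N) => (t, y)) :=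
      (Isometry.of_dist_eq fun y y' => by simp [Prod.dist_eq]).isClosedEmbedding
    have hs : ContDiff ℝ 1 fun y : EuclideanSpace ℝ (Fin N) => g (t, y) := by fun_prop
    refine Eq.trans (integral_congr_ae (Eventually.of_forall fun y => ?_))
      (integral_fderiv_eq_zero_of_compactSupport volume hs (hgc.comp_isClosedEmbedding hcl) u1)
    have h1 := (hgs.differentiable one_ne_zero (t, y)).hasFDerivAt.comp y
      (hasFDerivAt_prodMk_right t y)
    have h2 : fderiv ℝ (fun y : EuclideanSpace ℝ (Fin N) => g (t, y)) y =
      (fderiv ℝ g (t, y)).comp (ContinuousLinearMap.inr ℝ ℝ _) := h1.fderiv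
    simp [h2]
  -- On each normal ray the fundamental theorem of calculus leaves only the boundary value at depth
  -- 0.
  have hI1 : ∫ z in Set.Ioi (0 : ℝ) ×ˢ Set.univ, fderiv ℝ g z (1, 0) =
      -∫ y, f (P + planeEmb n hn0 y) := by
    rw [Measure.volume_eq_prod, ← Measure.prod_restrict, integral_prod_symm _ (by
      rw [Measure.prod_restrict, ← Measure.volume_eq_prod]; exact (hint _).integrableOn),
      Measure.restrict_univ, ← integral_neg]
    refine integral_congr_ae (Eventually.of_forall fun y => ?_)
    have hcl : Topology.IsClosedEmbedding (fun t : ℝ => (t, y)) :=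
      (Isometry.of_dist_eq fun t t' => by simp [Prod.dist_eq]).isClosedEmbedding
    have hs : ContDiff ℝ 1 fun t : ℝ => g (t, y) := by fun_prop
    have h := HasCompactSupport.integral_Ioi_deriv_eq hs (hgc.comp_isClosedEmbedding hcl) 0
    have h2 : g (0, y) = f (P + planeEmb n hn0 y) := by simp [hg, hΨ]
    rw [h2] at h
    dsimp only
    rw [← h]
    refine integral_congr_ae (Eventually.of_forall fun t => ?_)
    have h1 := (hgs.differentiable one_ne_zero (t, y)).hasFDerivAt.comp_hasDerivAt t
      ((hasDerivAt_id t).prodMk (hasDerivAt_const t y))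
    exact h1.deriv.symm
  rw [hI1, hI2]
  ring

end HalfSpace

/-! ### Surface measure on a face and the divergence theorem on K -/

section Surface

variable {N : ℕ} (K : Affine.Simplex ℝ (EuclideanSpace ℝ (Fin (N + 1))) (N + 1))

theorem outwardNormal_ne_zero (i : Fin (N + 1 + 1)) : outwardNormal K i ≠ 0 :=
  norm_pos_iff.1 (by rw [norm_outwardNormal]; exact one_pos)

/-- An isometric parametrization of the hyperplane spanned by the face opposite to `i`. -/
def faceChart (i : Fin (N + 1 + 1)) (y : EuclideanSpace ℝ (Fin N)) :
    EuclideanSpace ℝ (Fin (N + 1)) :=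
  K.altitudeFoot i + planeEmb (outwardNormal K i) (outwardNormal_ne_zero K i) y

theorem isometry_faceChart (i : Fin (N + 1 + 1)) : Isometry (faceChart K i) :=
  (isometry_add_left _).comp (planeEmb _ _).isometry

theorem isClosedEmbedding_faceChart (i : Fin (N + 1 + 1)) :
    Topology.IsClosedEmbedding (faceChart K i) :=
  (isometry_faceChart K i).isClosedEmbedding

theorem bary_altitudeFoot (i : Fin (N + 1 + 1)) : bary K i (K.altitudeFoot i) = 0 := by
  have := norm_altitude_pos K i
  rw [bary, grad, real_inner_smul_left, ← neg_sub (K.points i), inner_neg_right,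
    real_inner_self_eq_norm_sq]
  field_simp
  simp

theorem bary_eq_inner_outwardNormal (i : Fin (N + 1 + 1)) (x : EuclideanSpace ℝ (Fin (N + 1))) :
    bary K i x = -(‖grad K i‖ * inner ℝ (outwardNormal K i) (x - K.altitudeFoot i)) := by
  have h := bary_sub K i x (K.altitudeFoot i)
  have hg := norm_grad_pos K i
  rw [bary_altitudeFoot, sub_zero] at h
  rw [h, outwardNormal_eq, inner_neg_left, real_inner_smul_left]
  field_simp

theorem bary_faceChart_self (i : Fin (N + 1 + 1)) (y : EuclideanSpace ℝ (Fin N)) :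
    bary K i (faceChart K i y) = 0 := by
  rw [bary_eq_inner_outwardNormal, faceChart, add_sub_cancel_left, inner_planeEmb]
  simp

theorem exists_faceChart_add (i : Fin (N + 1 + 1)) (x : EuclideanSpace ℝ (Fin (N + 1))) :
    ∃ y, x = faceChart K i y - (bary K i x / ‖grad K i‖) • outwardNormal K i := by
  obtain ⟨e, he⟩ := exists_planeEmb_decomposition _ (norm_outwardNormal K i)
    (outwardNormal_ne_zero K i)
  obtain ⟨⟨t, y⟩, hz⟩ := e.surjective (x - K.altitudeFoot i)
  rw [he] at hz
  have hb := bary_eq_inner_outwardNormal K i x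
  rw [← hz, inner_sub_right, inner_planeEmb, real_inner_smul_right, real_inner_self_eq_norm_sq,
    norm_outwardNormal] at hb
  have hg := norm_grad_pos K i
  have ht : bary K i x / ‖grad K i‖ = t := by rw [hb]; field_simp; ring
  refine ⟨y, ?_⟩
  rw [ht, faceChart, add_sub_assoc, hz]
  abel

/-- An isometry transports Hausdorff measure, and on ℝ^N the Euclidean Hausdorff measure of
dimension N is Lebesgue measure. Surface integrals thus become integrals over a compact subset of
ℝ^N. -/
theorem surf_eq_map (i : Fin (N + 1 + 1)) :
    surf K i = (volume.restrict (faceChart K i ⁻¹' (K.faceOpposite i).closedInterior)).map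
      (faceChart K i) := by
  have hm := (isClosedEmbedding_faceChart K i).measurableEmbedding
  have hface : MeasurableSet (K.faceOpposite i).closedInterior := (isClosed_face K i).measurableSet
  rw [← Measure.restrict_map hm.measurable hface,
    ← EuclideanSpace.euclideanHausdorffMeasure_eq_volume,
    (isometry_faceChart K i).map_euclideanHausdorffMeasure, Measure.restrict_restrict hface,
    Set.inter_eq_left.2]
  · rfl
  · intro x hx
    obtain ⟨y, hy⟩ := exists_faceChart_add K i x
    refine ⟨y, ?_⟩
    rw [((mem_face_iff K i).1 hx).1] at hy
    simpa using hy.symm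

theorem integral_surf (i : Fin (N + 1 + 1)) (F : EuclideanSpace ℝ (Fin (N + 1)) → ℝ) :
    ∫ x, F x ∂(surf K i) =
      ∫ y in faceChart K i ⁻¹' (K.faceOpposite i).closedInterior, F (faceChart K i y) := by
  rw [surf_eq_map, (isClosedEmbedding_faceChart K i).measurableEmbedding.integral_map]

instance isFiniteMeasure_surf (i : Fin (N + 1 + 1)) : IsFiniteMeasure (surf K i) := by
  rw [surf_eq_map]
  have hc : IsCompact (faceChart K i ⁻¹' (K.faceOpposite i).closedInterior) :=
    (isClosedEmbedding_faceChart K i).isCompact_preimage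
      (K.faceOpposite i).isCompact_closedInterior
  have : IsFiniteMeasure
      (volume.restrict (faceChart K i ⁻¹' (K.faceOpposite i).closedInterior)) :=
    ⟨by rw [Measure.restrict_apply_univ]; exact hc.measure_lt_top⟩
  infer_instance

theorem ae_bary_ne_zero (i : Fin (N + 1 + 1)) : ∀ᵐ x, bary K i x ≠ 0 := by
  have hg := norm_grad_pos K i
  let S := AffineSubspace.mk' (K.altitudeFoot i) (Submodule.span ℝ {grad K i})ᗮ
  have hS : ∀ x, x ∈ S ↔ bary K i x = 0 := fun x => by
    rw [AffineSubspace.mem_mk', Submodule.mem_orthogonal_singleton_iff_inner_right, vsub_eq_sub,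
      ← bary_sub, bary_altitudeFoot, sub_zero]
  have htop : S ≠ ⊤ := fun h => by
    have h1 := (hS (K.points i)).1 (h ▸ AffineSubspace.mem_top ℝ _ _)
    simp [bary_point] at h1
  have h := Measure.addHaar_affineSubspace volume S htop
  refine measure_mono_null (fun x hx => ?_) h
  exact (hS x).2 (not_not.1 hx)

/-- The divergence theorem on `K` for functions vanishing on the faces other than the face
opposite to `i`. -/
theorem integral_vol_fderiv (i : Fin (N + 1 + 1)) {f : EuclideanSpace ℝ (Fin (N + 1)) → ℝ}
    (hf : ContDiff ℝ 1 f) (hc : HasCompactSupport f)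
    (h0 : ∀ x, 0 ≤ bary K i x → x ∉ K.closedInterior → f x = 0)
    (u : EuclideanSpace ℝ (Fin (N + 1))) :
    ∫ x, fderiv ℝ f x u ∂(vol K) = inner ℝ (outwardNormal K i) u * ∫ x, f x ∂(surf K i) := by
  have hg := norm_grad_pos K i
  have hH : {x | inner ℝ (outwardNormal K i) (x - K.altitudeFoot i) < 0} = {x | 0 < bary K i x} := by
    ext x
    simp only [Set.mem_ofPred_eq, bary_eq_inner_outwardNormal, Left.neg_pos_iff]
    rw [mul_neg_iff]
    simp [hg, hg.le.not_gt]
  have h := integral_halfSpace_fderiv _ (norm_outwardNormal K i) (outwardNormal_ne_zero K i)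
    (K.altitudeFoot i) hf hc u
  rw [hH] at h
  -- A point of the hyperplane of the face that lies in K lies in the face, so f vanishes on the
  -- rest of the hyperplane and the half-space boundary integral reduces to the face.
  have hsurf : ∫ x, f x ∂(surf K i) =
      ∫ y, f (K.altitudeFoot i + planeEmb (outwardNormal K i) (outwardNormal_ne_zero K i) y) := by
    rw [integral_surf, setIntegral_eq_integral_of_forall_compl_eq_zero]
    · rfl
    · intro y hy
      refine h0 _ (bary_faceChart_self K i y).ge fun hK => hy ?_
      exact (mem_face_iff K i).2 ⟨bary_faceChart_self K i y, (mem_closedInterior_iff K).1 hK⟩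
  rw [hsurf, ← h, vol]
  have hopen : IsOpen {x | 0 < bary K i x} := isOpen_lt continuous_const (continuous_bary K i)
  have hsub : (K.closedInterior ∩ {x | 0 < bary K i x} : Set _) =ᵐ[volume] K.closedInterior := by
    filter_upwards [ae_bary_ne_zero K i] with x hx
    refine propext ⟨fun h => h.1, fun h => ⟨h, lt_of_le_of_ne ((mem_closedInterior_iff K).1 h i) ?_⟩⟩
    exact hx.symm
  rw [← setIntegral_congr_set hsub]
  refine (setIntegral_eq_of_subset_of_forall_sdiff_eq_zero hopen.measurableSet
    Set.inter_subset_right fun x hx => ?_).symm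
  have hxK : x ∉ K.closedInterior := fun h => hx.2 ⟨h, hx.1⟩
  -- The complement of K in the open half-space is open and f vanishes on it, so the derivative
  -- vanishes there too and the half-space integral reduces to K.
  have hev : f =ᶠ[𝓝 x] fun _ => 0 := by
    filter_upwards [hopen.mem_nhds hx.1, K.isClosed_closedInterior.isOpen_compl.mem_nhds hxK]
      with y hy hyK
    exact h0 y (le_of_lt hy) hyK
  rw [hev.fderiv_eq]
  simp

end Surface

/-! ### Cutoff functions concentrated on one face -/

section Cutoff

/-- Squaring the positive part makes it C¹ across 0. The cutoff can then vanish identically where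
λ_j ≤ 0 and still be admissible in the divergence theorem. -/
theorem hasDerivAt_max_zero_sq (x : ℝ) :
    HasDerivAt (fun y : ℝ => max y 0 ^ 2) (2 * max x 0) x := by
  rcases lt_trichotomy x 0 with h | rfl | h
  · rw [max_eq_right h.le, mul_zero]
    refine (hasDerivAt_const x (0 : ℝ)).congr_of_eventuallyEq ?_
    filter_upwards [gt_mem_nhds h] with y hy
    rw [max_eq_right hy.le]; ring
  · rw [max_self, mul_zero]
    refine HasDerivAt.of_isLittleO ?_
    have h1 : (fun y : ℝ => max y 0 ^ 2) =O[𝓝 0] fun y : ℝ => y ^ 2 := by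
      refine Asymptotics.IsBigO.of_bound 1 (Eventually.of_forall fun y => ?_)
      rw [one_mul, norm_pow, norm_pow]
      gcongr
      rw [Real.norm_eq_abs, Real.norm_eq_abs, abs_of_nonneg (le_max_right _ _)]
      exact max_le (le_abs_self y) (abs_nonneg y)
    have h2 : (fun y : ℝ => y ^ 2) =o[𝓝 0] fun y : ℝ => y := by
      simpa using Asymptotics.isLittleO_pow_pow (𝕜 := ℝ) (m := 1) (n := 2) (by norm_num)
    simpa using h1.trans_isLittleO h2
  · have h1 : HasDerivAt (fun y : ℝ => y ^ 2) (2 * x) x := by simpa using hasDerivAt_pow 2 x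
    rw [max_eq_left h.le]
    refine h1.congr_of_eventuallyEq ?_
    filter_upwards [lt_mem_nhds h] with y hy
    rw [max_eq_left hy.le]

theorem contDiff_max_zero_sq : ContDiff ℝ 1 fun y : ℝ => max y 0 ^ 2 := by
  rw [contDiff_one_iff_deriv]
  refine ⟨fun x => (hasDerivAt_max_zero_sq x).differentiableAt, ?_⟩
  have h : deriv (fun y : ℝ => max y 0 ^ 2) = fun x => 2 * max x 0 :=
    funext fun x => (hasDerivAt_max_zero_sq x).deriv
  rw [h]
  fun_prop

variable {d : ℕ} [NeZero d] (K : Affine.Simplex ℝ (EuclideanSpace ℝ (Fin d)) d)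

/-- A `C¹` approximation of the function that is `1` on the face opposite to `i` and `0` on the
face opposite to `j`. -/
def cutoffFactor (i : Fin (d + 1)) (ε : ℝ) (j : Fin (d + 1)) (x : EuclideanSpace ℝ (Fin d)) : ℝ :=
  max (bary K j x) 0 ^ 2 * ((bary K i x + bary K j x) ^ 2 + ε ^ 2)⁻¹

/-- A `C¹` approximation of the function that is `1` on the face opposite to `i` and `0` on the
other faces. -/
def cutoff (i : Fin (d + 1)) (ε : ℝ) (x : EuclideanSpace ℝ (Fin d)) : ℝ :=
  ∏ j ∈ Finset.univ.erase i, cutoffFactor K i ε j x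

theorem cutoff_denom_pos (i j : Fin (d + 1)) {ε : ℝ} (hε : 0 < ε)
    (x : EuclideanSpace ℝ (Fin d)) : 0 < (bary K i x + bary K j x) ^ 2 + ε ^ 2 := by
  positivity

theorem contDiff_cutoffFactor (i j : Fin (d + 1)) {ε : ℝ} (hε : 0 < ε) :
    ContDiff ℝ 1 (cutoffFactor K i ε j) := by
  unfold cutoffFactor
  refine (contDiff_max_zero_sq.comp (contDiff_bary K j)).mul (ContDiff.inv ?_ fun x =>
    (cutoff_denom_pos K i j hε x).ne')
  exact (((contDiff_bary K i).add (contDiff_bary K j)).pow 2).add contDiff_const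

theorem contDiff_cutoff (i : Fin (d + 1)) {ε : ℝ} (hε : 0 < ε) :
    ContDiff ℝ 1 (cutoff K i ε) :=
  contDiff_prod fun j _ => contDiff_cutoffFactor K i j hε

theorem cutoffFactor_nonneg (i j : Fin (d + 1)) (ε : ℝ) (x : EuclideanSpace ℝ (Fin d)) :
    0 ≤ cutoffFactor K i ε j x := by
  unfold cutoffFactor
  positivity

theorem cutoffFactor_le_one (i j : Fin (d + 1)) {ε : ℝ} (hε : 0 < ε)
    {x : EuclideanSpace ℝ (Fin d)} (hi : 0 ≤ bary K i x) (hj : 0 ≤ bary K j x) :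
    cutoffFactor K i ε j x ≤ 1 := by
  rw [cutoffFactor, max_eq_left hj, mul_inv_le_iff₀ (cutoff_denom_pos K i j hε x)]
  nlinarith [sq_nonneg ε, mul_nonneg hi hj, sq_nonneg (bary K i x)]

theorem cutoff_nonneg (i : Fin (d + 1)) (ε : ℝ) (x : EuclideanSpace ℝ (Fin d)) :
    0 ≤ cutoff K i ε x :=
  Finset.prod_nonneg fun j _ => cutoffFactor_nonneg K i j ε x

theorem cutoff_le_one (i : Fin (d + 1)) {ε : ℝ} (hε : 0 < ε) {x : EuclideanSpace ℝ (Fin d)}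
    (hx : ∀ j, 0 ≤ bary K j x) : cutoff K i ε x ≤ 1 :=
  Finset.prod_le_one (fun j _ => cutoffFactor_nonneg K i j ε x)
    fun j _ => cutoffFactor_le_one K i j hε (hx i) (hx j)

/-- A point outside K with λ_i ≥ 0 violates λ_j ≥ 0 for some j ≠ i, and that positive part kills the
product. This is the vanishing condition of `integral_vol_fderiv`. -/
theorem cutoff_eq_zero (i : Fin (d + 1)) (ε : ℝ) {x : EuclideanSpace ℝ (Fin d)}
    (hi : 0 ≤ bary K i x) (hx : x ∉ K.closedInterior) : cutoff K i ε x = 0 := by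
  obtain ⟨j, hj⟩ : ∃ j, bary K j x < 0 := by
    by_contra! h
    exact hx ((mem_closedInterior_iff K).2 h)
  have hji : j ≠ i := by rintro rfl; exact hj.not_ge hi
  refine Finset.prod_eq_zero (Finset.mem_erase.2 ⟨hji, Finset.mem_univ j⟩) ?_
  rw [cutoffFactor, max_eq_right hj.le]
  ring

/-- Where λ_i = 0 each factor is λ_j² / (λ_j² + ε²), continuous at ε = 0 as long as λ_j > 0. -/
theorem tendsto_cutoff (i : Fin (d + 1)) {x : EuclideanSpace ℝ (Fin d)} (hi : bary K i x = 0)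
    (hx : ∀ j, j ≠ i → 0 < bary K j x) :
    Tendsto (fun ε => cutoff K i ε x) (𝓝 0) (𝓝 1) := by
  have h : ∀ j ∈ Finset.univ.erase i, Tendsto (fun ε => cutoffFactor K i ε j x) (𝓝 0) (𝓝 1) := by
    intro j hj
    have hj' := hx j (Finset.ne_of_mem_erase hj)
    have hc : ContinuousAt (fun ε => cutoffFactor K i ε j x) 0 := by
      unfold cutoffFactor
      refine continuousAt_const.mul (ContinuousAt.inv₀ (by fun_prop) ?_)
      rw [hi]; positivity
    have h0 : cutoffFactor K i 0 j x = 1 := by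
      rw [cutoffFactor, hi, max_eq_left hj'.le]
      field_simp
      simp
    rw [← h0]
    exact hc
  simpa [cutoff] using tendsto_finsetProd _ h

/-- The point is that ε does not occur in the bound. In the quotient rule, λ_j ≤ λ_i + λ_j and the
denominator is at least (λ_i + λ_j)²; the numerator then contributes 2b and the denominator 4b, each
times (λ_i + λ_j)⁻¹. -/
theorem mul_norm_fderiv_cutoffFactor_le (i j : Fin (d + 1)) {ε b : ℝ} (hε : 0 < ε)
    (hb : ∀ k, ‖grad K k‖ ≤ b) {x : EuclideanSpace ℝ (Fin d)} (hi : 0 < bary K i x)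
    (hj : 0 ≤ bary K j x) :
    ‖fderiv ℝ (cutoffFactor K i ε j) x‖ ≤ 6 * b * (bary K i x + bary K j x)⁻¹ := by
  have hb0 : 0 ≤ b := (norm_nonneg _).trans (hb i)
  have h1 := (hasDerivAt_max_zero_sq (bary K j x)).comp_hasFDerivAt x (hasFDerivAt_bary K j x)
  have h2 := ((((hasFDerivAt_bary K i x).add (hasFDerivAt_bary K j x)).pow 2).add_const (ε ^ 2))
  have h3 := (hasDerivAt_inv (cutoff_denom_pos K i j hε x).ne').comp_hasFDerivAt x h2
  have h4 := (h1.mul h3).fderiv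
  have h5 : fderiv ℝ (cutoffFactor K i ε j) x = _ := h4
  rw [h5]
  set a := bary K i x with ha
  set c := bary K j x with hc
  set D := (a + c) ^ 2 + ε ^ 2 with hD
  have hDpos : 0 < D := by positivity
  have hs : 0 < a + c := by positivity
  have hDs : (a + c) ^ 2 ≤ D := by rw [hD]; nlinarith [sq_nonneg ε]
  have hcs : c ≤ a + c := by linarith
  have hn : ∀ k, ‖innerSL ℝ (grad K k)‖ ≤ b := fun k => by rw [innerSL_apply_norm]; exact hb k
  refine (norm_add_le _ _).trans ?_
  simp only [Function.comp_apply, Pi.add_apply, norm_smul, max_eq_left hj, ← ha, ← hc]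
  rw [← hD]
  have e1 : ‖c ^ 2‖ * (‖-(D ^ 2)⁻¹‖ * (‖(2 : ℕ) • (a + c) ^ (2 - 1)‖ *
      ‖innerSL ℝ (grad K i) + innerSL ℝ (grad K j)‖)) ≤ 4 * b * (a + c)⁻¹ := by
    have hsum : ‖innerSL ℝ (grad K i) + innerSL ℝ (grad K j)‖ ≤ 2 * b :=
      (norm_add_le _ _).trans (by linarith [hn i, hn j])
    rw [norm_neg, Real.norm_of_nonneg (by positivity), Real.norm_of_nonneg (by positivity),
      Real.norm_of_nonneg (by simp; positivity)]
    calc c ^ 2 * ((D ^ 2)⁻¹ * (2 • (a + c) ^ (2 - 1) *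
          ‖innerSL ℝ (grad K i) + innerSL ℝ (grad K j)‖))
        ≤ (a + c) ^ 2 * ((((a + c) ^ 2) ^ 2)⁻¹ * (2 • (a + c) ^ (2 - 1) * (2 * b))) := by
          gcongr
      _ = 4 * b * (a + c)⁻¹ := by
          simp only [nsmul_eq_mul]
          field_simp
          ring
  have e2 : ‖D⁻¹‖ * (‖2 * c‖ * ‖innerSL ℝ (grad K j)‖) ≤ 2 * b * (a + c)⁻¹ := by
    rw [Real.norm_of_nonneg (by positivity), Real.norm_of_nonneg (by positivity)]
    calc D⁻¹ * (2 * c * ‖innerSL ℝ (grad K j)‖) ≤ ((a + c) ^ 2)⁻¹ * (2 * (a + c) * b) := by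
          gcongr
          exact hn j
      _ = 2 * b * (a + c)⁻¹ := by field_simp
  calc _ ≤ 4 * b * (a + c)⁻¹ + 2 * b * (a + c)⁻¹ := add_le_add e1 e2
    _ = _ := by ring

/-- Leibniz rule, with the undifferentiated factors bounded by 1. -/
theorem norm_fderiv_cutoff_le (i : Fin (d + 1)) {ε b : ℝ} (hε : 0 < ε)
    (hb : ∀ k, ‖grad K k‖ ≤ b) {x : EuclideanSpace ℝ (Fin d)} (hi : 0 < bary K i x)
    (hx : ∀ j, 0 ≤ bary K j x) :
    ‖fderiv ℝ (cutoff K i ε) x‖ ≤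
      ∑ j ∈ Finset.univ.erase i, 6 * b * (bary K i x + bary K j x)⁻¹ := by
  have h := HasFDerivAt.finsetProd (u := Finset.univ.erase i) (x := x)
    (g := fun j => cutoffFactor K i ε j) (g' := fun j => fderiv ℝ (cutoffFactor K i ε j) x)
    fun j _ => ((contDiff_cutoffFactor K i j hε).differentiable one_ne_zero x).hasFDerivAt
  have h' : fderiv ℝ (cutoff K i ε) x = _ := h.fderiv
  rw [h']
  refine norm_sum_le_of_le _ fun j _ => ?_
  rw [norm_smul]
  refine (mul_le_of_le_one_left (norm_nonneg _) ?_).trans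
    (mul_norm_fderiv_cutoffFactor_le K i j hε hb hi (hx j))
  rw [Real.norm_of_nonneg (Finset.prod_nonneg fun k _ => cutoffFactor_nonneg K i k ε x)]
  exact Finset.prod_le_one (fun k _ => cutoffFactor_nonneg K i k ε x)
    fun k _ => cutoffFactor_le_one K i k hε (hx i) (hx k)

end Cutoff

/-! ### Null sets on the faces -/

section NullSets

theorem volume_linear_eq_null {V : Type*} [NormedAddCommGroup V] [NormedSpace ℝ V]
    [FiniteDimensional ℝ V] [MeasurableSpace V] [BorelSpace V] (μ : Measure V)
    [μ.IsAddHaarMeasure] {L : V →ₗ[ℝ] ℝ} (hL : L ≠ 0) (c : ℝ) : μ {y | L y = c} = 0 := by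
  obtain ⟨v, hv⟩ : ∃ v, L v ≠ 0 := by
    by_contra! h
    exact hL (LinearMap.ext h)
  have hy0 : L ((c / L v) • v) = c := by
    rw [map_smul, smul_eq_mul, div_mul_cancel₀ _ hv]
  let S := AffineSubspace.mk' ((c / L v) • v) (LinearMap.ker L)
  have hS : ∀ x, x ∈ S ↔ L x = c := fun x => by
    rw [AffineSubspace.mem_mk', LinearMap.mem_ker, vsub_eq_sub, map_sub, hy0, sub_eq_zero]
  have htop : S ≠ ⊤ := fun h => by
    have h1 := (hS ((c / L v) • v + v)).1 (h ▸ AffineSubspace.mem_top ℝ _ _)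
    rw [map_add, hy0] at h1
    exact hv (by linarith)
  exact measure_mono_null (fun x hx => (hS x).2 hx) (Measure.addHaar_affineSubspace μ S htop)

variable {N : ℕ} (K : Affine.Simplex ℝ (EuclideanSpace ℝ (Fin (N + 1))) (N + 1))

/-- For N ≥ 1 there is a vertex k other than i and j. On the hyperplane of the face i, λ_j takes the
value 1 at the vertex j and 0 at k, so it is a nonconstant affine function with null zero set. Hence
the cutoff tends to 1 almost everywhere on the face. -/
theorem ae_surf_bary_ne_zero (hN : 1 ≤ N) {i j : Fin (N + 1 + 1)} (hij : j ≠ i) :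
    ∀ᵐ x ∂(surf K i), bary K j x ≠ 0 := by
  obtain ⟨k, hk⟩ : ∃ k, k ∉ ({i, j} : Finset (Fin (N + 1 + 1))) := by
    by_contra! h
    have := Finset.card_le_card (fun x _ => h x : Finset.univ ⊆ ({i, j} : Finset _))
    have h2 := Finset.card_le_two (a := i) (b := j)
    simp at this; omega
  simp only [Finset.mem_insert, Finset.mem_singleton, not_or] at hk
  have hmem : ∀ l, l ≠ i → ∃ y, faceChart K i y = K.points l := fun l hl => by
    obtain ⟨y, hy⟩ := exists_faceChart_add K i (K.points l)
    rw [bary_point, if_neg hl] at hy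
    exact ⟨y, by simpa using hy.symm⟩
  let L : EuclideanSpace ℝ (Fin N) →ₗ[ℝ] ℝ := (innerSL ℝ (grad K j)).toLinearMap.comp
    (planeEmb (outwardNormal K i) (outwardNormal_ne_zero K i)).toLinearMap
  have hval : ∀ y, bary K j (faceChart K i y) = bary K j (K.altitudeFoot i) + L y := fun y => by
    have := bary_sub K j (faceChart K i y) (K.altitudeFoot i)
    rw [faceChart, add_sub_cancel_left] at this
    change bary K j (faceChart K i y) = _ + inner ℝ (grad K j) (planeEmb _ _ y)
    rw [← this, faceChart]
    ring
  have hL : L ≠ 0 := fun h => by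
    obtain ⟨y, hy⟩ := hmem j hij
    obtain ⟨z, hz⟩ := hmem k hk.1
    have h1 := hval y
    have h2 := hval z
    rw [hy, bary_point, if_pos rfl, h] at h1
    rw [hz, bary_point, if_neg hk.2, h] at h2
    simp only [LinearMap.zero_apply] at h1 h2
    linarith
  rw [surf_eq_map, (isClosedEmbedding_faceChart K i).measurableEmbedding.ae_map_iff]
  refine ae_restrict_of_ae ?_
  refine measure_mono_null (fun y hy => ?_)
    (volume_linear_eq_null volume hL (-bary K j (K.altitudeFoot i)))
  have := not_not.1 hy
  rw [hval] at this
  exact eq_neg_of_add_eq_zero_right this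

end NullSets

/-! ### Integrability of the singular weight -/

section SingularIntegral

variable {d : ℕ} [NeZero d]

/-- The barycentric parametrization with base vertex `l`. -/
def baryParam (K : Affine.Simplex ℝ (EuclideanSpace ℝ (Fin d)) d) (l : Fin (d + 1)) :
    ({k : Fin (d + 1) // k ≠ l} → ℝ) →ₗ[ℝ] EuclideanSpace ℝ (Fin d) :=
  Fintype.linearCombination ℝ fun k => K.points k - K.points l

theorem bary_baryParam (K : Affine.Simplex ℝ (EuclideanSpace ℝ (Fin d)) d) {l : Fin (d + 1)}
    (ξ : {k : Fin (d + 1) // k ≠ l} → ℝ) (k : {k : Fin (d + 1) // k ≠ l}) :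
    bary K k (K.points l + baryParam K l ξ) = ξ k := by
  have h := bary_sub K k (K.points l + baryParam K l ξ) (K.points l)
  rw [add_sub_cancel_left, baryParam, Fintype.linearCombination_apply, inner_sum,
    bary_point, if_neg k.2.symm, sub_zero] at h
  rw [baryParam, Fintype.linearCombination_apply, h, Finset.sum_eq_single k]
  · rw [real_inner_smul_right, inner_grad_sub, if_pos rfl, if_neg k.2.symm]
    ring
  · intro b _ hb
    rw [real_inner_smul_right, inner_grad_sub, if_neg (fun h => hb (Subtype.ext h)),
      if_neg k.2.symm]
    ring
  · simp

theorem bijective_baryParam (K : Affine.Simplex ℝ (EuclideanSpace ℝ (Fin d)) d)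
    (l : Fin (d + 1)) : Function.Bijective (baryParam K l) := by
  refine ⟨fun ξ η h => funext fun k => ?_, fun v => ⟨fun k => inner ℝ (grad K k) v, ?_⟩⟩
  · rw [← bary_baryParam K ξ, ← bary_baryParam K η, h]
  · conv_rhs => rw [← sum_inner_grad_smul K v l]
    rw [baryParam, Fintype.linearCombination_apply,
      ← Finset.sum_subtype (Finset.univ.erase l) (by simp)
        (fun p => inner ℝ (grad K p) v • (K.points p - K.points l)),
      Finset.sum_erase _ (by simp)]

theorem volume_closedInterior_le (K : Affine.Simplex ℝ (EuclideanSpace ℝ (Fin d)) d) :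
    volume K.closedInterior ≤ ENNReal.ofReal (diam K ^ d) *
      volume (Metric.ball (0 : EuclideanSpace ℝ (Fin d)) 1) := by
  have hsub : K.closedInterior ⊆ Metric.closedBall (K.points 0) (diam K) := fun x hx =>
    dist_le_diam K hx (K.point_mem_closedInterior 0)
  refine (measure_mono hsub).trans ?_
  rw [Measure.addHaar_closedBall _ _ (diam_pos K).le]
  simp

/-- The constant c is the Jacobian of the barycentric parametrization. It is bounded without
computing a determinant: taking F = 1, it is the volume of K, at most that of a ball of radius h,
divided by the volume of the parameter simplex, at least d^(-d). -/
theorem exists_lintegral_vol_eq (K : Affine.Simplex ℝ (EuclideanSpace ℝ (Fin d)) d)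
    (l : Fin (d + 1)) :
    ∃ c : ENNReal, c ≤ ENNReal.ofReal (diam K ^ d) *
        (volume (Metric.ball (0 : EuclideanSpace ℝ (Fin d)) 1) *
          ENNReal.ofReal ((d : ℝ) ^ d)) ∧
      ∀ F : EuclideanSpace ℝ (Fin d) → ENNReal, Measurable F →
        ∫⁻ x, F x ∂(vol K) =
          c * ∫⁻ ξ in (fun ξ => K.points l + baryParam K l ξ) ⁻¹' K.closedInterior,
            F (K.points l + baryParam K l ξ) := by
  let T := (LinearEquiv.ofBijective _ (bijective_baryParam K l)).toContinuousLinearEquiv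
  have hT : ∀ ξ, T ξ = baryParam K l ξ := fun ξ => rfl
  have := T.isAddHaarMeasure_map (volume : Measure ({k : Fin (d + 1) // k ≠ l} → ℝ))
  obtain ⟨c, hc⟩ : ∃ c : NNReal, (volume : Measure (EuclideanSpace ℝ (Fin d))) =
      c • (volume : Measure ({k : Fin (d + 1) // k ≠ l} → ℝ)).map T :=
    ⟨_, Measure.isAddLeftInvariant_eq_smul _ _⟩
  have hem : MeasurableEmbedding fun ξ => K.points l + T ξ :=
    (measurableEmbedding_addLeft _).comp T.toHomeomorph.measurableEmbedding
  have hmap : (volume : Measure (EuclideanSpace ℝ (Fin d))) =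
      c • (volume : Measure ({k : Fin (d + 1) // k ≠ l} → ℝ)).map
        (fun ξ => K.points l + T ξ) := by
    have h1 := (measurePreserving_add_left (volume : Measure (EuclideanSpace ℝ (Fin d)))
      (K.points l)).map_eq
    rw [← h1, hc, Measure.map_smul, Measure.map_map (by fun_prop) (by fun_prop)]
    rfl
  have hmeas : MeasurableSet K.closedInterior := K.isClosed_closedInterior.measurableSet
  have hF : ∀ F : EuclideanSpace ℝ (Fin d) → ENNReal, Measurable F →
        ∫⁻ x, F x ∂(vol K) =
          c * ∫⁻ ξ in (fun ξ => K.points l + baryParam K l ξ) ⁻¹' K.closedInterior,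
            F (K.points l + baryParam K l ξ) := fun F hF => by
    rw [vol]
    conv_lhs => rw [hmap]
    rw [Measure.restrict_smul, hem.restrict_map, lintegral_smul_measure, hem.lintegral_map]
    rfl
  refine ⟨c, ?_, hF⟩
  have h1 := hF (fun _ => 1) measurable_const
  simp only [lintegral_one, vol, Measure.restrict_apply_univ] at h1
  have hd : (0 : ℝ) < d := by exact_mod_cast Nat.pos_of_ne_zero (NeZero.ne d)
  -- If d coordinates lie in (0, 1/d), the remaining barycentric coordinate is nonnegative.
  have hbox : (Set.univ.pi fun _ : {k : Fin (d + 1) // k ≠ l} => Set.Ioo (0 : ℝ) (d : ℝ)⁻¹) ⊆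
      (fun ξ => K.points l + baryParam K l ξ) ⁻¹' K.closedInterior := by
    intro ξ hξ
    rw [Set.mem_preimage, mem_closedInterior_iff]
    intro k
    rcases eq_or_ne k l with rfl | hk
    · have hsum := sum_bary K (K.points k + baryParam K k ξ)
      rw [← Finset.add_sum_erase _ _ (Finset.mem_univ k)] at hsum
      have hle : ∑ j ∈ Finset.univ.erase k, bary K j (K.points k + baryParam K k ξ) ≤
          ∑ j ∈ Finset.univ.erase k, (d : ℝ)⁻¹ := by
        refine Finset.sum_le_sum fun j hj => ?_
        have := bary_baryParam K ξ ⟨j, Finset.ne_of_mem_erase hj⟩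
        rw [this]
        exact (hξ _ trivial).2.le
      rw [Finset.sum_const, Finset.card_erase_of_mem (Finset.mem_univ k), Finset.card_univ,
        Fintype.card_fin, Nat.add_sub_cancel, nsmul_eq_mul, mul_inv_cancel₀ hd.ne'] at hle
      linarith
    · rw [bary_baryParam K ξ ⟨k, hk⟩]
      exact (hξ ⟨k, hk⟩ trivial).1.le
  have hvol : ENNReal.ofReal ((d : ℝ)⁻¹ ^ d) ≤
      volume ((fun ξ => K.points l + baryParam K l ξ) ⁻¹' K.closedInterior) := by
    refine le_trans (le_of_eq ?_) (measure_mono hbox)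
    rw [volume_pi_pi]
    rw [ENNReal.ofReal_pow (inv_nonneg.2 hd.le)]
    simp
  have hone : ENNReal.ofReal ((d : ℝ)⁻¹ ^ d) * ENNReal.ofReal ((d : ℝ) ^ d) = 1 := by
    rw [← ENNReal.ofReal_mul (by positivity), ← mul_pow, inv_mul_cancel₀ hd.ne', one_pow,
      ENNReal.ofReal_one]
  calc (c : ENNReal)
      = c * (ENNReal.ofReal ((d : ℝ)⁻¹ ^ d) * ENNReal.ofReal ((d : ℝ) ^ d)) := by
        rw [hone, mul_one]
    _ ≤ c * (volume ((fun ξ => K.points l + baryParam K l ξ) ⁻¹' K.closedInterior) *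
        ENNReal.ofReal ((d : ℝ) ^ d)) := by gcongr
    _ = volume K.closedInterior * ENNReal.ofReal ((d : ℝ) ^ d) := by rw [h1, mul_assoc]
    _ ≤ _ := by
        rw [← mul_assoc]
        gcongr
        exact volume_closedInterior_le K

theorem integrable_indicator_Icc_rpow {r : ℝ} (hr : -1 < r) :
    Integrable (Set.indicator (Set.Icc (0 : ℝ) 1) fun x => x ^ r) := by
  rw [integrable_indicator_iff measurableSet_Icc, integrableOn_Icc_iff_integrableOn_Ioc,
    ← intervalIntegrable_iff_integrableOn_Ioc_of_le zero_le_one]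
  exact intervalIntegral.intervalIntegrable_rpow' hr

theorem ae_vol_bary_pos {N : ℕ} (K : Affine.Simplex ℝ (EuclideanSpace ℝ (Fin (N + 1))) (N + 1))
    (i : Fin (N + 1 + 1)) : ∀ᵐ x ∂(vol K), 0 < bary K i x := by
  filter_upwards [ae_restrict_of_ae (ae_bary_ne_zero K i),
    ae_restrict_mem K.isClosed_closedInterior.measurableSet] with x hx hK
  exact lt_of_le_of_ne ((mem_closedInterior_iff K).1 hK i) hx.symm

/-- Since (a + b)^(-q) ≤ a^(-q/2) b^(-q/2), the weight is dominated by a product of one-variable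
powers, integrable on [0, 1] because q/2 < 1. The base vertex l is chosen different from i and j, so
that λ_i and λ_j are two independent coordinates of the parametrization. -/
theorem exists_lintegral_inv_bary_le {N : ℕ} (hN : 1 ≤ N) {q : ℝ} (hq0 : 0 ≤ q) (hq : q < 2)
    {i j : Fin (N + 1 + 1)} (hij : i ≠ j) :
    ∃ M : ENNReal, M ≠ ⊤ ∧ ∀ K : Affine.Simplex ℝ (EuclideanSpace ℝ (Fin (N + 1))) (N + 1),
      ∫⁻ x, ENNReal.ofReal ((bary K i x + bary K j x)⁻¹ ^ q) ∂(vol K) ≤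
        ENNReal.ofReal (diam K ^ (N + 1)) * M := by
  obtain ⟨l, hl⟩ : ∃ l, l ∉ ({i, j} : Finset (Fin (N + 1 + 1))) := by
    by_contra! h
    have := Finset.card_le_card (fun x _ => h x : Finset.univ ⊆ ({i, j} : Finset _))
    have h2 := Finset.card_le_two (a := i) (b := j)
    simp at this; omega
  simp only [Finset.mem_insert, Finset.mem_singleton, not_or] at hl
  let i' : {k : Fin (N + 1 + 1) // k ≠ l} := ⟨i, Ne.symm hl.1⟩
  let j' : {k : Fin (N + 1 + 1) // k ≠ l} := ⟨j, Ne.symm hl.2⟩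
  have hij' : i' ≠ j' := fun h => hij (congrArg Subtype.val h)
  let r : {k : Fin (N + 1 + 1) // k ≠ l} → ℝ := fun k => if k = i' ∨ k = j' then -(q / 2) else 0
  let f : {k : Fin (N + 1 + 1) // k ≠ l} → ℝ → ℝ :=
    fun k => Set.indicator (Set.Icc (0 : ℝ) 1) fun x => x ^ r k
  have hf : Integrable fun ξ : {k : Fin (N + 1 + 1) // k ≠ l} → ℝ => ∏ k, f k (ξ k) := by
    refine Integrable.fintype_prod_dep fun k => integrable_indicator_Icc_rpow ?_
    simp only [r]
    split_ifs <;> linarith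
  obtain ⟨J, hJ⟩ : ∃ J : ENNReal, J = ∫⁻ ξ : ({k : Fin (N + 1 + 1) // k ≠ l} → ℝ), ‖∏ k, f k (ξ k)‖ₑ := ⟨_, rfl⟩
  have hJt : J ≠ ⊤ := hJ ▸ hf.hasFiniteIntegral.ne
  obtain ⟨V, hV⟩ : ∃ V, V = volume (Metric.ball (0 : EuclideanSpace ℝ (Fin (N + 1))) 1) *
      ENNReal.ofReal (((N + 1 : ℕ) : ℝ) ^ (N + 1)) := ⟨_, rfl⟩
  have hVt : V ≠ ⊤ := by
    rw [hV]
    exact ENNReal.mul_ne_top measure_ball_lt_top.ne ENNReal.ofReal_ne_top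
  refine ⟨V * J, ENNReal.mul_ne_top hVt hJt, fun K => ?_⟩
  obtain ⟨c, hc, hF⟩ := exists_lintegral_vol_eq K l
  rw [← hV] at hc
  let G : EuclideanSpace ℝ (Fin (N + 1)) → ENNReal := fun x =>
    ENNReal.ofReal (bary K i x ^ (-(q / 2)) * bary K j x ^ (-(q / 2)))
  have hG : Measurable G := by
    have h1 := (continuous_bary K i).measurable
    have h2 := (continuous_bary K j).measurable
    fun_prop
  calc ∫⁻ x, ENNReal.ofReal ((bary K i x + bary K j x)⁻¹ ^ q) ∂(vol K)
      ≤ ∫⁻ x, G x ∂(vol K) := by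
        refine lintegral_mono_ae ?_
        filter_upwards [ae_vol_bary_pos K i, ae_vol_bary_pos K j] with x hi hj
        refine ENNReal.ofReal_le_ofReal ?_
        rw [Real.inv_rpow (by positivity), ← Real.rpow_neg (by positivity),
          show -q = -(q / 2) + -(q / 2) by ring, Real.rpow_add (by positivity)]
        gcongr ?_ * ?_
        · exact Real.rpow_le_rpow_of_nonpos hi (by linarith) (by linarith)
        · exact Real.rpow_le_rpow_of_nonpos hj (by linarith) (by linarith)
    _ = c * ∫⁻ ξ in (fun ξ => K.points l + baryParam K l ξ) ⁻¹' K.closedInterior,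
            G (K.points l + baryParam K l ξ) := hF G hG
    _ ≤ c * J := by
        rw [hJ]
        refine mul_le_mul_right ?_ _
        refine le_trans ?_ (setLIntegral_le_lintegral
          ((fun ξ => K.points l + baryParam K l ξ) ⁻¹' K.closedInterior) _)
        refine setLIntegral_mono' ?_ fun ξ hξ => ?_
        · refine K.isClosed_closedInterior.measurableSet.preimage ?_
          have := (baryParam K l).continuous_of_finiteDimensional.measurable
          fun_prop
        · have hmem : ∀ k, ξ k ∈ Set.Icc (0 : ℝ) 1 := fun k => by
            rw [← bary_baryParam K ξ k]
            exact ⟨(mem_closedInterior_iff K).1 hξ k, bary_le_one K hξ k⟩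
          have hprod : ∏ k, f k (ξ k) = ξ i' ^ (-(q / 2)) * ξ j' ^ (-(q / 2)) := by
            rw [Fintype.prod_eq_mul i' j' hij']
            · simp only [f, Set.indicator_of_mem (hmem _)]
              simp [r]
            · intro k hk
              simp only [f, Set.indicator_of_mem (hmem _)]
              simp [r, hk.1, hk.2]
          have hi := bary_baryParam K ξ i'
          have hj := bary_baryParam K ξ j'
          rw [hprod, ← hi, ← hj]
          exact Real.ofReal_le_enorm _
    _ ≤ _ := by
        refine (mul_le_mul_left hc _).trans (le_of_eq ?_)
        ring

end SingularIntegral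

/-! ### Inverse estimates for polynomials -/

section InverseEstimate

/-- The map from coefficients to L² of the unit ball is linear and injective on a finite-dimensional
space, hence bounded below. The coefficients then bound the function and its derivative on any ball.
-/
theorem exists_inverse_estimate {V : Type*} [NormedAddCommGroup V] [NormedSpace ℝ V]
    [FiniteDimensional ℝ V] [MeasurableSpace V] [BorelSpace V] (μ : Measure V)
    [μ.IsAddHaarMeasure] {m : ℕ} {f : Fin m → V → ℝ} (hf : ∀ k, ContDiff ℝ 1 (f k))
    (hind : ∀ c : Fin m → ℝ, (∀ y ∈ Metric.ball (0 : V) 1, ∑ k, c k * f k y = 0) → c = 0)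
    (R : ℝ) :
    ∃ C : ℝ, 0 ≤ C ∧ ∀ c : Fin m → ℝ, ∀ y ∈ Metric.closedBall (0 : V) R,
      |∑ k, c k * f k y| ≤ C * (eLpNorm (fun y => ∑ k, c k * f k y) 2
        (μ.restrict (Metric.ball 0 1))).toReal ∧
      ‖fderiv ℝ (fun y => ∑ k, c k * f k y) y‖ ≤
        C * (eLpNorm (fun y => ∑ k, c k * f k y) 2 (μ.restrict (Metric.ball 0 1))).toReal := by
  have hmem : ∀ g : V → ℝ, Continuous g → MemLp g 2 (μ.restrict (Metric.ball 0 1)) := by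
    intro g hg
    obtain ⟨A, hA⟩ := (isCompact_closedBall (0 : V) 1).exists_bound_of_continuousOn hg.continuousOn
    have : IsFiniteMeasure (μ.restrict (Metric.ball (0 : V) 1)) :=
      ⟨by rw [Measure.restrict_apply_univ]; exact measure_ball_lt_top⟩
    refine MemLp.of_bound hg.aestronglyMeasurable A ?_
    filter_upwards [ae_restrict_mem Metric.isOpen_ball.measurableSet] with y hy
    exact hA y (Metric.ball_subset_closedBall hy)
  let F : Fin m → Lp ℝ 2 (μ.restrict (Metric.ball 0 1)) := fun k =>
    (hmem (f k) (hf k).continuous).toLp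
  let Φ : (Fin m → ℝ) →ₗ[ℝ] Lp ℝ 2 (μ.restrict (Metric.ball 0 1)) :=
    Fintype.linearCombination ℝ F
  have hcs : ∀ c : Fin m → ℝ, ContDiff ℝ 1 fun y => ∑ k, c k * f k y := fun c =>
    ContDiff.sum fun k _ => contDiff_const.mul (hf k)
  have hΦ : ∀ c, Φ c = (hmem _ (hcs c).continuous).toLp := by
    intro c
    rw [Fintype.linearCombination_apply]
    refine Lp.ext ?_
    refine (Lp.coeFn_finsetSum _ _).trans ?_
    refine EventuallyEq.trans ?_ (MemLp.coeFn_toLp _).symm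
    have h1 : ∀ᵐ y ∂(μ.restrict (Metric.ball 0 1)), ∀ k,
        (c k • F k : Lp ℝ 2 (μ.restrict (Metric.ball 0 1))) y = c k * f k y := by
      rw [ae_all_iff]
      intro k
      filter_upwards [Lp.coeFn_smul (c k) (F k),
        (hmem (f k) (hf k).continuous).coeFn_toLp] with y h2 h3
      rw [h2, Pi.smul_apply, smul_eq_mul]
      congr 1
    filter_upwards [h1] with y hy
    simp [hy]
  have hnorm : ∀ c, ‖Φ c‖ = (eLpNorm (fun y => ∑ k, c k * f k y) 2
      (μ.restrict (Metric.ball 0 1))).toReal := fun c => by rw [hΦ, Lp.norm_toLp]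
  have hker : LinearMap.ker Φ = ⊥ := by
    refine LinearMap.ker_eq_bot'.2 fun c hc => hind c fun y hy => ?_
    rw [hΦ] at hc
    have h1 := MemLp.coeFn_toLp (hmem _ (hcs c).continuous)
    rw [hc] at h1
    -- A continuous function vanishing almost everywhere on an open set vanishes on it.
    have h := Measure.eqOn_open_of_ae_eq (h1.symm.trans (Lp.coeFn_zero _ _ _)) Metric.isOpen_ball (hcs c).continuous.continuousOn
      continuous_zero.continuousOn
    exact h hy
  obtain ⟨A, -, hA⟩ := Φ.exists_antilipschitzWith hker
  have hA' : ∀ c, ‖c‖ ≤ A * ‖Φ c‖ := fun c => by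
    have := hA.le_mul_dist c 0
    simpa using this
  have hb : ∀ k, ∃ D, ∀ y ∈ Metric.closedBall (0 : V) R, |f k y| ≤ D ∧ ‖fderiv ℝ (f k) y‖ ≤ D := by
    intro k
    obtain ⟨D1, h1⟩ := (isCompact_closedBall (0 : V) R).exists_bound_of_continuousOn
      (hf k).continuous.continuousOn
    obtain ⟨D2, h2⟩ := (isCompact_closedBall (0 : V) R).exists_bound_of_continuousOn
      ((hf k).continuous_fderiv one_ne_zero).continuousOn
    exact ⟨max D1 D2, fun y hy => ⟨(h1 y hy).trans (le_max_left _ _),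
      (h2 y hy).trans (le_max_right _ _)⟩⟩
  choose D hD using hb
  refine ⟨A * ∑ k, |D k|, by positivity, fun c y hy => ?_⟩
  have hck : ∀ k, |c k| ≤ A * ‖Φ c‖ := fun k => (norm_le_pi_norm c k).trans (hA' c)
  rw [← hnorm]
  have hfinal : ∑ k, A * ‖Φ c‖ * |D k| = A * (∑ k, |D k|) * ‖Φ c‖ := by
    rw [← Finset.mul_sum]; ring
  rw [← hfinal]
  constructor
  · refine (Finset.abs_sum_le_sum_abs _ _).trans (Finset.sum_le_sum fun k _ => ?_)
    rw [abs_mul]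
    exact mul_le_mul (hck k) ((hD k y hy).1.trans (le_abs_self _)) (abs_nonneg _) (by positivity)
  · have h : fderiv ℝ (fun y => ∑ k, c k * f k y) y = ∑ k, c k • fderiv ℝ (f k) y := by
      rw [fderiv_fun_sum fun k _ => ((hf k).differentiable one_ne_zero y).const_mul (c k)]
      refine Finset.sum_congr rfl fun k _ => ?_
      rw [fderiv_const_mul ((hf k).differentiable one_ne_zero y)]
    rw [h]
    refine norm_sum_le_of_le _ fun k _ => ?_
    rw [norm_smul]
    exact mul_le_mul (hck k) ((hD k y hy).2.trans (le_abs_self _)) (norm_nonneg _) (by positivity)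

theorem contDiff_eval {N : ℕ} (Q : MvPolynomial (Fin N) ℝ) {n : WithTop ℕ∞} :
    ContDiff ℝ n fun y : EuclideanSpace ℝ (Fin N) => MvPolynomial.eval y.ofLp Q := by
  simp only [MvPolynomial.eval_eq']
  refine ContDiff.sum fun s _ => contDiff_const.mul (contDiff_prod fun i _ => ContDiff.pow ?_ _)
  fun_prop

/-- The ball contains a box, that is, a product of infinite sets, on which only the zero polynomial
vanishes. -/
theorem eq_zero_of_eval_ball {N : ℕ} {Q : MvPolynomial (Fin N) ℝ}
    (h : ∀ y ∈ Metric.ball (0 : EuclideanSpace ℝ (Fin N)) 1, MvPolynomial.eval y.ofLp Q = 0) :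
    Q = 0 := by
  have hnhds : (WithLp.toLp 2 : (Fin N → ℝ) → EuclideanSpace ℝ (Fin N)) ⁻¹' Metric.ball 0 1 ∈
      𝓝 (0 : Fin N → ℝ) := by
    refine (PiLp.continuous_toLp 2 _).continuousAt.preimage_mem_nhds ?_
    exact Metric.ball_mem_nhds _ one_pos
  obtain ⟨δ, hδ, hsub⟩ := Metric.mem_nhds_iff.1 hnhds
  refine MvPolynomial.funext_set (fun _ => Set.Ioo 0 δ) (fun _ => Set.Ioo_infinite hδ) fun x hx => ?_
  rw [map_zero]
  refine h (WithLp.toLp 2 x) (hsub ?_)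
  rw [mem_ball_zero_iff, pi_norm_lt_iff hδ]
  intro i
  rw [Real.norm_of_nonneg (hx i trivial).1.le]
  exact (hx i trivial).2

/-- The radius R is free because the projection of K to the hyperplane of a face is larger than the
ball inscribed in the face, on which the L² norm is taken. -/
theorem exists_polynomial_inverse_estimate (N k : ℕ) (R : ℝ) :
    ∃ C : ℝ, 0 ≤ C ∧ ∀ Q : MvPolynomial (Fin N) ℝ, Q.totalDegree ≤ k →
      ∀ y ∈ Metric.closedBall (0 : EuclideanSpace ℝ (Fin N)) R,
      |MvPolynomial.eval y.ofLp Q| ≤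
        C * (eLpNorm (fun y : EuclideanSpace ℝ (Fin N) => MvPolynomial.eval y.ofLp Q) 2
        (volume.restrict (Metric.ball 0 1))).toReal ∧
      ‖fderiv ℝ (fun y : EuclideanSpace ℝ (Fin N) => MvPolynomial.eval y.ofLp Q) y‖ ≤
        C * (eLpNorm (fun y : EuclideanSpace ℝ (Fin N) => MvPolynomial.eval y.ofLp Q) 2
        (volume.restrict (Metric.ball 0 1))).toReal := by
  let b := Module.finBasis ℝ (MvPolynomial.restrictTotalDegree (Fin N) ℝ k)
  have hsum : ∀ (c : Fin _ → ℝ) (y : EuclideanSpace ℝ (Fin N)),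
      ∑ l, c l * MvPolynomial.eval y.ofLp (b l).1 =
        MvPolynomial.eval y.ofLp (∑ l, c l • b l : MvPolynomial.restrictTotalDegree (Fin N) ℝ k).1 :=
    fun c y => by simp [MvPolynomial.smul_eval]
  obtain ⟨C, hC, h⟩ := exists_inverse_estimate (V := EuclideanSpace ℝ (Fin N)) volume
    (f := fun l y => MvPolynomial.eval y.ofLp (b l).1) (fun l => contDiff_eval _) (by
      intro c hc
      simp only [hsum] at hc
      have h0 := eq_zero_of_eval_ball hc
      have h1 : ∑ l, c l • b l = 0 := Subtype.ext h0
      exact funext (Fintype.linearIndependent_iff.1 b.linearIndependent c h1)) R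
  refine ⟨C, hC, fun Q hQ y hy => ?_⟩
  let Q' : MvPolynomial.restrictTotalDegree (Fin N) ℝ k :=
    ⟨Q, (MvPolynomial.mem_restrictTotalDegree (Fin N) k Q).2 hQ⟩
  have h2 := h (b.repr Q') y hy
  simp only [hsum, b.sum_repr] at h2
  exact h2

theorem totalDegree_bind₁_le {σ τ : Type*} {f : σ → MvPolynomial τ ℝ}
    (hf : ∀ i, (f i).totalDegree ≤ 1) (q : MvPolynomial σ ℝ) :
    (MvPolynomial.bind₁ f q).totalDegree ≤ q.totalDegree := by
  rw [MvPolynomial.bind₁, MvPolynomial.aeval_def, MvPolynomial.eval₂_eq]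
  refine MvPolynomial.totalDegree_finsetSum_le fun s hs => ?_
  refine (MvPolynomial.totalDegree_mul _ _).trans ?_
  rw [MvPolynomial.algebraMap_eq, MvPolynomial.totalDegree_C, zero_add]
  refine (MvPolynomial.totalDegree_finsetProd _ _).trans ?_
  refine le_trans ?_ (MvPolynomial.le_totalDegree hs)
  refine Finset.sum_le_sum fun i _ => ?_
  refine (MvPolynomial.totalDegree_pow _ _).trans ?_
  exact (Nat.mul_le_mul_left _ (hf i)).trans (by simp)

theorem exists_polynomial_comp_affine {N M : ℕ}
    (L : EuclideanSpace ℝ (Fin N) →ₗ[ℝ] EuclideanSpace ℝ (Fin M)) (P : EuclideanSpace ℝ (Fin M))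
    (q : MvPolynomial (Fin M) ℝ) :
    ∃ Q : MvPolynomial (Fin N) ℝ, Q.totalDegree ≤ q.totalDegree ∧
      ∀ y : EuclideanSpace ℝ (Fin N),
        MvPolynomial.eval y.ofLp Q = MvPolynomial.eval (P + L y).ofLp q := by
  let f : Fin M → MvPolynomial (Fin N) ℝ := fun j => MvPolynomial.C (P j) +
    ∑ l, MvPolynomial.C (L (EuclideanSpace.single l 1) j) * MvPolynomial.X l
  refine ⟨MvPolynomial.bind₁ f q, totalDegree_bind₁_le (fun j => ?_) q, fun y => ?_⟩
  · refine (MvPolynomial.totalDegree_add _ _).trans (max_le ?_ ?_)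
    · rw [MvPolynomial.totalDegree_C]; exact Nat.zero_le _
    · refine MvPolynomial.totalDegree_finsetSum_le fun l _ => ?_
      refine (MvPolynomial.totalDegree_mul _ _).trans ?_
      rw [MvPolynomial.totalDegree_C, zero_add, MvPolynomial.totalDegree_X]
  · rw [MvPolynomial.eval, MvPolynomial.eval₂Hom_bind₁]
    change MvPolynomial.eval _ q = _
    congr 2
    funext j
    have hy : y = ∑ l, y l • EuclideanSpace.single l (1 : ℝ) := by
      ext i
      simp [Finset.sum_apply, Pi.single_apply]
    have hL : (L y) j = ∑ l, y l * L (EuclideanSpace.single l 1) j := by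
      conv_lhs => rw [hy]
      simp
    change MvPolynomial.eval y.ofLp (f j) = P j + (L y) j
    rw [hL]
    simp only [f, map_add, map_sum, map_mul, MvPolynomial.eval_C, MvPolynomial.eval_X]
    congr 1
    exact Finset.sum_congr rfl fun l _ => mul_comm _ _

theorem map_add_smul_volume {N : ℕ} (y0 : EuclideanSpace ℝ (Fin N)) {r : ℝ} (hr : 0 < r) :
    (volume : Measure (EuclideanSpace ℝ (Fin N))).map (fun z => y0 + r • z) =
      ENNReal.ofReal ((r ^ N)⁻¹) • volume := by
  have h1 := Measure.map_addHaar_smul (volume : Measure (EuclideanSpace ℝ (Fin N))) hr.ne'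
  have h2 : (fun z : EuclideanSpace ℝ (Fin N) => y0 + r • z) = (y0 + ·) ∘ (r • ·) := rfl
  rw [h2, ← Measure.map_map (by fun_prop) (by fun_prop), h1, Measure.map_smul,
    (measurePreserving_add_left volume y0).map_eq, finrank_euclideanSpace_fin,
    abs_of_pos (by positivity)]

theorem measurableEmbedding_add_smul {N : ℕ} (y0 : EuclideanSpace ℝ (Fin N)) {r : ℝ}
    (hr : 0 < r) : MeasurableEmbedding fun z : EuclideanSpace ℝ (Fin N) => y0 + r • z :=
  (measurableEmbedding_addLeft y0).comp (Homeomorph.smulOfNeZero r hr.ne').measurableEmbedding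

theorem eLpNorm_comp_add_smul_ball {N : ℕ} (y0 : EuclideanSpace ℝ (Fin N)) {r : ℝ} (hr : 0 < r)
    (F : EuclideanSpace ℝ (Fin N) → ℝ) :
    eLpNorm (fun z => F (y0 + r • z)) 2 (volume.restrict (Metric.ball 0 1)) =
      ENNReal.ofReal (r ^ (-(N : ℝ) / 2)) * eLpNorm F 2 (volume.restrict (Metric.ball y0 r)) := by
  have hem := measurableEmbedding_add_smul y0 hr
  have hpre : Metric.ball (0 : EuclideanSpace ℝ (Fin N)) 1 =
      (fun z => y0 + r • z) ⁻¹' Metric.ball y0 r := by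
    ext z
    simp [norm_smul, abs_of_pos hr, hr]
  have h := hem.eLpNorm_map_measure (g := F) (p := 2)
    (μ := volume.restrict (Metric.ball (0 : EuclideanSpace ℝ (Fin N)) 1))
  rw [hpre, ← hem.restrict_map, map_add_smul_volume y0 hr, Measure.restrict_smul,
    eLpNorm_smul_measure_of_ne_top ENNReal.ofNat_ne_top] at h
  rw [hpre]
  refine h.symm.trans ?_
  rw [smul_eq_mul, ENNReal.ofReal_rpow_of_nonneg (by positivity) (by positivity)]
  congr 2
  rw [← Real.rpow_natCast, ← Real.rpow_neg hr.le, ← Real.rpow_mul hr.le]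
  congr 1
  simp
  ring

end InverseEstimate

/-! ### Extension of polynomial fields from a face -/

section Extension

variable {N : ℕ} (K : Affine.Simplex ℝ (EuclideanSpace ℝ (Fin (N + 1))) (N + 1))

/-- The coordinates, in the chart `faceChart K i`, of the orthogonal projection to the hyperplane
spanned by the face opposite to `i`. -/
def faceProj (i : Fin (N + 1 + 1)) (x : EuclideanSpace ℝ (Fin (N + 1))) :
    EuclideanSpace ℝ (Fin N) :=
  (planeEmb (outwardNormal K i) (outwardNormal_ne_zero K i)).toContinuousLinearMap.adjoint
    (x - K.altitudeFoot i)

theorem faceProj_faceChart (i : Fin (N + 1 + 1)) (y : EuclideanSpace ℝ (Fin N)) :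
    faceProj K i (faceChart K i y) = y := by
  refine ext_inner_right ℝ fun z => ?_
  rw [faceProj, faceChart, add_sub_cancel_left, ContinuousLinearMap.adjoint_inner_left]
  exact (planeEmb _ _).inner_map_map y z

theorem norm_adjoint_planeEmb_le (n : EuclideanSpace ℝ (Fin (N + 1))) (hn : n ≠ 0) :
    ‖(planeEmb n hn).toContinuousLinearMap.adjoint‖ ≤ 1 := by
  rw [LinearIsometryEquiv.norm_map]
  exact LinearIsometry.norm_toContinuousLinearMap_le _

theorem dist_faceProj_le (i : Fin (N + 1 + 1)) (x : EuclideanSpace ℝ (Fin (N + 1)))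
    (y : EuclideanSpace ℝ (Fin N)) : dist (faceProj K i x) y ≤ dist x (faceChart K i y) := by
  conv_lhs => rw [← faceProj_faceChart K i y]
  rw [faceProj, faceProj, dist_eq_norm, ← map_sub, sub_sub_sub_cancel_right, dist_eq_norm]
  refine (ContinuousLinearMap.le_opNorm _ _).trans ?_
  exact mul_le_of_le_one_left (norm_nonneg _) (norm_adjoint_planeEmb_le _ _)

theorem hasFDerivAt_faceProj (i : Fin (N + 1 + 1)) (x : EuclideanSpace ℝ (Fin (N + 1))) :
    HasFDerivAt (faceProj K i)
      (planeEmb (outwardNormal K i) (outwardNormal_ne_zero K i)).toContinuousLinearMap.adjoint x := by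
  have h := ((planeEmb (outwardNormal K i)
    (outwardNormal_ne_zero K i)).toContinuousLinearMap.adjoint.hasFDerivAt
      (x := x - K.altitudeFoot i)).comp x ((hasFDerivAt_id x).sub_const (K.altitudeFoot i))
  exact h

theorem contDiff_faceProj (i : Fin (N + 1 + 1)) {n : WithTop ℕ∞} :
    ContDiff ℝ n (faceProj K i) := by
  unfold faceProj
  fun_prop

theorem continuous_polyField {d : ℕ} (q : Fin d → MvPolynomial (Fin d) ℝ) :
    Continuous (polyField q) := by
  unfold polyField
  exact (PiLp.continuous_toLp 2 _).comp
    (continuous_pi fun a => (contDiff_eval (q a) (n := 0)).continuous)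

theorem memLp_surf_of_continuous {V : Type*} [NormedAddCommGroup V]
    {f : EuclideanSpace ℝ (Fin (N + 1)) → V} (hf : Continuous f)
    (i : Fin (N + 1 + 1)) (p : ENNReal) : MemLp f p (surf K i) := by
  obtain ⟨A, hA⟩ := (K.faceOpposite i).isCompact_closedInterior.exists_bound_of_continuousOn
    hf.continuousOn
  refine MemLp.of_bound hf.aestronglyMeasurable A ?_
  filter_upwards [ae_restrict_mem (isClosed_face K i).measurableSet] with y hy
  exact hA y hy

/-- The centre is the barycentre of the face, where the N + 1 coordinates other than λ_i equal 1 /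
(N + 1). With slope at most B / h they stay nonnegative up to the distance h / ((N + 1) B). -/
theorem exists_faceChart_ball_subset {B : ℝ} (hB : 0 < B)
    (hK : ∀ j, ‖grad K j‖ ≤ B / diam K) (i : Fin (N + 1 + 1)) :
    ∃ y0, faceChart K i y0 ∈ K.closedInterior ∧
      Metric.ball y0 (diam K / ((N + 1) * B)) ⊆
        faceChart K i ⁻¹' (K.faceOpposite i).closedInterior := by
  let w : Fin (N + 1 + 1) → ℝ := fun j => if j = i then 0 else ((N : ℝ) + 1)⁻¹
  have hw : ∑ j, w j = 1 := by
    rw [← Finset.add_sum_erase _ _ (Finset.mem_univ i)]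
    have h : ∀ j ∈ Finset.univ.erase i, w j = ((N : ℝ) + 1)⁻¹ := fun j hj =>
      if_neg (Finset.ne_of_mem_erase hj)
    rw [Finset.sum_congr rfl h, Finset.sum_const, Finset.card_erase_of_mem (Finset.mem_univ i)]
    simp [w]
    field_simp
  have hbary := bary_linear_combination K hw
  obtain ⟨y0, hy0⟩ := exists_faceChart_add K i (∑ j, w j • K.points j)
  have hwi : w i = 0 := if_pos rfl
  have hw0 : ∀ j, 0 ≤ w j := fun j => by
    simp only [w]; split_ifs <;> positivity
  rw [hbary, hwi, zero_div, zero_smul, sub_zero] at hy0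
  have hD := diam_pos K
  refine ⟨y0, ?_, fun y hy => ?_⟩
  · rw [← hy0, mem_closedInterior_iff]
    intro j
    rw [hbary]
    exact hw0 j
  · refine (mem_face_iff K i).2 ⟨bary_faceChart_self K i y, fun j => ?_⟩
    rcases eq_or_ne j i with rfl | hj
    · exact (bary_faceChart_self K j y).ge
    have h1 := bary_sub K j (faceChart K i y0) (faceChart K i y)
    rw [← hy0, hbary, hy0] at h1
    have hwj : w j = ((N : ℝ) + 1)⁻¹ := if_neg hj
    have h2 : inner ℝ (grad K j) (faceChart K i y0 - faceChart K i y) ≤ ((N : ℝ) + 1)⁻¹ := by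
      refine (real_inner_le_norm _ _).trans ?_
      rw [← dist_eq_norm, (isometry_faceChart K i).dist_eq, dist_comm]
      calc ‖grad K j‖ * dist y y0 ≤ B / diam K * (diam K / ((N + 1) * B)) := by
            gcongr
            · exact hK j
            · exact (Metric.mem_ball.1 hy).le
        _ = ((N : ℝ) + 1)⁻¹ := by field_simp
    linarith

end Extension

/-- A polynomial field on the face opposite to `i` extends to `K` with bounds that scale
with the diameter. -/
theorem exists_face_extension (N k : ℕ) {B : ℝ} (hB : 0 < B) :
    ∃ C : ℝ, 0 ≤ C ∧ ∀ K : Affine.Simplex ℝ (EuclideanSpace ℝ (Fin (N + 1))) (N + 1),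
      (∀ j, ‖grad K j‖ ≤ B / diam K) → ∀ (i : Fin (N + 1 + 1))
      (q : Fin (N + 1) → MvPolynomial (Fin (N + 1)) ℝ), (∀ a, (q a).totalDegree ≤ k) →
      ∃ w : Fin (N + 1) → EuclideanSpace ℝ (Fin (N + 1)) → ℝ, (∀ a, ContDiff ℝ 1 (w a)) ∧
        (∀ x, bary K i x = 0 → ∀ a, w a x = polyField q x a) ∧
        ∀ x ∈ K.closedInterior, ∀ a,
          |w a x| ≤ C * diam K ^ (-(N : ℝ) / 2) * (eLpNorm (polyField q) 2 (surf K i)).toReal ∧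
          ‖fderiv ℝ (w a) x‖ ≤ C * diam K ^ (-(N : ℝ) / 2) * (diam K)⁻¹ *
            (eLpNorm (polyField q) 2 (surf K i)).toReal := by
  have hR : 0 < ((N : ℝ) + 1) * B := by positivity
  obtain ⟨C0, hC0, hC⟩ := exists_polynomial_inverse_estimate N k ((N + 1) * B)
  set R := ((N : ℝ) + 1) * B with hRdef
  -- With r = h / R, the factor R^(N/2) comes from rescaling the L² norm; 1 + R covers both the
  -- bound of the values (factor 1) and that of the gradients, where r⁻¹ = R / h.
  refine ⟨C0 * R ^ ((N : ℝ) / 2) * (1 + R), by positivity, fun K hK i q hq => ?_⟩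
  have hD := diam_pos K
  set r := diam K / R with hr
  have hr0 : 0 < r := by positivity
  obtain ⟨y0, hy0, hball⟩ := exists_faceChart_ball_subset K hB hK i
  rw [← hRdef, ← hr] at hball
  set ι := planeEmb (outwardNormal K i) (outwardNormal_ne_zero K i) with hι
  have hchart : ∀ z, faceChart K i y0 + (r • ι.toLinearMap) z = faceChart K i (y0 + r • z) := by
    intro z
    simp only [faceChart, map_add, map_smul, LinearMap.smul_apply, ← hι]
    rw [add_assoc]
    rfl
  have hQ := fun a => exists_polynomial_comp_affine (r • ι.toLinearMap) (faceChart K i y0) (q a)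
  simp only [hchart] at hQ
  choose Q hQdeg hQ using hQ
  have hbound : ∀ a, (eLpNorm (fun y : EuclideanSpace ℝ (Fin N) => MvPolynomial.eval y.ofLp (Q a)) 2
        (volume.restrict (Metric.ball 0 1))).toReal ≤
      R ^ ((N : ℝ) / 2) * diam K ^ (-(N : ℝ) / 2) *
        (eLpNorm (polyField q) 2 (surf K i)).toReal := by
    intro a
    simp only [hQ]
    rw [eLpNorm_comp_add_smul_ball y0 hr0 fun y => MvPolynomial.eval (faceChart K i y).ofLp (q a),
      ENNReal.toReal_mul, ENNReal.toReal_ofReal (by positivity)]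
    have e1 : r ^ (-(N : ℝ) / 2) = R ^ ((N : ℝ) / 2) * diam K ^ (-(N : ℝ) / 2) := by
      rw [hr, Real.div_rpow hD.le hR.le, neg_div, Real.rpow_neg hR.le]
      field_simp
    rw [e1]
    refine mul_le_mul_of_nonneg_left ?_ (by positivity)
    refine ENNReal.toReal_mono (memLp_surf_of_continuous K (continuous_polyField q) i 2).2.ne ?_
    rw [surf_eq_map, (isClosedEmbedding_faceChart K i).measurableEmbedding.eLpNorm_map_measure]
    refine (eLpNorm_mono_measure _ (Measure.restrict_mono hball le_rfl)).trans ?_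
    refine eLpNorm_mono fun y => ?_
    exact PiLp.norm_apply_le (polyField q (faceChart K i y)) a
  -- The extension is constant along the normal: project to the hyperplane, rescale the inscribed
  -- ball to the unit ball, evaluate the polynomial there.
  refine ⟨fun a x => MvPolynomial.eval (r⁻¹ • (faceProj K i x - y0)).ofLp (Q a), fun a => ?_,
    fun x hx a => ?_, fun x hx a => ?_⟩
  · have h := contDiff_faceProj K i (n := 1)
    have hg : ContDiff ℝ 1 fun x => r⁻¹ • (faceProj K i x - y0) := by fun_prop
    exact (contDiff_eval (Q a)).comp hg
  · obtain ⟨y, hy⟩ := exists_faceChart_add K i x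
    rw [hx, zero_div, zero_smul, sub_zero] at hy
    beta_reduce
    rw [hQ, hy, faceProj_faceChart, smul_smul, mul_inv_cancel₀ hr0.ne', one_smul, add_sub_cancel]
    rfl
  -- The projection is nonexpansive and the centre lies in K, so K projects into the ball of radius
  -- h = r R.
  · have hz : r⁻¹ • (faceProj K i x - y0) ∈ Metric.closedBall (0 : EuclideanSpace ℝ (Fin N)) R := by
      rw [mem_closedBall_zero_iff, norm_smul, norm_inv, Real.norm_of_nonneg hr0.le, ← dist_eq_norm]
      calc r⁻¹ * dist (faceProj K i x) y0 ≤ r⁻¹ * diam K := by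
            gcongr
            exact (dist_faceProj_le K i x y0).trans (dist_le_diam K hx hy0)
        _ = R := by rw [hr]; field_simp
    obtain ⟨h1, h2⟩ := hC (Q a) ((hQdeg a).trans (hq a)) _ hz
    have hb := hbound a
    set S := (eLpNorm (polyField q) 2 (surf K i)).toReal
    have hS : 0 ≤ S := ENNReal.toReal_nonneg
    constructor
    · calc _ ≤ C0 * (R ^ ((N : ℝ) / 2) * diam K ^ (-(N : ℝ) / 2) * S) :=
            h1.trans (mul_le_mul_of_nonneg_left hb hC0)
        _ = C0 * R ^ ((N : ℝ) / 2) * 1 * diam K ^ (-(N : ℝ) / 2) * S := by ring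
        _ ≤ _ := by gcongr; linarith
    · have hd := ((contDiff_eval (Q a) (n := 1)).differentiable one_ne_zero
        (r⁻¹ • (faceProj K i x - y0))).hasFDerivAt.comp x
        (((hasFDerivAt_faceProj K i x).sub_const y0).const_smul r⁻¹)
      have hd' : fderiv ℝ (fun x => MvPolynomial.eval (r⁻¹ • (faceProj K i x - y0)).ofLp (Q a)) x =
        _ := hd.fderiv
      beta_reduce
      rw [hd']
      refine (ContinuousLinearMap.opNorm_comp_le _ _).trans ?_
      rw [norm_smul, norm_inv, Real.norm_of_nonneg hr0.le]
      calc _ ≤ C0 * (R ^ ((N : ℝ) / 2) * diam K ^ (-(N : ℝ) / 2) * S) * (r⁻¹ * 1) := by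
            gcongr
            · exact h2.trans (mul_le_mul_of_nonneg_left hb hC0)
            · exact norm_adjoint_planeEmb_le _ _
        _ = C0 * R ^ ((N : ℝ) / 2) * R * diam K ^ (-(N : ℝ) / 2) * (diam K)⁻¹ * S := by
            rw [hr]; field_simp
        _ ≤ _ := by gcongr; linarith

/-! ### Integral estimates on K with explicit powers of the diameter -/

section FluxBound

variable {N : ℕ} (K : Affine.Simplex ℝ (EuclideanSpace ℝ (Fin (N + 1))) (N + 1))

theorem integrable_vol_of_continuous {f : EuclideanSpace ℝ (Fin (N + 1)) → ℝ} (hf : Continuous f) :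
    Integrable f (vol K) :=
  hf.continuousOn.integrableOn_compact K.isCompact_closedInterior

theorem integrable_surf_of_continuous {f : EuclideanSpace ℝ (Fin (N + 1)) → ℝ} (hf : Continuous f)
    (i : Fin (N + 1 + 1)) : Integrable f (surf K i) :=
  memLp_one_iff_integrable.1 (memLp_surf_of_continuous K hf i 1)

/-- The divergence theorem on `K` for functions vanishing on the faces other than the face
opposite to `i`, without assumption on the support. -/
theorem integral_vol_fderiv_of_contDiff (i : Fin (N + 1 + 1))
    {f : EuclideanSpace ℝ (Fin (N + 1)) → ℝ} (hf : ContDiff ℝ 1 f)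
    (h0 : ∀ x, 0 ≤ bary K i x → x ∉ K.closedInterior → f x = 0)
    (u : EuclideanSpace ℝ (Fin (N + 1))) :
    ∫ x, fderiv ℝ f x u ∂(vol K) = inner ℝ (outwardNormal K i) u * ∫ x, f x ∂(surf K i) := by
  obtain ⟨R, hR0, hR⟩ := (isBounded_closedInterior K).subset_ball_lt 0 0
  -- A bump equal to 1 near K provides compact support and changes neither of the two integrals.
  let χ : ContDiffBump (0 : EuclideanSpace ℝ (Fin (N + 1))) := ⟨R, R + 1, hR0, by linarith⟩
  have hχ1 : ∀ x ∈ K.closedInterior, χ =ᶠ[𝓝 x] 1 := fun x hx => by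
    filter_upwards [Metric.isOpen_ball.mem_nhds (hR hx)] with y hy
    exact χ.one_of_mem_closedBall (Metric.ball_subset_closedBall hy)
  have h := integral_vol_fderiv K i (f := fun x => f x * χ x) (hf.mul χ.contDiff)
    χ.hasCompactSupport.mul_left (fun x h1 h2 => by rw [h0 x h1 h2, zero_mul]) u
  have e1 : ∫ x, fderiv ℝ (fun x => f x * χ x) x u ∂(vol K) = ∫ x, fderiv ℝ f x u ∂(vol K) := by
    refine setIntegral_congr_fun K.isClosed_closedInterior.measurableSet fun x hx => ?_
    have : (fun x => f x * χ x) =ᶠ[𝓝 x] f := by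
      filter_upwards [hχ1 x hx] with y hy
      rw [hy, Pi.one_apply, mul_one]
    beta_reduce
    rw [this.fderiv_eq]
  have e2 : ∫ x, f x * χ x ∂(surf K i) = ∫ x, f x ∂(surf K i) := by
    refine setIntegral_congr_fun (isClosed_face K i).measurableSet fun x hx => ?_
    have hxK : x ∈ K.closedInterior := (mem_closedInterior_iff K).2 ((mem_face_iff K i).1 hx).2
    beta_reduce
    rw [(hχ1 x hxK).self_of_nhds, Pi.one_apply, mul_one]
  rwa [e1, e2] at h

/-- Hölder's inequality with the singular weight in L^q. The q-th root of the volume factor h^(N+1)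
gives the power of the diameter. -/
theorem exists_lintegral_inv_bary_mul_le (hN : 1 ≤ N) {p q : ℝ} (hpq : q.HolderConjugate p)
    (hq : q < 2) :
    ∃ M : ℝ, 0 ≤ M ∧ ∀ K : Affine.Simplex ℝ (EuclideanSpace ℝ (Fin (N + 1))) (N + 1),
      ∀ i j, i ≠ j → ∀ g : EuclideanSpace ℝ (Fin (N + 1)) → ℝ, Continuous g →
        ∫⁻ x, ENNReal.ofReal ((bary K i x + bary K j x)⁻¹) * ‖g x‖ₑ ∂(vol K) ≤
          ENNReal.ofReal (M * diam K ^ (((N : ℝ) + 1) / q)) *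
            eLpNorm g (ENNReal.ofReal p) (vol K) := by
  have hq0 : 0 < q := hpq.pos
  have hp0 : 0 < p := hpq.symm.pos
  -- The constants depend on the pair of faces; their sum over the finitely many pairs serves all of
  -- them.
  have hM : ∀ ij : Fin (N + 1 + 1) × Fin (N + 1 + 1), ∃ M : ENNReal, M ≠ ⊤ ∧ (ij.1 ≠ ij.2 →
      ∀ K : Affine.Simplex ℝ (EuclideanSpace ℝ (Fin (N + 1))) (N + 1),
      ∫⁻ x, ENNReal.ofReal ((bary K ij.1 x + bary K ij.2 x)⁻¹ ^ q) ∂(vol K) ≤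
        ENNReal.ofReal (diam K ^ (N + 1)) * M) := fun ij => by
    by_cases h : ij.1 = ij.2
    · exact ⟨0, by simp, fun h' => absurd h h'⟩
    · obtain ⟨M, h1, h2⟩ := exists_lintegral_inv_bary_le hN hq0.le hq h
      exact ⟨M, h1, fun _ => h2⟩
  choose M hMt hM using hM
  have hMsum : ∑ ij, M ij ≠ ⊤ := ENNReal.sum_ne_top.2 fun ij _ => hMt ij
  refine ⟨(∑ ij, M ij).toReal ^ (1 / q), by positivity, fun K i j hij g hg => ?_⟩
  have hD := diam_pos K
  have h := ENNReal.lintegral_mul_le_Lp_mul_Lq (vol K) hpq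
    (f := fun x => ENNReal.ofReal ((bary K i x + bary K j x)⁻¹)) (g := fun x => ‖g x‖ₑ)
    (by
      have h1 := continuous_bary K i
      have h2 := continuous_bary K j
      exact (((h1.add h2).measurable.inv).ennreal_ofReal).aemeasurable)
    hg.enorm.measurable.aemeasurable
  refine h.trans ?_
  have e2 : eLpNorm g (ENNReal.ofReal p) (vol K) = (∫⁻ x, ‖g x‖ₑ ^ p ∂(vol K)) ^ (1 / p) := by
    rw [eLpNorm_eq_lintegral_rpow_enorm_toReal (by simpa using hp0) ENNReal.ofReal_ne_top,
      ENNReal.toReal_ofReal hp0.le]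
  rw [e2]
  refine mul_le_mul_left ?_ _
  have e3 : ∫⁻ x, ENNReal.ofReal ((bary K i x + bary K j x)⁻¹) ^ q ∂(vol K) ≤
      ENNReal.ofReal (diam K ^ (N + 1) * (∑ ij, M ij).toReal) := by
    calc _ = ∫⁻ x, ENNReal.ofReal ((bary K i x + bary K j x)⁻¹ ^ q) ∂(vol K) := by
          refine lintegral_congr_ae ?_
          filter_upwards [ae_vol_bary_pos K i, ae_vol_bary_pos K j] with x hi hj
          rw [ENNReal.ofReal_rpow_of_nonneg (by positivity) hq0.le]
      _ ≤ ENNReal.ofReal (diam K ^ (N + 1)) * M (i, j) := hM (i, j) hij K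
      _ ≤ ENNReal.ofReal (diam K ^ (N + 1)) * ∑ ij, M ij := by
          refine mul_le_mul_right ?_ _
          exact Finset.single_le_sum (f := M) (fun _ _ => zero_le) (Finset.mem_univ (i, j))
      _ = _ := by
          rw [ENNReal.ofReal_mul (by positivity), ENNReal.ofReal_toReal hMsum]
  refine (ENNReal.rpow_le_rpow e3 (by positivity)).trans (le_of_eq ?_)
  rw [ENNReal.ofReal_rpow_of_nonneg (by positivity) (by positivity),
    Real.mul_rpow (by positivity) (by positivity), mul_comm, ← Real.rpow_natCast,
    ← Real.rpow_mul hD.le]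
  congr 3
  push_cast
  ring

/-- Cauchy–Schwarz, with the volume of K bounded by that of a ball of radius h. -/
theorem lintegral_vol_enorm_le {V : Type*} [NormedAddCommGroup V]
    {g : EuclideanSpace ℝ (Fin (N + 1)) → V} (hg : AEStronglyMeasurable g (vol K)) :
    ∫⁻ x, ‖g x‖ₑ ∂(vol K) ≤
      ENNReal.ofReal ((volume (Metric.ball (0 : EuclideanSpace ℝ (Fin (N + 1))) 1)).toReal ^
        (1 / 2 : ℝ) * diam K ^ (((N : ℝ) + 1) / 2)) * eLpNorm g 2 (vol K) := by
  have hD := diam_pos K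
  rw [← eLpNorm_one_eq_lintegral_enorm]
  refine (eLpNorm_le_eLpNorm_mul_rpow_measure_univ (p := 1) (q := 2) (by norm_num) hg).trans ?_
  rw [mul_comm]
  refine mul_le_mul_left ?_ _
  rw [vol, Measure.restrict_apply_univ]
  refine (ENNReal.rpow_le_rpow (volume_closedInterior_le K) (by norm_num)).trans (le_of_eq ?_)
  have hb : volume (Metric.ball (0 : EuclideanSpace ℝ (Fin (N + 1))) 1) ≠ ⊤ :=
    measure_ball_lt_top.ne
  conv_lhs => rw [← ENNReal.ofReal_toReal hb]
  rw [← ENNReal.ofReal_mul (by positivity),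
    ENNReal.ofReal_rpow_of_nonneg (by positivity) (by norm_num),
    Real.mul_rpow (by positivity) (by positivity), mul_comm, ← Real.rpow_natCast,
    ← Real.rpow_mul hD.le]
  congr 3
  · norm_num
  · push_cast
    norm_num
    ring

end FluxBound

/-! ### The trace estimate for smooth fields -/

section SmoothBound

variable {N : ℕ} (K : Affine.Simplex ℝ (EuclideanSpace ℝ (Fin (N + 1))) (N + 1))
  {σ : EuclideanSpace ℝ (Fin (N + 1)) → Matrix (Fin (N + 1)) (Fin (N + 1)) ℝ}
  {w : Fin (N + 1) → EuclideanSpace ℝ (Fin (N + 1)) → ℝ}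

theorem continuous_entries {d : ℕ} {σ : EuclideanSpace ℝ (Fin d) → Matrix (Fin d) (Fin d) ℝ}
    (hσ : ∀ a b, Continuous fun x => σ x a b) :
    Continuous fun x => entries (σ x) :=
  (PiLp.continuous_toLp 2 _).comp (continuous_pi fun ab => hσ ab.1 ab.2)

theorem continuous_pderiv {d : ℕ} {f : EuclideanSpace ℝ (Fin d) → ℝ} (hf : ContDiff ℝ 1 f)
    (b : Fin d) : Continuous (pderiv b f) :=
  (hf.continuous_fderiv one_ne_zero).clm_apply continuous_const

theorem continuous_classicalDiv {d : ℕ}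
    {σ : EuclideanSpace ℝ (Fin d) → Matrix (Fin d) (Fin d) ℝ}
    (hσ : ∀ a b, ContDiff ℝ 1 fun x => σ x a b) : Continuous (classicalDiv σ) :=
  (PiLp.continuous_toLp 2 _).comp (continuous_pi fun a =>
    continuous_finsetSum _ fun b _ => continuous_pderiv (hσ a b) b)

theorem memLp_vol_of_continuous {V : Type*} [NormedAddCommGroup V]
    {f : EuclideanSpace ℝ (Fin (N + 1)) → V} (hf : Continuous f) (p : ENNReal) :
    MemLp f p (vol K) := by
  obtain ⟨A, hA⟩ := K.isCompact_closedInterior.exists_bound_of_continuousOn hf.continuousOn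
  have : IsFiniteMeasure (vol K) :=
    ⟨by rw [vol, Measure.restrict_apply_univ]; exact K.isCompact_closedInterior.measure_lt_top⟩
  refine MemLp.of_bound hf.aestronglyMeasurable A ?_
  filter_upwards [ae_restrict_mem K.isClosed_closedInterior.measurableSet] with y hy
  exact hA y hy

theorem inner_mulVec {d : ℕ} (v n : EuclideanSpace ℝ (Fin d)) (A : Matrix (Fin d) (Fin d) ℝ) :
    inner ℝ v (mulVec A n) = ∑ a, ∑ b, n b * (v a * A a b) := by
  rw [PiLp.inner_apply]
  refine Finset.sum_congr rfl fun a _ => ?_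
  simp only [mulVec, Matrix.mulVec, dotProduct, RCLike.inner_apply, conj_trivial]
  rw [Finset.sum_mul]
  exact Finset.sum_congr rfl fun b _ => by ring

/-- The divergence theorem is applied to each scalar φ w_a σ_ab in the direction e_b. Only values on
the face enter the boundary term, so there v may be replaced by its extension w. -/
theorem integral_cutoff_mul_inner_mulVec (i : Fin (N + 1 + 1)) {ε : ℝ} (hε : 0 < ε)
    (hσ : ∀ a b, ContDiff ℝ 1 fun x => σ x a b) (hw : ∀ a, ContDiff ℝ 1 (w a))
    {v : EuclideanSpace ℝ (Fin (N + 1)) → EuclideanSpace ℝ (Fin (N + 1))}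
    (hv : ∀ x, bary K i x = 0 → ∀ a, w a x = v x a) :
    ∫ x, cutoff K i ε x * inner ℝ (v x) (mulVec (σ x) (outwardNormal K i)) ∂(surf K i) =
      ∫ x, ∑ a, ∑ b, pderiv b (fun x => cutoff K i ε x * w a x * σ x a b) x ∂(vol K) := by
  have hF : ∀ a b, ContDiff ℝ 1 fun x => cutoff K i ε x * w a x * σ x a b := fun a b =>
    ((contDiff_cutoff K i hε).mul (hw a)).mul (hσ a b)
  have hdiv : ∀ a b, ∫ x, pderiv b (fun x => cutoff K i ε x * w a x * σ x a b) x ∂(vol K) =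
      outwardNormal K i b * ∫ x, cutoff K i ε x * w a x * σ x a b ∂(surf K i) := fun a b => by
    have h := integral_vol_fderiv_of_contDiff K i (hF a b) (fun x h1 h2 => by
      rw [cutoff_eq_zero K i ε h1 h2]; ring) (EuclideanSpace.single b 1)
    rw [EuclideanSpace.inner_single_right] at h
    simpa [pderiv] using h
  rw [integral_finsetSum _ fun a _ => integrable_finsetSum _ fun b _ =>
    integrable_vol_of_continuous K (continuous_pderiv (hF a b) b)]
  have h1 : ∀ a, ∫ x, ∑ b, pderiv b (fun x => cutoff K i ε x * w a x * σ x a b) x ∂(vol K) =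
      ∫ x, ∑ b, outwardNormal K i b * (cutoff K i ε x * w a x * σ x a b) ∂(surf K i) := fun a => by
    rw [integral_finsetSum _ fun b _ =>
      integrable_vol_of_continuous K (continuous_pderiv (hF a b) b),
      integral_finsetSum _ fun b _ =>
        (integrable_surf_of_continuous K (hF a b).continuous i).const_mul _]
    refine Finset.sum_congr rfl fun b _ => ?_
    rw [hdiv, integral_const_mul]
  rw [Finset.sum_congr rfl fun a _ => h1 a, ← integral_finsetSum _ fun a _ =>
    integrable_finsetSum _ fun b _ =>
      (integrable_surf_of_continuous K (hF a b).continuous i).const_mul _]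
  refine setIntegral_congr_fun (isClosed_face K i).measurableSet fun x hx => ?_
  have hx0 := ((mem_face_iff K i).1 hx).1
  beta_reduce
  rw [inner_mulVec, Finset.mul_sum]
  refine Finset.sum_congr rfl fun a _ => ?_
  rw [Finset.mul_sum]
  refine Finset.sum_congr rfl fun b _ => ?_
  rw [hv x hx0 a]
  ring

/-- Leibniz rule: either the derivative falls on φ w, giving the singular weight times |σ|, or on σ,
where summation over b reassembles the divergence. In 6B + 2, the term 6B comes from ∇φ and the 2
from ∇w; the factor (N + 1)² counts the entries. -/
theorem abs_pderiv_sum_le (i : Fin (N + 1 + 1)) {ε B W : ℝ} (hε : 0 < ε)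
    (hK : ∀ j, ‖grad K j‖ ≤ B / diam K)
    (hσ : ∀ a b, ContDiff ℝ 1 fun x => σ x a b) (hw : ∀ a, ContDiff ℝ 1 (w a))
    (hw0 : ∀ x ∈ K.closedInterior, ∀ a, |w a x| ≤ W)
    (hw1 : ∀ x ∈ K.closedInterior, ∀ a, ‖fderiv ℝ (w a) x‖ ≤ W * (diam K)⁻¹)
    {x : EuclideanSpace ℝ (Fin (N + 1))} (hx : x ∈ K.closedInterior) (hi : 0 < bary K i x) :
    |∑ a, ∑ b, pderiv b (fun x => cutoff K i ε x * w a x * σ x a b) x| ≤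
      ((N + 1) ^ 2 * (6 * B + 2) * (W * (diam K)⁻¹)) *
        ∑ j ∈ Finset.univ.erase i, (bary K i x + bary K j x)⁻¹ * ‖entries (σ x)‖ +
      (N + 1) * W * ‖classicalDiv σ x‖ := by
  have hD := diam_pos K
  have hxb := (mem_closedInterior_iff K).1 hx
  have hW : 0 ≤ W := (abs_nonneg _).trans (hw0 x hx 0)
  set P := ∑ j ∈ Finset.univ.erase i, (bary K i x + bary K j x)⁻¹ with hP
  -- Since λ_i + λ_j ≤ 2, the weight is bounded below by 1/2. This lets the nonsingular term φ ∇w be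
  -- absorbed into the singular one.
  have hP2 : 1 ≤ 2 * P := by
    obtain ⟨j, hj⟩ : (Finset.univ.erase i).Nonempty := by
      rw [← Finset.card_pos, Finset.card_erase_of_mem (Finset.mem_univ i)]
      simp
    have h1 : (bary K i x + bary K j x)⁻¹ ≤ P :=
      Finset.single_le_sum (f := fun j => (bary K i x + bary K j x)⁻¹)
        (fun j _ => inv_nonneg.2 (add_nonneg hi.le (hxb j))) hj
    have h2 : (2 : ℝ)⁻¹ ≤ (bary K i x + bary K j x)⁻¹ := by
      refine inv_anti₀ (add_pos_of_pos_of_nonneg hi (hxb j)) ?_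
      linarith [bary_le_one K hx i, bary_le_one K hx j]
    linarith
  have hφ := norm_fderiv_cutoff_le K i hε hK hi hxb
  rw [← Finset.mul_sum, ← hP] at hφ
  have hφ0 := cutoff_nonneg K i ε x
  have hφ1 := cutoff_le_one K i hε hxb
  have hB : 0 ≤ B := by
    have := (norm_nonneg _).trans (hK i)
    by_contra! h
    exact absurd this (not_le.2 (div_neg_of_neg_of_pos h hD))
  have hcs := (contDiff_cutoff K i hε)
  have hder : ∀ a b, pderiv b (fun x => cutoff K i ε x * w a x * σ x a b) x =
      fderiv ℝ (fun x => cutoff K i ε x * w a x) x (EuclideanSpace.single b 1) * σ x a b +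
        cutoff K i ε x * w a x * pderiv b (fun x => σ x a b) x := fun a b => by
    have h := (((hcs.mul (hw a)).differentiable one_ne_zero x).hasFDerivAt.mul
      ((hσ a b).differentiable one_ne_zero x).hasFDerivAt).fderiv
    have h' : fderiv ℝ (fun x => cutoff K i ε x * w a x * σ x a b) x = _ := h
    rw [pderiv, h', pderiv]
    simp only [add_apply, smul_apply, smul_eq_mul]
    ring
  have hprod : ∀ a, ‖fderiv ℝ (fun x => cutoff K i ε x * w a x) x‖ ≤
      (6 * B + 2) * (W * (diam K)⁻¹) * P := fun a => by
    have h := ((hcs.differentiable one_ne_zero x).hasFDerivAt.mul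
      ((hw a).differentiable one_ne_zero x).hasFDerivAt).fderiv
    have h' : fderiv ℝ (fun x => cutoff K i ε x * w a x) x = _ := h
    rw [h']
    refine (norm_add_le _ _).trans ?_
    rw [norm_smul, norm_smul, Real.norm_of_nonneg hφ0, Real.norm_eq_abs]
    calc cutoff K i ε x * ‖fderiv ℝ (w a) x‖ + |w a x| * ‖fderiv ℝ (cutoff K i ε) x‖
        ≤ 1 * (W * (diam K)⁻¹) + W * (6 * (B / diam K) * P) := by
          gcongr
          · exact hw1 x hx a
          · exact hw0 x hx a
      _ ≤ (2 * P) * (W * (diam K)⁻¹) + W * (6 * (B / diam K) * P) := by gcongr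
      _ = _ := by rw [div_eq_mul_inv]; ring
  have hent : ∀ a b, |σ x a b| ≤ ‖entries (σ x)‖ := fun a b =>
    PiLp.norm_apply_le (entries (σ x)) (a, b)
  have hdivle : ∀ a, |∑ b, pderiv b (fun x => σ x a b) x| ≤ ‖classicalDiv σ x‖ := fun a =>
    PiLp.norm_apply_le (classicalDiv σ x) a
  simp only [hder]
  have hrow : ∀ a, |∑ b, (fderiv ℝ (fun x => cutoff K i ε x * w a x) x
      (EuclideanSpace.single b 1) * σ x a b +
        cutoff K i ε x * w a x * pderiv b (fun x => σ x a b) x)| ≤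
      (N + 1) * ((6 * B + 2) * (W * (diam K)⁻¹) * P * ‖entries (σ x)‖) +
        W * ‖classicalDiv σ x‖ := fun a => by
    rw [Finset.sum_add_distrib, ← Finset.mul_sum]
    refine (abs_add_le _ _).trans (add_le_add ?_ ?_)
    · refine (Finset.abs_sum_le_sum_abs _ _).trans ?_
      have hle : ∀ b ∈ Finset.univ, |fderiv ℝ (fun x => cutoff K i ε x * w a x) x
          (EuclideanSpace.single b 1) * σ x a b| ≤
          (6 * B + 2) * (W * (diam K)⁻¹) * P * ‖entries (σ x)‖ := fun b _ => by
        rw [abs_mul]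
        refine mul_le_mul ?_ (hent a b) (abs_nonneg _) ((norm_nonneg _).trans (hprod a))
        rw [← Real.norm_eq_abs]
        refine (ContinuousLinearMap.le_opNorm _ _).trans ?_
        rw [PiLp.norm_single, norm_one, mul_one]
        exact hprod a
      refine (Finset.sum_le_sum hle).trans (le_of_eq ?_)
      simp
    · rw [abs_mul]
      refine mul_le_mul ?_ (hdivle a) (abs_nonneg _) hW
      rw [abs_mul, abs_of_nonneg hφ0]
      exact (mul_le_of_le_one_left (abs_nonneg _) hφ1).trans (hw0 x hx a)
  refine (Finset.abs_sum_le_sum_abs _ _).trans ((Finset.sum_le_sum fun a _ => hrow a).trans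
    (le_of_eq ?_))
  rw [← Finset.sum_mul, ← hP]
  simp
  ring

/-- The trace estimate for smooth fields. -/
theorem exists_abs_classicalFlux_le (N : ℕ) (hN : 1 ≤ N) {p : ℝ} (hp : 2 < p) (k : ℕ) {B : ℝ}
    (hB : 0 < B) :
    ∃ C : ℝ, 0 < C ∧ ∀ K : Affine.Simplex ℝ (EuclideanSpace ℝ (Fin (N + 1))) (N + 1),
      (∀ j, ‖grad K j‖ ≤ B / diam K) → ∀ (i : Fin (N + 1 + 1))
      (q : Fin (N + 1) → MvPolynomial (Fin (N + 1)) ℝ), (∀ a, (q a).totalDegree ≤ k) →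
      ∀ σ : EuclideanSpace ℝ (Fin (N + 1)) → Matrix (Fin (N + 1)) (Fin (N + 1)) ℝ,
        (∀ a b, ContDiff ℝ 1 fun x => σ x a b) →
      |classicalFlux K i σ (polyField q)| ≤ C * diam K ^ (-(1 / 2) : ℝ) *
        (eLpNorm (polyField q) 2 (surf K i)).toReal *
        (diam K * (eLpNorm (classicalDiv σ) 2 (vol K)).toReal +
          diam K ^ (((N : ℝ) + 1) * (p - 2) / (2 * p)) *
            (eLpNorm (fun x => entries (σ x)) (ENNReal.ofReal p) (vol K)).toReal) := by
  obtain ⟨C0, hC0, hext⟩ := exists_face_extension N k hB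
  have hpc := (Real.HolderConjugate.conjExponent (by linarith : 1 < p)).symm
  have hq2 : Real.conjExponent p < 2 := by
    rw [Real.conjExponent, div_lt_iff₀ (by linarith)]; linarith
  set p' := Real.conjExponent p with hp'
  obtain ⟨M, hM0, hM⟩ := exists_lintegral_inv_bary_mul_le hN hpc hq2
  set V := (volume (Metric.ball (0 : EuclideanSpace ℝ (Fin (N + 1))) 1)).toReal ^ (1 / 2 : ℝ)
    with hV
  have hV0 : 0 ≤ V := by positivity
  -- The third factor N + 1 counts the faces j ≠ i in the singular weight.
  set C1 := ((N : ℝ) + 1) ^ 3 * (6 * B + 2) * C0 * M with hC1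
  set C2 := ((N : ℝ) + 1) * C0 * V with hC2
  refine ⟨C1 + C2 + 1, by positivity, fun K hK i q hq σ hσ => ?_⟩
  have hD := diam_pos K
  obtain ⟨w, hw, hwv, hwb⟩ := hext K hK i q hq
  set S := (eLpNorm (polyField q) 2 (surf K i)).toReal with hS
  have hS0 : 0 ≤ S := ENNReal.toReal_nonneg
  set W := C0 * diam K ^ (-(N : ℝ) / 2) * S with hW
  have hW0 : 0 ≤ W := by positivity
  have hcd := continuous_classicalDiv hσ
  have hce := continuous_entries fun a b => (hσ a b).continuous
  set E2 := eLpNorm (classicalDiv σ) 2 (vol K) with hE2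
  set Ep := eLpNorm (fun x => entries (σ x)) (ENNReal.ofReal p) (vol K) with hEp
  have hE2t : E2 ≠ ⊤ := (memLp_vol_of_continuous K hcd 2).2.ne
  have hEpt : Ep ≠ ⊤ := (memLp_vol_of_continuous K hce _).2.ne
  set c1 := ((N : ℝ) + 1) ^ 2 * (6 * B + 2) * (W * (diam K)⁻¹) with hc1
  set c2 := ((N : ℝ) + 1) * W with hc2
  have hc10 : 0 ≤ c1 := by positivity
  have hc20 : 0 ≤ c2 := by positivity
  set T := c1 * (((N : ℝ) + 1) * (M * diam K ^ (((N : ℝ) + 1) / p'))) * Ep.toReal +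
    c2 * (V * diam K ^ (((N : ℝ) + 1) / 2)) * E2.toReal with hT
  have hstep : ∀ ε : ℝ, 0 < ε →
      |∫ x, cutoff K i ε x * inner ℝ (polyField q x) (mulVec (σ x) (outwardNormal K i))
        ∂(surf K i)| ≤ T := by
    intro ε hε
    rw [integral_cutoff_mul_inner_mulVec K i hε hσ hw hwv]
    have hle : ENNReal.ofReal |∫ x, ∑ a, ∑ b,
        pderiv b (fun x => cutoff K i ε x * w a x * σ x a b) x ∂(vol K)| ≤
        ENNReal.ofReal (c1 * (((N : ℝ) + 1) * (M * diam K ^ (((N : ℝ) + 1) / p')))) * Ep +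
          ENNReal.ofReal (c2 * (V * diam K ^ (((N : ℝ) + 1) / 2))) * E2 := by
      rw [← Real.enorm_eq_ofReal_abs]
      refine (enorm_integral_le_lintegral_enorm _).trans ?_
      calc _ ≤ ∫⁻ x, (ENNReal.ofReal c1 * ∑ j ∈ Finset.univ.erase i,
              ENNReal.ofReal ((bary K i x + bary K j x)⁻¹) * ‖‖entries (σ x)‖‖ₑ +
              ENNReal.ofReal c2 * ‖classicalDiv σ x‖ₑ) ∂(vol K) := by
            refine lintegral_mono_ae ?_
            filter_upwards [ae_vol_bary_pos K i,
              ae_restrict_mem K.isClosed_closedInterior.measurableSet] with x hi hx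
            have h := abs_pderiv_sum_le K i hε hK hσ hw (fun x hx a => (hwb x hx a).1)
              (fun x hx a => (hwb x hx a).2.trans (le_of_eq (by ring))) hx hi
            have hxb := (mem_closedInterior_iff K).1 hx
            have hs : ∀ j, 0 ≤ (bary K i x + bary K j x)⁻¹ := fun j =>
              inv_nonneg.2 (add_nonneg hi.le (hxb j))
            rw [Real.enorm_eq_ofReal_abs]
            refine (ENNReal.ofReal_le_ofReal h).trans (le_of_eq ?_)
            rw [ENNReal.ofReal_add (mul_nonneg hc10 (Finset.sum_nonneg fun j _ =>
                mul_nonneg (hs j) (norm_nonneg _))) (by positivity),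
              ENNReal.ofReal_mul hc10, ENNReal.ofReal_mul hc20,
              ENNReal.ofReal_sum_of_nonneg fun j _ => mul_nonneg (hs j) (norm_nonneg _),
              ofReal_norm]
            congr 2
            refine Finset.sum_congr rfl fun j _ => ?_
            rw [ENNReal.ofReal_mul (hs j), enorm_norm, ofReal_norm]
        _ = ENNReal.ofReal c1 * ∑ j ∈ Finset.univ.erase i, ∫⁻ x,
              ENNReal.ofReal ((bary K i x + bary K j x)⁻¹) * ‖‖entries (σ x)‖‖ₑ ∂(vol K) +
              ENNReal.ofReal c2 * ∫⁻ x, ‖classicalDiv σ x‖ₑ ∂(vol K) := by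
            rw [lintegral_add_right _ (hcd.enorm.measurable.const_mul _),
              lintegral_const_mul _ hcd.enorm.measurable, lintegral_const_mul' _ _
                ENNReal.ofReal_ne_top, lintegral_finsetSum]
            intro j _
            exact ((((continuous_bary K i).add (continuous_bary K j)).measurable.inv).ennreal_ofReal
              ).mul hce.norm.enorm.measurable
        _ ≤ ENNReal.ofReal c1 * ∑ j ∈ Finset.univ.erase i,
              ENNReal.ofReal (M * diam K ^ (((N : ℝ) + 1) / p')) * Ep +
              ENNReal.ofReal c2 * (ENNReal.ofReal (V * diam K ^ (((N : ℝ) + 1) / 2)) * E2) := by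
            refine add_le_add (mul_le_mul_right (Finset.sum_le_sum fun j hj => ?_) _)
              (mul_le_mul_right (lintegral_vol_enorm_le K hcd.aestronglyMeasurable) _)
            have h := hM K i j (Finset.ne_of_mem_erase hj).symm (fun x => ‖entries (σ x)‖) hce.norm
            rwa [eLpNorm_norm] at h
        _ = _ := by
            rw [Finset.sum_const, Finset.card_erase_of_mem (Finset.mem_univ i), Finset.card_univ,
              Fintype.card_fin, Nat.add_sub_cancel, nsmul_eq_mul, ENNReal.ofReal_mul hc10,
              ENNReal.ofReal_mul hc20, ENNReal.ofReal_mul (p := (N : ℝ) + 1)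
                (q := M * diam K ^ (((N : ℝ) + 1) / p')) (by positivity)]
            have : ENNReal.ofReal ((N : ℝ) + 1) = ((N + 1 : ℕ) : ENNReal) := by
              rw [← ENNReal.ofReal_natCast]; push_cast; rfl
            rw [this]
            ring
    have h2 := ENNReal.toReal_mono (ENNReal.add_ne_top.2
      ⟨ENNReal.mul_ne_top ENNReal.ofReal_ne_top hEpt,
        ENNReal.mul_ne_top ENNReal.ofReal_ne_top hE2t⟩) hle
    rw [ENNReal.toReal_ofReal (abs_nonneg _), ENNReal.toReal_add
      (ENNReal.mul_ne_top ENNReal.ofReal_ne_top hEpt)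
      (ENNReal.mul_ne_top ENNReal.ofReal_ne_top hE2t), ENNReal.toReal_mul, ENNReal.toReal_mul,
      ENNReal.toReal_ofReal (by positivity), ENNReal.toReal_ofReal (by positivity)] at h2
    exact h2
  have hHc : Continuous fun x => inner ℝ (polyField q x) (mulVec (σ x) (outwardNormal K i)) := by
    have h1 := continuous_polyField q
    have h2 := fun a b => (hσ a b).continuous
    simp only [inner_mulVec]
    exact continuous_finsetSum _ fun a _ => continuous_finsetSum _ fun b _ =>
      continuous_const.mul (((EuclideanSpace.proj (𝕜 := ℝ) a).continuous.comp h1).mul (h2 a b))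
  -- Dominated convergence on the face: there the cutoff lies between 0 and 1 and tends to 1 almost
  -- everywhere as ε → 0+.
  have hlim : Tendsto (fun ε => ∫ x, cutoff K i ε x *
      inner ℝ (polyField q x) (mulVec (σ x) (outwardNormal K i)) ∂(surf K i)) (𝓝[>] 0)
      (𝓝 (classicalFlux K i σ (polyField q))) := by
    refine tendsto_integral_filter_of_dominated_convergence
      (fun x => ‖inner ℝ (polyField q x) (mulVec (σ x) (outwardNormal K i))‖) ?_ ?_
      (integrable_surf_of_continuous K hHc i).norm ?_
    · filter_upwards [self_mem_nhdsWithin] with ε hε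
      exact ((contDiff_cutoff K i hε).continuous.mul hHc).aestronglyMeasurable
    · filter_upwards [self_mem_nhdsWithin] with ε hε
      filter_upwards [ae_restrict_mem (isClosed_face K i).measurableSet] with x hx
      rw [norm_mul, Real.norm_of_nonneg (cutoff_nonneg K i ε x)]
      exact mul_le_of_le_one_left (norm_nonneg _)
        (cutoff_le_one K i hε ((mem_face_iff K i).1 hx).2)
    · have h : ∀ᵐ x ∂(surf K i), ∀ j, j ≠ i → bary K j x ≠ 0 := by
        rw [ae_all_iff]
        intro j
        by_cases hj : j = i
        · exact Eventually.of_forall fun x h => absurd hj h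
        · filter_upwards [ae_surf_bary_ne_zero K hN hj] with x hx _
          exact hx
      filter_upwards [h, ae_restrict_mem (isClosed_face K i).measurableSet] with x hx hxf
      have hxf' := (mem_face_iff K i).1 hxf
      have h1 := (tendsto_cutoff K i hxf'.1 fun j hj =>
        lt_of_le_of_ne (hxf'.2 j) (hx j hj).symm).mono_left
          (nhdsWithin_le_nhds (s := Set.Ioi (0 : ℝ)))
      simpa using h1.mul_const (inner ℝ (polyField q x) (mulVec (σ x) (outwardNormal K i)))
  have hfin : |classicalFlux K i σ (polyField q)| ≤ T :=
    le_of_tendsto hlim.abs (by filter_upwards [self_mem_nhdsWithin] with ε hε using hstep ε hε)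
  refine hfin.trans ?_
  have hpp : (p' : ℝ)⁻¹ = 1 - p⁻¹ := by
    have := hpc.inv_add_inv_eq_one
    linarith
  -- With 1/p' = 1 - 1/p, the exponent -N/2 - 1 + (N+1)/p' equals -1/2 + (N+1)(1/2 - 1/p).
  have hpow1 : diam K ^ (-(N : ℝ) / 2) * (diam K)⁻¹ * diam K ^ (((N : ℝ) + 1) / p') =
      diam K ^ (-(1 / 2) : ℝ) * diam K ^ (((N : ℝ) + 1) * (p - 2) / (2 * p)) := by
    rw [← Real.rpow_neg_one, ← Real.rpow_add hD, ← Real.rpow_add hD, ← Real.rpow_add hD,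
      div_eq_mul_inv _ p', hpp]
    congr 1
    have : p ≠ 0 := by linarith
    field_simp
    ring
  have hpow2 : diam K ^ (-(N : ℝ) / 2) * diam K ^ (((N : ℝ) + 1) / 2) =
      diam K ^ (-(1 / 2) : ℝ) * diam K := by
    nth_rewrite 4 [← Real.rpow_one (diam K)]
    rw [← Real.rpow_add hD, ← Real.rpow_add hD]
    congr 1
    ring
  have hT' : T = diam K ^ (-(1 / 2) : ℝ) * S * (C2 * (diam K * E2.toReal) +
      C1 * (diam K ^ (((N : ℝ) + 1) * (p - 2) / (2 * p)) * Ep.toReal)) := by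
    calc T = C1 * S * (diam K ^ (-(N : ℝ) / 2) * (diam K)⁻¹ *
          diam K ^ (((N : ℝ) + 1) / p')) * Ep.toReal +
          C2 * S * (diam K ^ (-(N : ℝ) / 2) * diam K ^ (((N : ℝ) + 1) / 2)) * E2.toReal := by
          rw [hT, hc1, hc2, hW, hC1, hC2]; ring
      _ = _ := by rw [hpow1, hpow2]; ring
  rw [hT']
  have hE2r : 0 ≤ E2.toReal := ENNReal.toReal_nonneg
  have hEpr : 0 ≤ Ep.toReal := ENNReal.toReal_nonneg
  have hC10 : 0 ≤ C1 := by positivity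
  have hC20 : 0 ≤ C2 := by positivity
  calc _ ≤ diam K ^ (-(1 / 2) : ℝ) * S * ((C1 + C2 + 1) * (diam K * E2.toReal) +
      (C1 + C2 + 1) * (diam K ^ (((N : ℝ) + 1) * (p - 2) / (2 * p)) * Ep.toReal)) := by
        gcongr <;> linarith
    _ = _ := by ring

end SmoothBound

/-! ### Mollification after shrinking -/

section Mollify

open scoped Convolution
open ContinuousLinearMap (lsmul)

variable {d : ℕ}

/-- Mollification does not increase the `L^p` norm. -/
theorem eLpNorm_normed_convolution_le (ρ : ContDiffBump (0 : EuclideanSpace ℝ (Fin d)))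
    {p : ENNReal} (hp : 1 ≤ p) (hp' : p ≠ ⊤) {f : EuclideanSpace ℝ (Fin d) → ℝ}
    (hf : AEStronglyMeasurable f volume) :
    eLpNorm (ρ.normed volume ⋆[lsmul ℝ ℝ, volume] f) p volume ≤ eLpNorm f p volume := by
  have hp0 : p ≠ 0 := (zero_lt_one.trans_le hp).ne'
  rw [convolution_congr (lsmul ℝ ℝ) (EventuallyEq.refl _ _) hf.ae_eq_mk,
    eLpNorm_congr_ae hf.ae_eq_mk]
  have hg := hf.stronglyMeasurable_mk
  generalize hf.mk f = g at hg
  have hρm : Measurable fun y => ‖ρ.normed volume y‖ₑ :=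
    (ρ.continuous_normed (μ := volume)).measurable.enorm
  -- The convolution is an average against a probability measure. Monotonicity of L^p norms in the
  -- exponent plays the role of Jensen's inequality; Tonelli and translation invariance conclude.
  obtain ⟨ν, hν⟩ : ∃ ν : Measure (EuclideanSpace ℝ (Fin d)),
    ν = volume.withDensity fun y => ‖ρ.normed volume y‖ₑ := ⟨_, rfl⟩
  have hνp : IsProbabilityMeasure ν := by
    constructor
    rw [hν, withDensity_apply _ MeasurableSet.univ, Measure.restrict_univ,
      ← ofReal_integral_norm_eq_lintegral_enorm ρ.integrable_normed]
    simp only [Real.norm_of_nonneg (ρ.nonneg_normed _), ρ.integral_normed, ENNReal.ofReal_one]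
  have hpt : ∀ z, ‖(ρ.normed volume ⋆[lsmul ℝ ℝ, volume] g) z‖ₑ ^ p.toReal ≤
      ∫⁻ y, ‖g (z - y)‖ₑ ^ p.toReal ∂ν := by
    intro z
    have hgz : Measurable fun y => g (z - y) := hg.measurable.comp (measurable_const.sub measurable_id)
    have h1 : ‖(ρ.normed volume ⋆[lsmul ℝ ℝ, volume] g) z‖ₑ ≤
        eLpNorm (fun y => g (z - y)) 1 ν := by
      rw [eLpNorm_one_eq_lintegral_enorm, hν,
        lintegral_withDensity_eq_lintegral_mul _ hρm hgz.enorm]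
      refine (enorm_integral_le_lintegral_enorm _).trans (le_of_eq ?_)
      refine lintegral_congr fun y => ?_
      simp [enorm_mul]
    have h2 := h1.trans (eLpNorm_le_eLpNorm_of_exponent_le hp hgz.aestronglyMeasurable)
    rw [eLpNorm_eq_lintegral_rpow_enorm_toReal hp0 hp'] at h2
    have hpr : 0 < p.toReal := ENNReal.toReal_pos hp0 hp'
    calc _ ≤ ((∫⁻ y, ‖g (z - y)‖ₑ ^ p.toReal ∂ν) ^ (1 / p.toReal)) ^ p.toReal := by
          gcongr
      _ = _ := by
          rw [← ENNReal.rpow_mul, one_div, inv_mul_cancel₀ hpr.ne', ENNReal.rpow_one]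
  rw [eLpNorm_eq_lintegral_rpow_enorm_toReal hp0 hp', eLpNorm_eq_lintegral_rpow_enorm_toReal hp0 hp']
  gcongr ?_ ^ (1 / p.toReal)
  have hm : Measurable fun zy : EuclideanSpace ℝ (Fin d) × EuclideanSpace ℝ (Fin d) =>
      ‖g (zy.1 - zy.2)‖ₑ ^ p.toReal :=
    (hg.measurable.comp (measurable_fst.sub measurable_snd)).enorm.pow_const _
  calc _ ≤ ∫⁻ z, ∫⁻ y, ‖g (z - y)‖ₑ ^ p.toReal ∂ν := lintegral_mono hpt
    _ = ∫⁻ y, (∫⁻ z, ‖g (z - y)‖ₑ ^ p.toReal) ∂ν := lintegral_lintegral_swap hm.aemeasurable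
    _ = ∫⁻ _y, (∫⁻ z, ‖g z‖ₑ ^ p.toReal) ∂ν := by
        refine lintegral_congr fun y => ?_
        exact lintegral_sub_right_eq_self (fun z => ‖g z‖ₑ ^ p.toReal) y
    _ = _ := by simp

/-- The mollification of `f`, extended by zero from `S`, evaluated after a homothety of ratio
`1 - s` centred at `c`. -/
def shrinkMollify (S : Set (EuclideanSpace ℝ (Fin d))) (c : EuclideanSpace ℝ (Fin d)) (s : ℝ)
    (ρ : ContDiffBump (0 : EuclideanSpace ℝ (Fin d))) (f : EuclideanSpace ℝ (Fin d) → ℝ)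
    (x : EuclideanSpace ℝ (Fin d)) : ℝ :=
  (ρ.normed volume ⋆[lsmul ℝ ℝ, volume] S.indicator f) (s • c + (1 - s) • x)

variable {S : Set (EuclideanSpace ℝ (Fin d))} (c : EuclideanSpace ℝ (Fin d))
  (ρ : ContDiffBump (0 : EuclideanSpace ℝ (Fin d)))

/-- The homothety costs (1 - s)^(-d/p), at most 2^d since s ≤ 1/2 and p ≥ 1. The bound is uniform in
s and in the mollifier. -/
theorem eLpNorm_shrinkMollify_le (hS : MeasurableSet S) {s : ℝ} (hs : s ≤ 1 / 2)
    {p : ENNReal} (hp : 1 ≤ p) (hp' : p ≠ ⊤) {f : EuclideanSpace ℝ (Fin d) → ℝ}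
    (hf : AEStronglyMeasurable f (volume.restrict S)) :
    eLpNorm (shrinkMollify S c s ρ f) p (volume.restrict S) ≤
      2 ^ d * eLpNorm f p (volume.restrict S) := by
  have ht : 0 < 1 - s := by linarith
  have h1 := (measurableEmbedding_add_smul (s • c) ht).eLpNorm_map_measure (p := p)
    (μ := volume) (g := ρ.normed volume ⋆[lsmul ℝ ℝ, volume] S.indicator f)
  rw [map_add_smul_volume _ ht, eLpNorm_smul_measure_of_ne_top hp'] at h1
  have hfac : ENNReal.ofReal (((1 - s) ^ d)⁻¹) ^ (1 / p).toReal ≤ 2 ^ d := by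
    have h2 : ENNReal.ofReal (((1 - s) ^ d)⁻¹) ≤ 2 ^ d := by
      rw [← ENNReal.ofReal_ofNat, ← ENNReal.ofReal_pow (by norm_num)]
      refine ENNReal.ofReal_le_ofReal ?_
      rw [← inv_pow]
      refine pow_le_pow_left₀ (by positivity) ?_ d
      rw [inv_le_comm₀ ht (by norm_num)]
      linarith
    have h3 : (1 / p).toReal ≤ 1 := by
      rw [one_div, ENNReal.toReal_inv]
      refine inv_le_one_of_one_le₀ ?_
      simpa using ENNReal.toReal_mono hp' hp
    calc _ ≤ ((2 : ENNReal) ^ d) ^ (1 / p).toReal := by gcongr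
      _ ≤ ((2 : ENNReal) ^ d) ^ (1 : ℝ) :=
          ENNReal.rpow_le_rpow_of_exponent_le (one_le_pow₀ (by norm_num)) h3
      _ = _ := ENNReal.rpow_one _
  calc _ ≤ eLpNorm (shrinkMollify S c s ρ f) p volume :=
        eLpNorm_mono_measure _ Measure.restrict_le_self
    _ = ENNReal.ofReal (((1 - s) ^ d)⁻¹) ^ (1 / p).toReal *
        eLpNorm (ρ.normed volume ⋆[lsmul ℝ ℝ, volume] S.indicator f) p volume := h1.symm
    _ ≤ 2 ^ d * eLpNorm (S.indicator f) p volume := by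
        gcongr
        exact eLpNorm_normed_convolution_le ρ hp hp' ((aestronglyMeasurable_indicator_iff hS).2 hf)
    _ = _ := by rw [eLpNorm_indicator_eq_eLpNorm_restrict hS]

theorem locallyIntegrable_indicator (hS : MeasurableSet S) {p : ENNReal} (hp : 1 ≤ p)
    {f : EuclideanSpace ℝ (Fin d) → ℝ} (hf : MemLp f p (volume.restrict S)) :
    LocallyIntegrable (S.indicator f) volume :=
  ((memLp_indicator_iff_restrict hS).2 hf).locallyIntegrable hp

theorem contDiff_shrinkMollify (hS : MeasurableSet S) (s : ℝ) {p : ENNReal} (hp : 1 ≤ p)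
    {f : EuclideanSpace ℝ (Fin d) → ℝ} (hf : MemLp f p (volume.restrict S)) :
    ContDiff ℝ ∞ (shrinkMollify S c s ρ f) :=
  (ρ.hasCompactSupport_normed.contDiff_convolution_left (lsmul ℝ ℝ) (ρ.contDiff_normed (μ := volume))
    (locallyIntegrable_indicator hS hp hf)).comp
      (contDiff_const.add (contDiff_id.const_smul (1 - s)))

theorem shrinkMollify_add (hS : MeasurableSet S) (s : ℝ) {p : ENNReal} (hp : 1 ≤ p)
    {f g : EuclideanSpace ℝ (Fin d) → ℝ} (hf : MemLp f p (volume.restrict S))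
    (hg : MemLp g p (volume.restrict S)) :
    shrinkMollify S c s ρ (f + g) = shrinkMollify S c s ρ f + shrinkMollify S c s ρ g := by
  funext x
  have h := ConvolutionExists.distrib_add
    (ρ.hasCompactSupport_normed.convolutionExists_left (lsmul ℝ ℝ) (ρ.continuous_normed (μ := volume))
      (locallyIntegrable_indicator hS hp hf))
    (ρ.hasCompactSupport_normed.convolutionExists_left (lsmul ℝ ℝ) (ρ.continuous_normed (μ := volume))
      (locallyIntegrable_indicator hS hp hg))
  rw [← Set.indicator_add'] at h
  exact congrFun h _

/-- A point of the small ball is s c' + (1 - s) x with c' in the ball around c, hence interior by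
convexity. A mollifier of radius s r therefore never sees the extension by zero, and its translates
are admissible test functions in `HasWeakDiv`. -/
theorem closedBall_shrink_subset (hS : Convex ℝ S) {r : ℝ}
    (hc : Metric.closedBall c r ⊆ interior S) {s : ℝ} (hs : 0 < s) (hs1 : s ≤ 1)
    {x : EuclideanSpace ℝ (Fin d)} (hx : x ∈ S) :
    Metric.closedBall (s • c + (1 - s) • x) (s * r) ⊆ interior S := by
  intro y hy
  have h1 : s⁻¹ • (y - (1 - s) • x) ∈ Metric.closedBall c r := by
    have : s⁻¹ • (y - (1 - s) • x) - c = s⁻¹ • (y - (s • c + (1 - s) • x)) := by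
      rw [← sub_sub, sub_right_comm, smul_sub s⁻¹ _ (s • c), smul_smul, inv_mul_cancel₀ hs.ne',
        one_smul]
    rw [Metric.mem_closedBall, dist_eq_norm, this, norm_smul, Real.norm_of_nonneg (by positivity),
      inv_mul_le_iff₀ hs, ← dist_eq_norm]
    exact hy
  have h2 := hS.combo_interior_closure_subset_interior hs (sub_nonneg.2 hs1) (by ring)
    (Set.add_mem_add (Set.smul_mem_smul_set (a := s) (hc h1))
      (Set.smul_mem_smul_set (a := 1 - s) (subset_closure hx)))
  simpa [smul_smul, mul_inv_cancel₀ hs.ne'] using h2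

/-- For continuous functions the error of the mollification is controlled by the oscillation. -/
theorem dist_shrinkMollify_le (hS : Convex ℝ S) (hSm : MeasurableSet S) {r : ℝ}
    (hc : Metric.closedBall c r ⊆ interior S) {s : ℝ} (hs : 0 < s) (hs1 : s ≤ 1)
    (hρ : ρ.rOut = s * r) {D : ℝ} (hD : ∀ x ∈ S, dist c x ≤ D)
    {g : EuclideanSpace ℝ (Fin d) → ℝ} (hg : Continuous g) {ε : ℝ} (hε : 0 ≤ ε)
    (hosc : ∀ x y, dist x y ≤ s * (r + D) → dist (g x) (g y) ≤ ε)
    {x : EuclideanSpace ℝ (Fin d)} (hx : x ∈ S) :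
    dist (shrinkMollify S c s ρ g x) (g x) ≤ ε := by
  refine dist_convolution_le hε ρ.support_normed_eq.subset ρ.nonneg_normed ρ.integral_normed
    (hg.aestronglyMeasurable.indicator hSm) fun y hy => ?_
  rw [hρ] at hy
  have hy' := Metric.ball_subset_closedBall hy
  rw [Set.indicator_of_mem (interior_subset (closedBall_shrink_subset c hS hc hs hs1 hx hy'))]
  refine hosc _ _ ((dist_triangle y (s • c + (1 - s) • x) x).trans ?_)
  have h1 : dist (s • c + (1 - s) • x) x = s * dist c x := by
    rw [dist_eq_norm, dist_eq_norm, ← Real.norm_of_nonneg hs.le, ← norm_smul,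
      Real.norm_of_nonneg hs.le]
    congr 1
    module
  rw [h1, mul_add]
  exact add_le_add hy' (mul_le_mul_of_nonneg_left (hD x hx) hs.le)

end Mollify

/-! ### Density of smooth fields -/

section Density

open scoped Convolution
open ContinuousLinearMap (lsmul)

variable {d : ℕ} {S : Set (EuclideanSpace ℝ (Fin d))} (c : EuclideanSpace ℝ (Fin d))

/-- Three-term argument: approximate f by a continuous g of compact support. The operators are
uniformly bounded, which handles f - g, and for g uniform continuity gives uniform convergence on S,
hence in L^p as S has finite measure. -/
theorem tendsto_eLpNorm_shrinkMollify_sub (hS : Convex ℝ S) (hSm : MeasurableSet S)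
    (hSb : Bornology.IsBounded S) {r : ℝ} (hc : Metric.closedBall c r ⊆ interior S)
    {s : ℕ → ℝ} (hs : ∀ n, 0 < s n) (hs2 : ∀ n, s n ≤ 1 / 2) (hs0 : Tendsto s atTop (𝓝 0))
    {ρ : ℕ → ContDiffBump (0 : EuclideanSpace ℝ (Fin d))} (hρ : ∀ n, (ρ n).rOut = s n * r)
    {p : ENNReal} (hp : 1 ≤ p) (hp' : p ≠ ⊤) {f : EuclideanSpace ℝ (Fin d) → ℝ}
    (hf : MemLp f p (volume.restrict S)) :
    Tendsto (fun n => eLpNorm (shrinkMollify S c (s n) (ρ n) f - f) p (volume.restrict S))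
      atTop (𝓝 0) := by
  have hfin : IsFiniteMeasure (volume.restrict S) :=
    ⟨by rw [Measure.restrict_apply_univ]; exact hSb.measure_lt_top⟩
  rw [ENNReal.tendsto_nhds_zero]
  intro ε hε
  by_cases hεt : ε = ⊤
  · simp [hεt]
  obtain ⟨M, hM⟩ : ∃ M : ENNReal, M = volume.restrict S Set.univ ^ p.toReal⁻¹ := ⟨_, rfl⟩
  have hMt : M ≠ ⊤ := by
    rw [hM]
    exact ENNReal.rpow_ne_top_of_nonneg (by positivity) (measure_ne_top _ _)
  -- δ pays for the mollification of f - g (factor 2^d) and for g - f together.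
  obtain ⟨δ, hδ0, hδ⟩ : ∃ δ : ENNReal, δ ≠ 0 ∧ 2 ^ d * δ + δ ≤ ε / 2 := by
    refine ⟨ε / 2 / (2 ^ d + 1), ?_, le_of_eq ?_⟩
    · refine (ENNReal.div_pos (ENNReal.half_pos hε.ne').ne' ?_).ne'
      exact ENNReal.add_ne_top.2 ⟨ENNReal.pow_ne_top (by norm_num), by norm_num⟩
    · rw [← add_one_mul]
      exact ENNReal.mul_div_cancel (by simp)
        (ENNReal.add_ne_top.2 ⟨ENNReal.pow_ne_top (by norm_num), by norm_num⟩)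
  obtain ⟨η, hη0, hη⟩ : ∃ η : ℝ, 0 < η ∧ M * ENNReal.ofReal η ≤ ε / 2 := by
    have h1 : Tendsto (fun η : ℝ => M * ENNReal.ofReal η) (𝓝[>] 0) (𝓝 0) := by
      have := ENNReal.Tendsto.const_mul (a := M)
        ((ENNReal.continuous_ofReal.tendsto 0).mono_left (nhdsWithin_le_nhds (s := Set.Ioi (0 : ℝ))))
        (Or.inr hMt)
      simpa using this
    have h2 := (ENNReal.tendsto_nhds_zero.1 h1 (ε / 2) (ENNReal.half_pos hε.ne')).and
      self_mem_nhdsWithin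
    obtain ⟨η, h3, h4⟩ := h2.exists
    exact ⟨η, h4, h3⟩
  obtain ⟨g, hgc, hfg, hg, hgp⟩ := hf.exists_hasCompactSupport_eLpNorm_sub_le hp' hδ0
  obtain ⟨D, hD⟩ : ∃ D, ∀ x ∈ S, dist c x ≤ D := by
    obtain ⟨D, hD⟩ := hSb.subset_closedBall c
    exact ⟨D, fun x hx => by simpa [dist_comm] using hD hx⟩
  have hosc := Metric.uniformContinuous_iff.1 (hgc.uniformContinuous_of_continuous hg) η hη0
  obtain ⟨κ, hκ0, hκ⟩ := hosc
  have hsmall : ∀ᶠ n in atTop, s n * (r + D) < κ := by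
    have : Tendsto (fun n => s n * (r + D)) atTop (𝓝 0) := by simpa using hs0.mul_const (r + D)
    exact this.eventually (gt_mem_nhds hκ0)
  filter_upwards [hsmall] with n hn
  have hsplit : shrinkMollify S c (s n) (ρ n) f - f = shrinkMollify S c (s n) (ρ n) (f - g) +
      (shrinkMollify S c (s n) (ρ n) g - g) + (g - f) := by
    have h := shrinkMollify_add c (ρ n) hSm (s n) hp (hf.sub hgp) hgp
    rw [sub_add_cancel] at h
    rw [h]
    abel
  have hfs := (contDiff_shrinkMollify c (ρ n) hSm (s n) hp (hf.sub hgp)).continuous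
  have hgs := (contDiff_shrinkMollify c (ρ n) hSm (s n) hp hgp).continuous
  have h1 : eLpNorm (shrinkMollify S c (s n) (ρ n) (f - g)) p (volume.restrict S) ≤
      2 ^ d * δ :=
    (eLpNorm_shrinkMollify_le c (ρ n) hSm (hs2 n) hp hp'
      (hf.sub hgp).aestronglyMeasurable).trans (by gcongr)
  have h2 : eLpNorm (shrinkMollify S c (s n) (ρ n) g - g) p (volume.restrict S) ≤ ε / 2 := by
    refine (eLpNorm_le_of_ae_bound (C := η) ?_).trans (by rw [← hM]; exact hη)
    filter_upwards [ae_restrict_mem hSm] with x hx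
    rw [Pi.sub_apply, ← dist_eq_norm]
    exact dist_shrinkMollify_le c (ρ n) hS hSm hc (hs n) ((hs2 n).trans (by norm_num)) (hρ n) hD hg
      hη0.le (fun x y hxy => (hκ (hxy.trans_lt hn)).le) hx
  have h3 : eLpNorm (g - f) p (volume.restrict S) ≤ δ := by
    rw [eLpNorm_sub_comm]
    exact hfg
  rw [hsplit]
  calc _ ≤ 2 ^ d * δ + ε / 2 + δ := by
        refine (eLpNorm_add_le ((hfs.aestronglyMeasurable).add
          (hgs.sub hg).aestronglyMeasurable) (hgp.sub hf).aestronglyMeasurable hp).trans ?_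
        refine add_le_add ((eLpNorm_add_le hfs.aestronglyMeasurable
          (hgs.sub hg).aestronglyMeasurable hp).trans (add_le_add h1 h2)) h3
    _ = (2 ^ d * δ + δ) + ε / 2 := by ring
    _ ≤ ε / 2 + ε / 2 := by gcongr
    _ = ε := ENNReal.add_halves ε

variable (ρ : ContDiffBump (0 : EuclideanSpace ℝ (Fin d)))

theorem shrinkMollify_eq_setIntegral (hS : MeasurableSet S) (s : ℝ)
    (f : EuclideanSpace ℝ (Fin d) → ℝ) (x : EuclideanSpace ℝ (Fin d)) :
    shrinkMollify S c s ρ f x =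
      ∫ y in S, f y * ρ.normed volume (s • c + (1 - s) • x - y) := by
  rw [shrinkMollify, convolution_lsmul_swap, ← integral_indicator hS]
  refine integral_congr_ae (Eventually.of_forall fun y => ?_)
  by_cases hy : y ∈ S <;> simp [hy, mul_comm]

/-- The derivative is put on the mollifier; the homothety contributes 1 - s by the chain rule. -/
theorem pderiv_shrinkMollify (hS : MeasurableSet S) (s : ℝ) {p : ENNReal} (hp : 1 ≤ p)
    {f : EuclideanSpace ℝ (Fin d) → ℝ} (hf : MemLp f p (volume.restrict S)) (b : Fin d)
    (x : EuclideanSpace ℝ (Fin d)) :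
    pderiv b (shrinkMollify S c s ρ f) x =
      (1 - s) * ∫ y in S, f y * pderiv b (ρ.normed volume) (s • c + (1 - s) • x - y) := by
  have hli := locallyIntegrable_indicator hS hp hf
  have h1 := ρ.hasCompactSupport_normed.hasFDerivAt_convolution_left (lsmul ℝ ℝ)
    (ρ.contDiff_normed (μ := volume)) hli (s • c + (1 - s) • x)
  have h2 : HasFDerivAt (fun x : EuclideanSpace ℝ (Fin d) => s • c + (1 - s) • x)
      ((1 - s) • ContinuousLinearMap.id ℝ _) x :=
    ((hasFDerivAt_id x).const_smul (1 - s)).const_add _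
  have h3 := (h1.comp x h2).fderiv
  have hex := (ρ.hasCompactSupport_normed (μ := volume)).fderiv (𝕜 := ℝ)
    |>.convolutionExists_left ((lsmul ℝ ℝ).precompL (EuclideanSpace ℝ (Fin d)))
      ((ρ.contDiff_normed (μ := volume) (n := 1)).continuous_fderiv (by simp)) hli
      (s • c + (1 - s) • x)
  have h4 : pderiv b (shrinkMollify S c s ρ f) x = (1 - s) *
      (convolution (fderiv ℝ (ρ.normed volume)) (S.indicator f)
        ((lsmul ℝ ℝ).precompL (EuclideanSpace ℝ (Fin d))) volume (s • c + (1 - s) • x))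
        (EuclideanSpace.single b 1) := by
    have h5 : pderiv b (shrinkMollify S c s ρ f) x = _ :=
      congrArg (fun T => T (EuclideanSpace.single b 1)) h3
    rw [h5]
    simp
  rw [h4, convolution, ContinuousLinearMap.integral_apply hex,
    ← integral_sub_left_eq_self _ _ (s • c + (1 - s) • x), ← integral_indicator hS]
  congr 1
  refine integral_congr_ae (Eventually.of_forall fun y => ?_)
  by_cases hy : y ∈ S <;> simp [hy, mul_comm, pderiv]

variable (K : Affine.Simplex ℝ (EuclideanSpace ℝ (Fin d)) d)

/-- The divergence commutes with the mollification, up to the ratio of the homothety. -/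
theorem sum_pderiv_shrinkMollify {r : ℝ}
    (hc : Metric.closedBall c r ⊆ interior K.closedInterior) {s : ℝ} (hs : 0 < s) (hs1 : s ≤ 1)
    (hρ : ρ.rOut = s * r) {p : ENNReal} (hp : 1 ≤ p)
    {τ : EuclideanSpace ℝ (Fin d) → Matrix (Fin d) (Fin d) ℝ}
    {g : EuclideanSpace ℝ (Fin d) → EuclideanSpace ℝ (Fin d)}
    (hτ : ∀ a b, MemLp (fun x => τ x a b) p (vol K)) (hw : HasWeakDiv K τ g) (a : Fin d)
    {x : EuclideanSpace ℝ (Fin d)} (hx : x ∈ K.closedInterior) :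
    ∑ b, pderiv b (shrinkMollify K.closedInterior c s ρ fun y => τ y a b) x =
      (1 - s) * shrinkMollify K.closedInterior c s ρ (fun y => g y a) x := by
  have hm : MeasurableSet K.closedInterior := K.isCompact_closedInterior.isClosed.measurableSet
  obtain ⟨z, hz⟩ : ∃ z, z = s • c + (1 - s) • x := ⟨_, rfl⟩
  have hφ : ContDiff ℝ ∞ fun y => ρ.normed volume (z - y) :=
    ρ.contDiff_normed.comp (contDiff_const.sub contDiff_id)
  have hsub : tsupport (fun y => ρ.normed volume (z - y)) ⊆ Metric.closedBall z (s * r) := by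
    refine closure_minimal (fun y hy => ?_) Metric.isClosed_closedBall
    have : z - y ∈ Function.support (ρ.normed volume) := hy
    rw [ρ.support_normed_eq, hρ, mem_ball_zero_iff] at this
    rw [mem_closedBall_iff_norm, norm_sub_rev]
    exact this.le
  have hcs : HasCompactSupport fun y => ρ.normed volume (z - y) :=
    (isCompact_closedBall z (s * r)).of_isClosed_subset (isClosed_tsupport _) hsub
  have hball := closedBall_shrink_subset c (convex_closedInterior K) hc hs hs1 hx
  rw [← hz] at hball
  -- Differentiating in y instead of z changes the sign, which cancels the minus sign in
  -- `HasWeakDiv`.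
  have hpd : ∀ b y, pderiv b (fun y => ρ.normed volume (z - y)) y =
      -pderiv b (ρ.normed volume) (z - y) := by
    intro b y
    have h1 : HasFDerivAt (fun y : EuclideanSpace ℝ (Fin d) => z - y)
        (-ContinuousLinearMap.id ℝ _) y := (hasFDerivAt_id y).const_sub z
    have h2 := ((ρ.contDiff_normed (μ := volume) (n := 1)).differentiable (by simp)
      (z - y)).hasFDerivAt
    have h3 := (h2.comp y h1).fderiv
    have h5 : pderiv b (fun y => ρ.normed volume (z - y)) y = _ :=
      congrArg (fun T => T (EuclideanSpace.single b 1)) h3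
    rw [h5]
    simp [pderiv]
  have hint : ∀ b, Integrable (fun y => τ y a b * pderiv b (ρ.normed volume) (z - y)) (vol K) := by
    intro b
    have h1 : Continuous fun y => pderiv b (ρ.normed volume) (z - y) :=
      (continuous_pderiv ρ.contDiff_normed b).comp (continuous_const.sub continuous_id)
    have hfin : IsFiniteMeasure (vol K) :=
      ⟨by rw [vol, Measure.restrict_apply_univ]
          exact (isBounded_closedInterior K).measure_lt_top⟩
    have h2 : IntegrableOn (fun y => τ y a b) K.closedInterior volume := (hτ a b).integrable hp
    exact h2.mul_continuousOn h1.continuousOn K.isCompact_closedInterior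
  have hweak := hw _ hφ hcs (hsub.trans hball) a
  simp only [hpd, mul_neg, Finset.sum_neg_distrib, integral_neg, neg_inj] at hweak
  rw [integral_finsetSum _ fun b _ => hint b] at hweak
  rw [shrinkMollify_eq_setIntegral c ρ hm, ← hz]
  change _ = (1 - s) * ∫ y, g y a * ρ.normed volume (z - y) ∂(vol K)
  rw [← hweak, Finset.mul_sum]
  refine Finset.sum_congr rfl fun b _ => ?_
  rw [pderiv_shrinkMollify c ρ hm s hp (hτ a b), ← hz, vol]

theorem tendsto_eLpNorm_of_components {α ι : Type*} [Fintype ι] {m : MeasurableSpace α}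
    {μ : Measure α} {p : ENNReal} (hp : 1 ≤ p) {F : ℕ → α → EuclideanSpace ℝ ι}
    (hF : ∀ n i, AEStronglyMeasurable (fun x => F n x i) μ)
    (h : ∀ i, Tendsto (fun n => eLpNorm (fun x => F n x i) p μ) atTop (𝓝 0)) :
    Tendsto (fun n => eLpNorm (F n) p μ) atTop (𝓝 0) := by
  classical
  have hsum : Tendsto (fun n => ∑ i, eLpNorm (fun x => F n x i) p μ) atTop (𝓝 0) := by
    simpa using tendsto_finsetSum Finset.univ fun i _ => h i
  refine tendsto_of_tendsto_of_tendsto_of_le_of_le tendsto_const_nhds hsum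
    (fun _ => zero_le) fun n => ?_
  have h1 : eLpNorm (F n) p μ ≤ eLpNorm (∑ i, fun x => ‖F n x i‖) p μ := by
    refine eLpNorm_mono_real fun x => ?_
    rw [Finset.sum_apply]
    have h2 : F n x = ∑ i, EuclideanSpace.single i (F n x i) := by
      ext j
      simp [Finset.sum_apply, Pi.single_apply]
    calc ‖F n x‖ = ‖∑ i, EuclideanSpace.single i (F n x i)‖ := by rw [← h2]
      _ ≤ ∑ i, ‖EuclideanSpace.single i (F n x i)‖ := norm_sum_le _ _
      _ = _ := by simp
  refine h1.trans ((eLpNorm_sum_le (fun i _ => (hF n i).norm) hp).trans (le_of_eq ?_))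
  exact Finset.sum_congr rfl fun i _ => eLpNorm_norm _

/-- Fields in `L^p(K)` with weak divergence in `L²(K)` are limits of smooth fields. -/
theorem exists_smoothApprox [NeZero d] {p : ENNReal} (hp : 1 ≤ p) (hp' : p ≠ ⊤)
    {τ : EuclideanSpace ℝ (Fin d) → Matrix (Fin d) (Fin d) ℝ}
    {g : EuclideanSpace ℝ (Fin d) → EuclideanSpace ℝ (Fin d)}
    (hτ : MemLp (fun x => entries (τ x)) p (vol K)) (hg : MemLp g 2 (vol K))
    (hw : HasWeakDiv K τ g) : ∃ σ, SmoothApprox p K τ g σ := by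
  have hm : MeasurableSet K.closedInterior := K.isCompact_closedInterior.isClosed.measurableSet
  have hτc : ∀ a b, MemLp (fun x => τ x a b) p (vol K) := fun a b => hτ.eval_piLp (a, b)
  have hgc : ∀ a, MemLp (fun x => g x a) 2 (vol K) := fun a => hg.eval_piLp a
  obtain ⟨c, hcK⟩ := nonempty_interior K
  obtain ⟨r, hr, hc⟩ := Metric.nhds_basis_closedBall.mem_iff.1 (isOpen_interior.mem_nhds hcK)
  -- The shift by 2 ensures s n ≤ 1 / 2 from n = 0 on.
  obtain ⟨s, hs⟩ : ∃ s : ℕ → ℝ, s = fun n : ℕ => ((n : ℝ) + 2)⁻¹ := ⟨_, rfl⟩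
  have hs0 : ∀ n, 0 < s n := fun n => by rw [hs]; positivity
  have hs2 : ∀ n, s n ≤ 1 / 2 := fun n => by
    rw [hs, one_div]
    exact inv_anti₀ (by norm_num) (by linarith [(Nat.cast_nonneg n : (0 : ℝ) ≤ n)])
  have hst : Tendsto s atTop (𝓝 0) := by
    rw [hs]
    exact tendsto_inv_atTop_zero.comp
      (tendsto_atTop_add_const_right _ _ tendsto_natCast_atTop_atTop)
  obtain ⟨ρ, hρ⟩ : ∃ ρ : ℕ → ContDiffBump (0 : EuclideanSpace ℝ (Fin d)),
      ∀ n, (ρ n).rOut = s n * r :=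
    ⟨fun n => ⟨s n * r / 2, s n * r, half_pos (mul_pos (hs0 n) hr),
      half_lt_self (mul_pos (hs0 n) hr)⟩, fun n => rfl⟩
  have hT : ∀ {p : ENNReal}, 1 ≤ p → p ≠ ⊤ → ∀ {f : EuclideanSpace ℝ (Fin d) → ℝ},
      MemLp f p (vol K) → Tendsto (fun n => eLpNorm
        (shrinkMollify K.closedInterior c (s n) (ρ n) f - f) p (vol K)) atTop (𝓝 0) :=
    fun {p} hp hp' {f} hf => tendsto_eLpNorm_shrinkMollify_sub c (convex_closedInterior K) hm
      (isBounded_closedInterior K) hc hs0 hs2 hst hρ hp hp' hf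
  have hsm : ∀ {p : ENNReal}, 1 ≤ p → ∀ {f : EuclideanSpace ℝ (Fin d) → ℝ},
      MemLp f p (vol K) → ∀ n,
        ContDiff ℝ ∞ (shrinkMollify K.closedInterior c (s n) (ρ n) f) :=
    fun {p} hp {f} hf n => contDiff_shrinkMollify c (ρ n) hm (s n) hp hf
  refine ⟨fun n x => Matrix.of fun a b =>
    shrinkMollify K.closedInterior c (s n) (ρ n) (fun y => τ y a b) x,
    fun n a b => hsm hp (hτc a b) n, ?_, ?_⟩
  · refine tendsto_eLpNorm_of_components hp (fun n ab => ?_) fun ab => hT hp hp' (hτc ab.1 ab.2)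
    exact (hsm hp (hτc ab.1 ab.2) n).continuous.aestronglyMeasurable.sub
      (hτc ab.1 ab.2).aestronglyMeasurable
  · have h12 : (1 : ENNReal) ≤ 2 := by norm_num
    -- The divergence of the approximation is (1 - s) times the mollified g. Its error splits into
    -- the mollification error and s g, which both tend to 0.
    have hcomp : ∀ n a, (fun x => (classicalDiv (fun x => Matrix.of fun a b =>
        shrinkMollify K.closedInterior c (s n) (ρ n) (fun y => τ y a b) x) x - g x) a)
        =ᵐ[vol K] (1 - s n) • (shrinkMollify K.closedInterior c (s n) (ρ n) (fun y => g y a) -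
          fun y => g y a) - s n • fun y => g y a := by
      intro n a
      filter_upwards [ae_restrict_mem hm] with x hx
      have h1 := sum_pderiv_shrinkMollify c (ρ n) K hc (hs0 n) ((hs2 n).trans (by norm_num))
        (hρ n) hp hτc hw a hx
      change ∑ b, pderiv b (shrinkMollify K.closedInterior c (s n) (ρ n) fun y => τ y a b) x -
        g x a = _
      rw [h1]
      simp
      ring
    have hmeas : ∀ n a, AEStronglyMeasurable
        (shrinkMollify K.closedInterior c (s n) (ρ n) (fun y => g y a) - fun y => g y a) (vol K) :=
      fun n a => (hsm h12 (hgc a) n).continuous.aestronglyMeasurable.sub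
        (hgc a).aestronglyMeasurable
    refine tendsto_eLpNorm_of_components h12 (fun n a => ?_) fun a => ?_
    · refine AEStronglyMeasurable.congr ?_ (hcomp n a).symm
      exact ((hmeas n a).const_smul _).sub ((hgc a).aestronglyMeasurable.const_smul _)
    · have hlim : Tendsto (fun n => eLpNorm (shrinkMollify K.closedInterior c (s n) (ρ n)
          (fun y => g y a) - fun y => g y a) 2 (vol K) +
          ENNReal.ofReal (s n) * eLpNorm (fun y => g y a) 2 (vol K)) atTop (𝓝 0) := by
        have h2 := ENNReal.Tendsto.mul_const (b := eLpNorm (fun y => g y a) 2 (vol K))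
          ((ENNReal.continuous_ofReal.tendsto 0).comp hst) (Or.inr (hgc a).2.ne)
        simpa using (hT h12 (by norm_num) (hgc a)).add h2
      refine tendsto_of_tendsto_of_tendsto_of_le_of_le tendsto_const_nhds hlim
        (fun _ => zero_le) fun n => ?_
      rw [eLpNorm_congr_ae (hcomp n a)]
      refine (eLpNorm_sub_le ((hmeas n a).const_smul _)
        ((hgc a).aestronglyMeasurable.const_smul _) h12).trans ?_
      rw [eLpNorm_const_smul, eLpNorm_const_smul]
      refine add_le_add (mul_le_of_le_one_left' ?_) (le_of_eq ?_)
      · rw [Real.enorm_eq_ofReal_abs, ENNReal.ofReal_le_one, abs_le]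
        constructor <;> linarith [hs0 n, hs2 n]
      · rw [Real.enorm_of_nonneg (hs0 n).le]

end Density

/-! ### The normal trace by density -/

section Trace

theorem classicalDiv_sub {d : ℕ} {σ σ' : EuclideanSpace ℝ (Fin d) → Matrix (Fin d) (Fin d) ℝ}
    (hσ : ∀ a b, ContDiff ℝ 1 fun x => σ x a b) (hσ' : ∀ a b, ContDiff ℝ 1 fun x => σ' x a b)
    (x : EuclideanSpace ℝ (Fin d)) :
    classicalDiv (fun x => σ x - σ' x) x = classicalDiv σ x - classicalDiv σ' x := by
  ext a
  simp only [classicalDiv, pderiv, Matrix.sub_apply, PiLp.sub_apply, ← Finset.sum_sub_distrib]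
  refine Finset.sum_congr rfl fun b _ => ?_
  rw [fderiv_fun_sub ((hσ a b).differentiable (by simp) x) ((hσ' a b).differentiable (by simp) x)]
  rfl

variable {N : ℕ} (K : Affine.Simplex ℝ (EuclideanSpace ℝ (Fin (N + 1))) (N + 1))

theorem classicalFlux_sub (i : Fin (N + 1 + 1))
    {σ σ' : EuclideanSpace ℝ (Fin (N + 1)) → Matrix (Fin (N + 1)) (Fin (N + 1)) ℝ}
    (hσ : ∀ a b, Continuous fun x => σ x a b) (hσ' : ∀ a b, Continuous fun x => σ' x a b)
    {v : EuclideanSpace ℝ (Fin (N + 1)) → EuclideanSpace ℝ (Fin (N + 1))} (hv : Continuous v) :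
    classicalFlux K i (fun x => σ x - σ' x) v = classicalFlux K i σ v - classicalFlux K i σ' v := by
  have hint : ∀ σ : EuclideanSpace ℝ (Fin (N + 1)) → Matrix (Fin (N + 1)) (Fin (N + 1)) ℝ,
      (∀ a b, Continuous fun x => σ x a b) →
      Integrable (fun x => inner ℝ (v x) (mulVec (σ x) (outwardNormal K i))) (surf K i) := by
    intro σ hσ
    refine integrable_surf_of_continuous K ?_ i
    simp only [inner_mulVec]
    refine continuous_finsetSum _ fun a _ => continuous_finsetSum _ fun b _ => ?_
    have : Continuous fun x => v x a := by fun_prop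
    exact continuous_const.mul (this.mul (hσ a b))
  rw [classicalFlux, classicalFlux, classicalFlux, ← integral_sub (hint σ hσ) (hint σ' hσ')]
  refine integral_congr_ae (Eventually.of_forall fun x => ?_)
  simp only [inner_mulVec, ← Finset.sum_sub_distrib, Matrix.sub_apply]
  refine Finset.sum_congr rfl fun a _ => Finset.sum_congr rfl fun b _ => ?_
  ring

theorem toReal_eLpNorm_sub_le {α V : Type*} [NormedAddCommGroup V] {m : MeasurableSpace α}
    {μ : Measure α} {p : ENNReal} (hp : 1 ≤ p) {f g h : α → V} (hf : MemLp f p μ)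
    (hg : MemLp g p μ) (hh : MemLp h p μ) :
    (eLpNorm (fun x => f x - g x) p μ).toReal ≤
      (eLpNorm (fun x => f x - h x) p μ).toReal + (eLpNorm (fun x => g x - h x) p μ).toReal := by
  have hfh : eLpNorm (fun x => f x - h x) p μ ≠ ⊤ := (hf.sub hh).2.ne
  have hgh : eLpNorm (fun x => g x - h x) p μ ≠ ⊤ := (hg.sub hh).2.ne
  rw [← ENNReal.toReal_add hfh hgh]
  refine ENNReal.toReal_mono (ENNReal.add_ne_top.2 ⟨hfh, hgh⟩) ?_
  have h1 : (fun x => f x - g x) = (fun x => f x - h x) - fun x => g x - h x := by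
    funext x
    simp
  rw [h1]
  exact eLpNorm_sub_le (hf.sub hh).1 (hg.sub hh).1 hp

/-- Reverse triangle inequality, from two applications of `toReal_eLpNorm_sub_le` with subtracted
field 0. -/
theorem tendsto_toReal_eLpNorm {α V : Type*} [NormedAddCommGroup V] {m : MeasurableSpace α}
    {μ : Measure α} {p : ENNReal} (hp : 1 ≤ p) {F : ℕ → α → V} {h : α → V}
    (hF : ∀ n, MemLp (F n) p μ) (hh : MemLp h p μ)
    (hlim : Tendsto (fun n => eLpNorm (fun x => F n x - h x) p μ) atTop (𝓝 0)) :
    Tendsto (fun n => (eLpNorm (F n) p μ).toReal) atTop (𝓝 (eLpNorm h p μ).toReal) := by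
  have hlim' := (ENNReal.tendsto_toReal ENNReal.zero_ne_top).comp hlim
  rw [tendsto_iff_dist_tendsto_zero]
  refine squeeze_zero (fun _ => dist_nonneg) (fun n => ?_) hlim'
  have h0 : MemLp (fun _ : α => (0 : V)) p μ := MemLp.zero
  have h1 := toReal_eLpNorm_sub_le hp (hF n) h0 hh
  have h2 := toReal_eLpNorm_sub_le hp hh h0 (hF n)
  have h3 : eLpNorm (fun x => h x - F n x) p μ = eLpNorm (fun x => F n x - h x) p μ :=
    eLpNorm_sub_comm h (F n) p μ
  simp only [sub_zero, zero_sub] at h1 h2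
  rw [h3] at h2
  have h4 : eLpNorm (fun x => -h x) p μ = eLpNorm h p μ := eLpNorm_neg h p μ
  have h5 : eLpNorm (fun x => -F n x) p μ = eLpNorm (F n) p μ := eLpNorm_neg (F n) p μ
  rw [h4] at h1
  rw [h5] at h2
  rw [Real.dist_eq, abs_le]
  constructor <;> simp only [Function.comp_apply] <;> linarith

/-- A bound of the classical flux by the norms of the field and of its divergence extends to the
fields which can be approximated by smooth ones. -/
theorem exists_hasFaceFlux_le (i : Fin (N + 1 + 1)) {p : ENNReal} (hp : 1 ≤ p)
    {v : EuclideanSpace ℝ (Fin (N + 1)) → EuclideanSpace ℝ (Fin (N + 1))} (hv : Continuous v)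
    {A D₁ D₂ : ℝ} (hbd : ∀ σ : EuclideanSpace ℝ (Fin (N + 1)) →
        Matrix (Fin (N + 1)) (Fin (N + 1)) ℝ, (∀ a b, ContDiff ℝ 1 fun x => σ x a b) →
      |classicalFlux K i σ v| ≤ A * (D₁ * (eLpNorm (classicalDiv σ) 2 (vol K)).toReal +
        D₂ * (eLpNorm (fun x => entries (σ x)) p (vol K)).toReal))
    (hA : 0 ≤ A) (hD₁ : 0 ≤ D₁) (hD₂ : 0 ≤ D₂)
    {τ : EuclideanSpace ℝ (Fin (N + 1)) → Matrix (Fin (N + 1)) (Fin (N + 1)) ℝ}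
    {g : EuclideanSpace ℝ (Fin (N + 1)) → EuclideanSpace ℝ (Fin (N + 1))}
    (hτ : MemLp (fun x => entries (τ x)) p (vol K)) (hg : MemLp g 2 (vol K))
    (hex : ∃ σ, SmoothApprox p K τ g σ) :
    ∃ I, HasFaceFlux p K i τ g v I ∧ I ≤ A * (D₁ * (eLpNorm g 2 (vol K)).toReal +
      D₂ * (eLpNorm (fun x => entries (τ x)) p (vol K)).toReal) := by
  have hone : ∀ {σ : ℕ → EuclideanSpace ℝ (Fin (N + 1)) → Matrix (Fin (N + 1)) (Fin (N + 1)) ℝ},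
      SmoothApprox p K τ g σ → ∀ n a b, ContDiff ℝ 1 fun x => σ n x a b :=
    fun h n a b => (h.smooth n a b).of_le (by exact_mod_cast le_top)
  have hent : ∀ {σ : ℕ → EuclideanSpace ℝ (Fin (N + 1)) → Matrix (Fin (N + 1)) (Fin (N + 1)) ℝ},
      SmoothApprox p K τ g σ → ∀ n, MemLp (fun x => entries (σ n x)) p (vol K) :=
    fun h n => memLp_vol_of_continuous K
      (continuous_entries fun a b => (hone h n a b).continuous) p
  have hdiv : ∀ {σ : ℕ → EuclideanSpace ℝ (Fin (N + 1)) → Matrix (Fin (N + 1)) (Fin (N + 1)) ℝ},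
      SmoothApprox p K τ g σ → ∀ n, MemLp (classicalDiv (σ n)) 2 (vol K) :=
    fun h n => memLp_vol_of_continuous K (continuous_classicalDiv (hone h n)) 2
  -- The bound for the difference of two approximations, taken from possibly different sequences.
  -- With equal sequences it gives the Cauchy property; with different ones, on the diagonal, the
  -- independence of the limit.
  have key : ∀ {σ σ' : ℕ → EuclideanSpace ℝ (Fin (N + 1)) → Matrix (Fin (N + 1)) (Fin (N + 1)) ℝ},
      SmoothApprox p K τ g σ → SmoothApprox p K τ g σ' →
      Tendsto (fun mn : ℕ × ℕ => dist (classicalFlux K i (σ mn.1) v)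
        (classicalFlux K i (σ' mn.2) v)) atTop (𝓝 0) := by
    intro σ σ' h h'
    rw [← prod_atTop_atTop_eq]
    have t1 := (ENNReal.tendsto_toReal ENNReal.zero_ne_top).comp h.tendsto_field
    have t2 := (ENNReal.tendsto_toReal ENNReal.zero_ne_top).comp h'.tendsto_field
    have t3 := (ENNReal.tendsto_toReal ENNReal.zero_ne_top).comp h.tendsto_div
    have t4 := (ENNReal.tendsto_toReal ENNReal.zero_ne_top).comp h'.tendsto_div
    have hfst : Tendsto Prod.fst ((atTop : Filter ℕ) ×ˢ (atTop : Filter ℕ)) atTop := tendsto_fst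
    have hsnd : Tendsto Prod.snd ((atTop : Filter ℕ) ×ˢ (atTop : Filter ℕ)) atTop := tendsto_snd
    have t := ((((t3.comp hfst).add (t4.comp hsnd)).const_mul D₁).add
      (((t1.comp hfst).add (t2.comp hsnd)).const_mul D₂)).const_mul A
    simp only [ENNReal.toReal_zero, add_zero, mul_zero] at t
    refine squeeze_zero (fun _ => dist_nonneg) (fun mn => ?_) t
    have h1 := hbd (fun x => σ mn.1 x - σ' mn.2 x) fun a b =>
      (hone h mn.1 a b).sub (hone h' mn.2 a b)
    rw [classicalFlux_sub K i (fun a b => (hone h mn.1 a b).continuous)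
      (fun a b => (hone h' mn.2 a b).continuous) hv] at h1
    rw [Real.dist_eq]
    refine h1.trans ?_
    have h2 := toReal_eLpNorm_sub_le (by norm_num) (hdiv h mn.1) (hdiv h' mn.2) hg
    have h3 := toReal_eLpNorm_sub_le hp (hent h mn.1) (hent h' mn.2) hτ
    rw [← funext (classicalDiv_sub (hone h mn.1) (hone h' mn.2))] at h2
    simp only [Function.comp_apply]
    gcongr
    exact h3
  obtain ⟨σ, hσ⟩ := hex
  have hcauchy : CauchySeq fun n => classicalFlux K i (σ n) v :=
    cauchySeq_iff_tendsto_dist_atTop_0.2 (key hσ hσ)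
  obtain ⟨I, hI⟩ := cauchySeq_tendsto_of_complete hcauchy
  refine ⟨I, ⟨⟨σ, hσ⟩, fun σ' hσ' => ?_⟩, ?_⟩
  · have h1 := (key hσ hσ').comp (tendsto_atTop_diagonal (α := ℕ))
    exact (tendsto_iff_of_dist h1).1 hI
  · have h1 := tendsto_toReal_eLpNorm (by norm_num) (hdiv hσ) hg hσ.tendsto_div
    have h2 := tendsto_toReal_eLpNorm hp (hent hσ) hτ hσ.tendsto_field
    exact le_of_tendsto_of_tendsto' hI (((h1.const_mul D₁).add (h2.const_mul D₂)).const_mul A)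
      fun n => (le_abs_self _).trans (hbd (σ n) (hone hσ n))

end Trace

end FaceTrace

end

theorem propositionA1 (d : ℕ) [NeZero d] (hd : d = 2 ∨ d = 3) (p : ℝ) (hp : 2 < p)
    (θ : ℝ) (hθ : 0 < θ) (k : ℕ) :
    ∃ C : ℝ, 0 < C ∧
      ∀ K : Affine.Simplex ℝ (EuclideanSpace ℝ (Fin d)) d, FaceTrace.MinAngleGE K θ →
      ∀ i : Fin (d + 1),
      ∀ (τ : EuclideanSpace ℝ (Fin d) → Matrix (Fin d) (Fin d) ℝ)
        (divτ : EuclideanSpace ℝ (Fin d) → EuclideanSpace ℝ (Fin d)),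
        MemLp (fun x => FaceTrace.entries (τ x)) (ENNReal.ofReal p) (FaceTrace.vol K) →
        (∀ᵐ x ∂(FaceTrace.vol K), (τ x).IsSymm) →
        MemLp divτ 2 (FaceTrace.vol K) →
        FaceTrace.HasWeakDiv K τ divτ →
      ∀ q : Fin d → MvPolynomial (Fin d) ℝ, (∀ a, (q a).totalDegree ≤ k) →
        ∃ I : ℝ,
          FaceTrace.HasFaceFlux (ENNReal.ofReal p) K i τ divτ (FaceTrace.polyField q) I ∧
          I ≤ C * FaceTrace.diam K ^ (-(1 / 2) : ℝ) *
            (eLpNorm (FaceTrace.polyField q) 2 (FaceTrace.surf K i)).toReal *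
            (FaceTrace.diam K * (eLpNorm divτ 2 (FaceTrace.vol K)).toReal +
              FaceTrace.diam K ^ ((d : ℝ) * (p - 2) / (2 * p)) *
                (eLpNorm (fun x => FaceTrace.entries (τ x)) (ENNReal.ofReal p)
                  (FaceTrace.vol K)).toReal) := by
  obtain ⟨B, hB, hgrad⟩ := FaceTrace.exists_norm_grad_le d hd hθ
  -- The dimension N = d - 1 of the faces becomes the parameter; d ≥ 2 gives N ≥ 1.
  obtain ⟨N, rfl⟩ : ∃ N, d = N + 1 := ⟨d - 1, by omega⟩
  obtain ⟨C, hC, hbd⟩ := FaceTrace.exists_abs_classicalFlux_le N (by omega) hp k hB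
  refine ⟨C, hC, fun K hK i τ divτ hτ _ hdivτ hw q hq => ?_⟩
  have hp1 : 1 ≤ ENNReal.ofReal p := by
    rw [← ENNReal.ofReal_one]
    exact ENNReal.ofReal_le_ofReal (by linarith)
  have hD := (FaceTrace.diam_pos K).le
  rw [Nat.cast_add_one]
  exact FaceTrace.exists_hasFaceFlux_le K i hp1 (FaceTrace.continuous_polyField q)
    (fun σ hσ => hbd K (hgrad K hK) i q hq σ hσ) (by positivity) hD (by positivity) hτ hdivτ
    (FaceTrace.exists_smoothApprox K hp1 ENNReal.ofReal_ne_top hτ hdivτ hw)
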